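/- Notation. Let $d\in\mathbb N$. For $r>0$ let $\mathcal B_r^d$ be the Borel subsets of $\{x\in\mathbb R^d:|x|\ge r\}$ and $\mathcal B_0^d=\bigcup_{r>0}\mathcal B_r^d$. A Lévy measure is a Borel measure $\eta$ on $\mathbb R^d$ with $\eta(\{0\})=0$ and $\int(1\wedge|x|^2)\,\eta(dx)<\infty$. A quasi-Lévy type measure is a function $\nu:\mathcal B_0^d\to\mathbb R$ whose restriction to $\mathcal B_r^d$ is a finite signed measure for every $r>0$, and for which $x\mapsto 1\wedge|x|^2$ is integrable with respect to $\nu^+ +\nu^-$; here $\nu^\pm$ are the unique Borel measures on $\mathbb R^d$ with $\nu^\pm(\{0\})=0$ that agree on each $\mathcal B_r^d$ with the positive/negative part of $\nu_{|\mathcal B_r^d}$, and $\int f\,d\nu:=\int f\,d\nu^+-\int f\,d\nu^-$. A representation function is a bounded Borel measurable $c:\mathbb R^d\to\mathbb R^d$ with $\lim_{x\to0}|x|^{-2}|c(x)-x|=0$. A probability distribution $\mu$ on $\mathbb R^d$ is quasi-infinitely divisible if $\widehat\mu=\widehat\mu_1/\widehat\mu_2$ for two infinitely divisible distributions $\mu_1,\mu_2$;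 its characteristic triplet $(A,\nu,\gamma)_c$ with respect to $c$ consists of the symmetric matrix $A\in\mathbb R^{d\times d}$, the quasi-Lévy type measure $\nu$ and the vector $\gamma\in\mathbb R^d$ such that for all $z\in\mathbb R^d$ $$\widehat\mu(z)=\exp\Big(i\langle\gamma,z\rangle-\tfrac12\langle z,Az\rangle+\int_{\mathbb R^d}\big(e^{i\langle z,x\rangle}-1-i\langle z,c(x)\rangle\big)\,\nu(dx)\Big).$$ Let $C_\#$ be the set of bounded continuous functions $f:\mathbb R^d\to\mathbb R$ that vanish on a neighbourhood of $0$. Theorem. Let $c$ be a continuous representation function on $\mathbb R^d$, and for $n\in\mathbb N$ let $\mu_n$ be a quasi-infinitely divisible distribution on $\mathbb R^d$ with characteristic triplet $(A_n,\nu_n,\gamma_n)_c$. Suppose that $(\mu_n)$ converges weakly to some distribution $\mu$ and that there is a Lévy measure $\sigma$ on $\mathbb R^d$ such that $$\lim_{n\to\infty}\int f\,d\nu_n^-=\int f\,d\sigma\quad\text{for all } f\in C_\#,\qquad \lim_{\varepsilon\downarrow0}\limsup_{n\to\infty}\int_{|x|\le\varepsilon}|x|^2\,\nu_n^-(dx)=0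 .$$ Then $\mu$ is quasi-infinitely divisible. Moreover, if $(A,\nu,\gamma)_c$ is its characteristic triplet, then: (i) $\nu+\sigma$ is a Lévy measure, i.e. there is a (necessarily unique) Lévy measure $\eta$ with $\eta(B)=\nu(B)+\sigma(B)$ for all $B\in\mathcal B_0^d$, and $\lim_{n\to\infty}\int f\,d\nu_n^+=\int f\,d\eta$ for all $f\in C_\#$; (ii) $\gamma_n\to\gamma$ as $n\to\infty$; (iii) if $A_{n,\varepsilon}\in\mathbb R^{d\times d}$ is the symmetric matrix with $$\langle z,A_{n,\varepsilon}z\rangle=\langle z,A_nz\rangle+\int_{|x|\le\varepsilon}\langle z,x\rangle^2\,\nu_n^+(dx)\quad\text{for all } z\in\mathbb R^d,$$ then $\lim_{\varepsilon\downarrow0}\limsup_{n\to\infty}|\langle z,A_{n,\varepsilon}z\rangle-\langle z,Az\rangle|=0$ for all $z\in\mathbb R^d$. -/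

import Mathlib

open MeasureTheory Filter Topology
open scoped ENNReal RealInnerProductSpace BoundedContinuousFunction Matrix

noncomputable section

namespace QID

/-- Euclidean space `ℝ^d`. -/
abbrev Rd (d : ℕ) : Type := EuclideanSpace ℝ (Fin d)

variable {d : ℕ}

/-! ### Infinitely divisible and quasi-infinitely divisible distributions -/

/-- The `n`-fold convolution product of a measure with itself (`δ_0` for `n = 0`). -/
def convPow (ρ : Measure (Rd d)) : ℕ → Measure (Rd d)
  | 0 => Measure.dirac 0
  | n + 1 => Measure.conv (convPow ρ n) ρ

/-- A distribution is infinitely divisible if for every `n ≥ 1` it is the `n`-fold convolution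
of some distribution with itself. -/
def IsInfinitelyDivisible (μ : ProbabilityMeasure (Rd d)) : Prop :=
  ∀ n : ℕ, 1 ≤ n → ∃ ρ : ProbabilityMeasure (Rd d), (μ : Measure (Rd d)) = convPow ρ n

/-- A distribution is quasi-infinitely divisible if its characteristic function is the quotient
of the characteristic functions of two infinitely divisible distributions. -/
def IsQuasiInfinitelyDivisible (μ : ProbabilityMeasure (Rd d)) : Prop :=
  ∃ μ₁ μ₂ : ProbabilityMeasure (Rd d), IsInfinitelyDivisible μ₁ ∧ IsInfinitelyDivisible μ₂ ∧
    ∀ z : Rd d, charFun (μ : Measure (Rd d)) z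
      = charFun (μ₁ : Measure (Rd d)) z / charFun (μ₂ : Measure (Rd d)) z

/-! ### Lévy measures, representation functions and test functions -/

/-- A Lévy measure: a Borel measure `η` with `η {0} = 0` and `∫ (1 ∧ |x|^2) η(dx) < ∞`. -/
def IsLevyMeasure (η : Measure (Rd d)) : Prop :=
  η {0} = 0 ∧ ∫⁻ x, min 1 (‖x‖ₑ ^ 2) ∂η < ∞

/-- A representation function: bounded, Borel measurable, with
`|x|^{-2} |c(x) - x| → 0` as `x → 0`. -/
structure IsRepresentationFunction (c : Rd d → Rd d) : Prop where
  bounded : ∃ C : ℝ, ∀ x, ‖c x‖ ≤ C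
  measurable : Measurable c
  tendsto_zero : Tendsto (fun x : Rd d => (‖x‖ ^ 2)⁻¹ * ‖c x - x‖) (𝓝[≠] 0) (𝓝 0)

/-- `C_#`: bounded continuous real functions vanishing on a neighbourhood of `0`. -/
def CSharp (d : ℕ) : Set (Rd d →ᵇ ℝ) := {f | ∀ᶠ x in 𝓝 (0 : Rd d), f x = 0}

/-! ### Quasi-Lévy type measures -/

/-- `B_r^d`: the Borel subsets of `{x : |x| ≥ r}`. -/
def BorelAway (d : ℕ) (r : ℝ) : Set (Set (Rd d)) :=
  {B | MeasurableSet B ∧ ∀ x ∈ B, r ≤ ‖x‖}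

/-- `B_0^d = ⋃_{r > 0} B_r^d`: the Borel sets that are bounded away from `0`. -/
def BorelAwayZero (d : ℕ) : Set (Set (Rd d)) :=
  {B | ∃ r : ℝ, 0 < r ∧ B ∈ BorelAway d r}

/-- A function `ν : B_0^d → ℝ` whose restriction to `B_r^d` is a finite signed measure
for every `r > 0`. -/
structure SignedMeasureAwayZero (d : ℕ) where
  toFun : BorelAwayZero d → ℝ
  isSigned : ∀ r : ℝ, 0 < r → ∃ s : SignedMeasure (Rd d),
    ∀ B : BorelAwayZero d, (B : Set (Rd d)) ∈ BorelAway d r → s B = toFun B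

lemma measurableSet_away (r : ℝ) : MeasurableSet {x : Rd d | r ≤ ‖x‖} :=
  measurableSet_le measurable_const measurable_norm

/-- The shell `{x ≠ 0 : n ≤ 1 / |x| < n + 1}`; these partition `ℝ^d ∖ {0}`. -/
def shell (d : ℕ) (n : ℕ) : Set (Rd d) := {x | x ≠ 0 ∧ ⌊‖x‖⁻¹⌋₊ = n}

lemma measurableSet_shell (n : ℕ) : MeasurableSet (shell d n) := by
  refine (measurableSet_singleton (0 : Rd d)).compl.inter ?_
  exact (Nat.measurable_floor.comp measurable_norm.inv) (measurableSet_singleton n)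

lemma shell_away {n : ℕ} {x : Rd d} (hx : x ∈ shell d n) : ((n : ℝ) + 1)⁻¹ ≤ ‖x‖ := by
  have h0 : 0 < ‖x‖ := norm_pos_iff.2 hx.1
  have h1 := Nat.lt_floor_add_one (‖x‖⁻¹)
  rw [hx.2] at h1
  exact (inv_lt_of_inv_lt₀ h0 h1).le

/-- The measure on `ℝ^d` without mass at `0` that is obtained from the measures `m r` on
`{x : |x| ≥ r}`, `r > 0`, by gluing them along the shells. -/
def glue (m : ℝ → Measure (Rd d)) : Measure (Rd d) :=
  Measure.sum fun n : ℕ => (m ((n : ℝ) + 1)⁻¹).restrict (shell d n)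

lemma glue_zero (m : ℝ → Measure (Rd d)) : glue m {0} = 0 := by
  rw [glue, Measure.sum_apply _ (measurableSet_singleton _)]
  refine ENNReal.tsum_eq_zero.2 fun n => ?_
  rw [Measure.restrict_apply (measurableSet_singleton _)]
  have : ({0} : Set (Rd d)) ∩ shell d n = ∅ := by
    ext x; simp +contextual [shell]
  simp [this]

lemma glue_apply (m : ℝ → Measure (Rd d))
    (hm : ∀ r s : ℝ, 0 < r → 0 < s → ∀ B, B ∈ BorelAway d r → B ∈ BorelAway d s → m r B = m s B)
    {r : ℝ} (hr : 0 < r) {B : Set (Rd d)} (hB : B ∈ BorelAway d r) : glue m B = m r B := by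
  have hU : B = ⋃ n, B ∩ shell d n := by
    ext x
    simp only [Set.mem_iUnion, Set.mem_inter_iff, exists_and_left, iff_self_and]
    intro hx
    exact ⟨_, norm_pos_iff.1 (hr.trans_le (hB.2 x hx)), rfl⟩
  have hd : Pairwise (Function.onFun Disjoint fun n => B ∩ shell d n) := by
    intro i j hij
    refine Set.disjoint_left.2 fun x hx hx' => hij ?_
    rw [← hx.2.2, ← hx'.2.2]
  rw [glue, Measure.sum_apply _ hB.1]
  conv_rhs => rw [hU, measure_iUnion hd fun n => hB.1.inter (measurableSet_shell n)]
  congr 1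
  ext n
  rw [Measure.restrict_apply hB.1]
  exact hm _ _ (by positivity) hr _ ⟨hB.1.inter (measurableSet_shell n), fun x hx => shell_away hx.2⟩
    ⟨hB.1.inter (measurableSet_shell n), fun x hx => hB.2 x hx.1⟩

namespace SignedMeasureAwayZero

/-- The finite signed measure `B ↦ ν(B ∩ {x : |x| ≥ r})` on `ℝ^d`, that is, `ν` restricted to
`B_r^d` (and the zero measure for `r ≤ 0`). -/
def restr (ν : SignedMeasureAwayZero d) (r : ℝ) : SignedMeasure (Rd d) :=
  if hr : 0 < r then (ν.isSigned r hr).choose.restrict {x | r ≤ ‖x‖} else 0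

lemma inter_mem {r : ℝ} (hr : 0 < r) {B : Set (Rd d)} (hB : MeasurableSet B) :
    B ∩ {x : Rd d | r ≤ ‖x‖} ∈ BorelAwayZero d :=
  ⟨r, hr, hB.inter (measurableSet_away r), fun _ hx => hx.2⟩

lemma restr_apply (ν : SignedMeasureAwayZero d) {r : ℝ} (hr : 0 < r) {B : Set (Rd d)}
    (hB : MeasurableSet B) :
    ν.restr r B = ν.toFun ⟨B ∩ {x | r ≤ ‖x‖}, inter_mem hr hB⟩ := by
  rw [restr, dif_pos hr, VectorMeasure.restrict_apply _ (measurableSet_away r) hB]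
  exact (ν.isSigned r hr).choose_spec ⟨_, inter_mem hr hB⟩
    ⟨hB.inter (measurableSet_away r), fun _ hx => hx.2⟩

/-- The positive part `ν⁺`, the measure on `ℝ^d` with `ν⁺ {0} = 0` that agrees on `B_r^d` with the
positive part of the restriction of `ν` to `B_r^d`, for every `r > 0`. -/
def posPart (ν : SignedMeasureAwayZero d) : Measure (Rd d) :=
  glue fun r => (ν.restr r).toJordanDecomposition.posPart

/-- The negative part `ν⁻`, the measure on `ℝ^d` with `ν⁻ {0} = 0` that agrees on `B_r^d` with the
negative part of the restriction of `ν` to `B_r^d`, for every `r > 0`. -/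
def negPart (ν : SignedMeasureAwayZero d) : Measure (Rd d) :=
  glue fun r => (ν.restr r).toJordanDecomposition.negPart

/-- The total variation `|ν| = ν⁺ + ν⁻`. -/
def totalVariation (ν : SignedMeasureAwayZero d) : Measure (Rd d) := ν.posPart + ν.negPart

end SignedMeasureAwayZero

/-- Restriction of a Jordan decomposition to a measurable set. -/
def jordanRestrict (j : JordanDecomposition (Rd d)) (S : Set (Rd d)) :
    JordanDecomposition (Rd d) where
  posPart := j.posPart.restrict S
  negPart := j.negPart.restrict S
  mutuallySingular := (j.mutuallySingular.restrict S).symm.restrict S |>.symm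

lemma jordan_restr_eq (ν : SignedMeasureAwayZero d) {r s : ℝ} (hr : 0 < r) (hrs : r ≤ s) :
    (ν.restr s).toJordanDecomposition
      = jordanRestrict (ν.restr r).toJordanDecomposition {x | s ≤ ‖x‖} := by
  apply SignedMeasure.toJordanDecomposition_eq
  ext B hB
  rw [ν.restr_apply (hr.trans_le hrs) hB, JordanDecomposition.toSignedMeasure,
    _root_.sub_apply, Measure.toSignedMeasure_apply_measurable hB,
    Measure.toSignedMeasure_apply_measurable hB]
  simp only [jordanRestrict, measureReal_restrict_apply hB]
  rw [← SignedMeasure.apply_eq_posPart_real_sub_negPart_real _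
    (hB.inter (measurableSet_away s)), ν.restr_apply hr (hB.inter (measurableSet_away s))]
  congr 1
  ext x
  simp only [Set.mem_inter_iff, Set.mem_ofPred_eq]
  constructor
  · rintro ⟨h1, h2⟩; exact ⟨⟨h1, h2⟩, hrs.trans h2⟩
  · rintro ⟨h, _⟩; exact h

lemma jordan_consistent (ν : SignedMeasureAwayZero d) {r s : ℝ} (hr : 0 < r) (hs : 0 < s)
    {B : Set (Rd d)} (hBr : B ∈ BorelAway d r) (hBs : B ∈ BorelAway d s) :
    (ν.restr r).toJordanDecomposition.posPart B = (ν.restr s).toJordanDecomposition.posPart B ∧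
    (ν.restr r).toJordanDecomposition.negPart B = (ν.restr s).toJordanDecomposition.negPart B := by
  wlog h : r ≤ s generalizing r s
  · have := this hs hr hBs hBr (le_of_not_ge h)
    exact ⟨this.1.symm, this.2.symm⟩
  rw [jordan_restr_eq ν hr h]
  simp only [jordanRestrict, Measure.restrict_apply hBs.1]
  have h' : B ∩ {x : Rd d | s ≤ ‖x‖} = B := Set.inter_eq_left.2 fun x hx => hBs.2 x hx
  rw [h']
  exact ⟨rfl, rfl⟩

namespace SignedMeasureAwayZero

lemma posPart_zero (ν : SignedMeasureAwayZero d) : ν.posPart {0} = 0 := glue_zero _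

lemma negPart_zero (ν : SignedMeasureAwayZero d) : ν.negPart {0} = 0 := glue_zero _

lemma posPart_apply (ν : SignedMeasureAwayZero d) {r : ℝ} (hr : 0 < r) {B : Set (Rd d)}
    (hB : B ∈ BorelAway d r) : ν.posPart B = (ν.restr r).toJordanDecomposition.posPart B :=
  glue_apply _ (fun _ _ hr hs _ h h' => (jordan_consistent ν hr hs h h').1) hr hB

lemma negPart_apply (ν : SignedMeasureAwayZero d) {r : ℝ} (hr : 0 < r) {B : Set (Rd d)}
    (hB : B ∈ BorelAway d r) : ν.negPart B = (ν.restr r).toJordanDecomposition.negPart B :=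
  glue_apply _ (fun _ _ hr hs _ h h' => (jordan_consistent ν hr hs h h').2) hr hB

/-- `∫ f dν = ∫ f dν⁺ - ∫ f dν⁻`, used only for functions `f` integrable with respect to `|ν|`. -/
def integral (ν : SignedMeasureAwayZero d) (f : Rd d → ℂ) : ℂ :=
  ∫ x, f x ∂ν.posPart - ∫ x, f x ∂ν.negPart

/-- `ν` is a quasi-Lévy type measure if `x ↦ 1 ∧ |x|^2` is integrable with respect to `|ν|`. -/
def IsQuasiLevyType (ν : SignedMeasureAwayZero d) : Prop :=
  Integrable (fun x : Rd d => min 1 (‖x‖ ^ 2)) ν.totalVariation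

end SignedMeasureAwayZero

/-! ### Characteristic triplets -/

/-- The quadratic form `z ↦ ⟨z, A z⟩`. -/
def quadForm (A : Matrix (Fin d) (Fin d) ℝ) (z : Rd d) : ℝ := ⟪z, Matrix.toEuclideanLin A z⟫

/-- `(A, ν, γ)` is the characteristic triplet of `μ` with respect to `c`, i.e. `A` is symmetric,
`ν` is a quasi-Lévy type measure and the Lévy-Khintchine representation holds. -/
structure IsCharacteristicTriplet (c : Rd d → Rd d) (μ : ProbabilityMeasure (Rd d))
    (A : Matrix (Fin d) (Fin d) ℝ) (ν : SignedMeasureAwayZero d) (γ : Rd d) : Prop where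
  symm : A.IsSymm
  quasiLevy : ν.IsQuasiLevyType
  charFun_eq : ∀ z : Rd d, charFun (μ : Measure (Rd d)) z
    = Complex.exp (Complex.I * (⟪γ, z⟫ : ℝ) - (1 / 2 : ℂ) * (quadForm A z : ℝ)
        + ν.integral fun x => Complex.exp (Complex.I * (⟪z, x⟫ : ℝ)) - 1 - Complex.I * (⟪z, c x⟫ : ℝ))

/-- The matrix `A_ε` with `⟨z, A_ε z⟩ = ⟨z, A z⟩ + ∫_{|x| ≤ ε} ⟨z, x⟩² ν⁺(dx)`. -/
def truncatedGaussian (A : Matrix (Fin d) (Fin d) ℝ) (ν : SignedMeasureAwayZero d) (ε : ℝ) :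
    Matrix (Fin d) (Fin d) ℝ :=
  Matrix.of fun i j => A i j + ∫ x in Metric.closedBall (0 : Rd d) ε, x i * x j ∂ν.posPart

lemma integrableOn_coord_mul_coord {ν : SignedMeasureAwayZero d} (hν : ν.IsQuasiLevyType) (ε : ℝ)
    (i j : Fin d) :
    IntegrableOn (fun x : Rd d => x i * x j) (Metric.closedBall 0 ε) ν.posPart := by
  have h1 : Integrable (fun x : Rd d => min 1 (‖x‖ ^ 2)) ν.posPart :=
    hν.mono_measure (Measure.le_add_right le_rfl)
  refine Integrable.mono' (h1.const_mul (max 1 (ε ^ 2))).integrableOn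
    (by fun_prop) ?_
  refine (ae_restrict_iff' Metric.isClosed_closedBall.measurableSet).2 (ae_of_all _ fun x hx => ?_)
  have hx' : ‖x‖ ≤ ε := by simpa using hx
  have h2 : ‖x i * x j‖ ≤ ‖x‖ ^ 2 := by
    rw [norm_mul, sq]
    exact mul_le_mul (PiLp.norm_apply_le x i) (PiLp.norm_apply_le x j) (norm_nonneg _)
      (norm_nonneg _)
  refine h2.trans ?_
  have h3 : ‖x‖ ^ 2 ≤ ε ^ 2 := by gcongr
  rcases le_total 1 (‖x‖ ^ 2) with h | h
  · rw [min_eq_left h, mul_one]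
    exact h3.trans (le_max_right _ _)
  · rw [min_eq_right h]
    exact le_mul_of_one_le_left (by positivity) (le_max_left _ _)

lemma quadForm_eq_sum (A : Matrix (Fin d) (Fin d) ℝ) (z : Rd d) :
    quadForm A z = ∑ i, ∑ j, A i j * (z i * z j) := by
  simp only [quadForm, PiLp.inner_apply, Matrix.toLpLin_apply, Matrix.mulVec, dotProduct,
    RCLike.inner_apply, conj_trivial, Finset.sum_mul]
  exact Finset.sum_congr rfl fun i _ => Finset.sum_congr rfl fun j _ => by ring

lemma quadForm_truncatedGaussian (A : Matrix (Fin d) (Fin d) ℝ) {ν : SignedMeasureAwayZero d}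
    (hν : ν.IsQuasiLevyType) (ε : ℝ) (z : Rd d) :
    quadForm (truncatedGaussian A ν ε) z
      = quadForm A z + ∫ x in Metric.closedBall (0 : Rd d) ε, ⟪z, x⟫ ^ 2 ∂ν.posPart := by
  have key : ∀ x : Rd d, ⟪z, x⟫ ^ 2 = ∑ i, ∑ j, (x i * x j) * (z i * z j) := by
    intro x
    simp only [PiLp.inner_apply, RCLike.inner_apply, conj_trivial, sq, Finset.sum_mul_sum]
    exact Finset.sum_congr rfl fun i _ => Finset.sum_congr rfl fun j _ => by ring
  have hint := integrableOn_coord_mul_coord hν ε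
  simp only [quadForm_eq_sum, truncatedGaussian, Matrix.of_apply, add_mul, Finset.sum_add_distrib,
    key]
  rw [integral_finsetSum _ fun i _ => integrable_finsetSum _ fun j _ => (hint i j).mul_const _]
  congr 1
  refine Finset.sum_congr rfl fun i _ => ?_
  rw [integral_finsetSum _ fun j _ => (hint i j).mul_const _]
  exact Finset.sum_congr rfl fun j _ => (integral_mul_const _ _).symm

end QID

end

noncomputable section

namespace QID

variable {d : ℕ} {c : Rd d → Rd d}

/-! The characteristic function of `μn n` is `exp (ψₙ - κₙ)`, where `ψₙ` is the exponent of `(Aₙ,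
νₙ⁺, γₙ)` and `κₙ` is the integral of the Lévy-Khintchine kernel against `νₙ⁻`. The hypotheses on
`νₙ⁻` exclude that its small jumps leave a Gaussian contribution in the limit, so integrals of every
continuous function dominated by `1 ∧ |x|²` converge (`tendsto_integral_of_small_jumps`), and `κₙ`
converges to the kernel integral `κ` of `σ`. Everything is thereby reduced to a limit theorem for
the genuine generating triplets `(Aₙ, νₙ⁺, γₙ)`.

Since `|exp ψₙ(z)|⁴ ≤ |exp ψₙ(2z)|`, the limit of `exp ψₙ` has no zeros, hence neither has the
characteristic function of `μ`. Weak convergence makes the convergence of characteristic functions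
locally uniform, so their continuous logarithms converge too (`exists_log_limit`), and `ψₙ`
converges, locally boundedly, to a continuous function `ψ`.

To extract a triplet from `ψ` (`exists_triplet_of_tendsto`), take second differences along the
coordinate axes, averaged over steps in `[0,1]`. They remove the drift and the compensator and turn
`ψₙ` into the characteristic function of the finite measure `w νₙ⁺ + (tr Aₙ / 6) δ₀`, with a weight
`w` comparable to `1 ∧ |x|²`. By Lévy's continuity theorem these measures converge weakly; dividing
the limit by `w` off the origin gives `η`. The kernel plus `⟨z, c(x)⟩² / 2` is `o(|x|²)`, so its
quotient by `w` is a bounded continuous test function and its integrals converge. What remains of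
`ψₙ` is a linear form in `γₙ` and the quadratic form of `Aₙ + ∫ c cᵀ dνₙ⁺`; their limits give `γ`
and `A`, and (iii) follows by comparing `⟨z, c(x)⟩²` with `⟨z, x⟩²` near the origin.

Thus the characteristic function of `μ` is `exp (ψ - κ)` with `ψ` the exponent of `(A, η, γ)`. The
matrix `A` is positive semidefinite because jump parts grow slower than `|z|²`, so `μ` is
quasi-infinitely divisible. Any triplet of `μ` agrees with `(A, η - σ, γ)`: moving negative parts
across the equation leaves two exponents of honest measures, to which `levyExponent_injective`
applies. -/

/-- The integrand of the Lévy-Khintchine formula with respect to `c`. -/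
def levyKernel (c : Rd d → Rd d) (z x : Rd d) : ℂ :=
  Complex.exp (Complex.I * (⟪z, x⟫ : ℝ)) - 1 - Complex.I * (⟪z, c x⟫ : ℝ)

/-! ### Domination by `1 ∧ |x|²` and estimates for the kernel -/

/-- The function `1 ∧ |x|^2`. -/
def truncSq (x : Rd d) : ℝ := min 1 (‖x‖ ^ 2)

lemma continuous_truncSq : Continuous (truncSq (d := d)) := by unfold truncSq; fun_prop

lemma truncSq_nonneg (x : Rd d) : 0 ≤ truncSq x := le_min zero_le_one (by positivity)

lemma truncSq_le_one (x : Rd d) : truncSq x ≤ 1 := min_le_left _ _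

lemma truncSq_le_sq (x : Rd d) : truncSq x ≤ ‖x‖ ^ 2 := min_le_right _ _

lemma truncSq_pos {x : Rd d} (hx : x ≠ 0) : 0 < truncSq x :=
  lt_min one_pos (by positivity)

/-- The standard way to dominate by `1 ∧ |x|²`: one constant bound and one quadratic bound. -/
lemma le_mul_truncSq {a K L : ℝ} {x : Rd d} (hK : 0 ≤ K) (hL : 0 ≤ L) (h1 : a ≤ K)
    (h2 : a ≤ L * ‖x‖ ^ 2) : a ≤ (K + L) * truncSq x := by
  unfold truncSq
  rcases le_total 1 (‖x‖ ^ 2) with h | h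
  · rw [min_eq_left h]; linarith
  · rw [min_eq_right h]; nlinarith [sq_nonneg ‖x‖]

lemma IsRepresentationFunction.map_zero {c : Rd d → Rd d} (hc : IsRepresentationFunction c)
    (hcc : Continuous c) : c 0 = 0 := by
  -- In dimension zero the punctured neighbourhoods of `0` are empty and limits along them are not
  -- unique.
  rcases subsingleton_or_nontrivial (Rd d) with hs | hs
  · exact Subsingleton.elim _ _
  have h1 : Tendsto (fun x : Rd d => ‖x‖ ^ 2 * ((‖x‖ ^ 2)⁻¹ * ‖c x - x‖)) (𝓝[≠] 0) (𝓝 0) := by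
    have : Tendsto (fun x : Rd d => ‖x‖ ^ 2) (𝓝[≠] 0) (𝓝 0) := by
      have : Continuous fun x : Rd d => ‖x‖ ^ 2 := by fun_prop
      simpa using (this.tendsto 0).mono_left nhdsWithin_le_nhds
    simpa using this.mul hc.tendsto_zero
  have h2 : Tendsto (fun x : Rd d => ‖c x - x‖) (𝓝[≠] 0) (𝓝 ‖c 0 - 0‖) :=
    ((by fun_prop : Continuous fun x : Rd d => ‖c x - x‖).tendsto 0).mono_left nhdsWithin_le_nhds
  have h3 : Tendsto (fun x : Rd d => ‖c x - x‖) (𝓝[≠] 0) (𝓝 0) := by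
    refine h1.congr' ?_
    filter_upwards [self_mem_nhdsWithin] with x hx
    have : ‖x‖ ≠ 0 := norm_ne_zero_iff.2 hx
    field_simp
  simpa using tendsto_nhds_unique h2 h3

lemma IsRepresentationFunction.exists_norm_sub_le {c : Rd d → Rd d}
    (hc : IsRepresentationFunction c) (hcc : Continuous c) :
    ∃ K, 0 ≤ K ∧ ∀ x, ‖c x - x‖ ≤ K * ‖x‖ ^ 2 := by
  obtain ⟨C, hC⟩ := hc.bounded
  have hC0 : 0 ≤ C := (norm_nonneg _).trans (hC 0)
  have h1 := hc.tendsto_zero.eventually (Iio_mem_nhds one_pos)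
  obtain ⟨δ, hδ, h⟩ := Metric.mem_nhdsWithin_iff.1 h1
  -- The summand `1` serves `|x| < δ`, where the defining limit gives a ratio below `1`; the other
  -- two bound `C + |x|` by a multiple of `|x|²` when `|x| ≥ δ`.
  refine ⟨1 + (C / δ ^ 2 + 1 / δ), by positivity, fun x => ?_⟩
  rcases eq_or_ne x 0 with rfl | hx
  · simp [hc.map_zero hcc]
  have hx0 : 0 < ‖x‖ := norm_pos_iff.2 hx
  rcases lt_or_ge ‖x‖ δ with hlt | hge
  · have := h ⟨by simpa using hlt, hx⟩
    simp only [Set.mem_ofPred_eq] at this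
    rw [inv_mul_lt_iff₀ (by positivity)] at this
    have : ‖c x - x‖ ≤ ‖x‖ ^ 2 := by linarith
    have h2 : 0 ≤ (C / δ ^ 2 + 1 / δ) * ‖x‖ ^ 2 := by positivity
    linarith
  · have h2 : ‖c x - x‖ ≤ C + ‖x‖ := (norm_sub_le _ _).trans (by linarith [hC x])
    have h3 : C ≤ C / δ ^ 2 * ‖x‖ ^ 2 := by
      rw [div_mul_eq_mul_div, le_div_iff₀ (by positivity)]; gcongr
    have h4 : ‖x‖ ≤ 1 / δ * ‖x‖ ^ 2 := by
      rw [div_mul_eq_mul_div, le_div_iff₀ (by positivity)]; nlinarith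
    nlinarith [sq_nonneg ‖x‖]

lemma norm_exp_I_mul_sub_one_sub_le (u : ℝ) :
    ‖Complex.exp (Complex.I * u) - 1 - Complex.I * u‖ ≤ 3 * u ^ 2 := by
  have hn : ‖Complex.I * (u : ℂ)‖ = |u| := by simp
  rcases le_total |u| 1 with h | h
  · have := Complex.norm_exp_sub_one_sub_id_le (x := Complex.I * u) (by rwa [hn])
    rw [hn, sq_abs] at this
    nlinarith [sq_nonneg u]
  · have h1 : ‖Complex.exp (Complex.I * u)‖ = 1 := by
      rw [mul_comm]; exact Complex.norm_exp_ofReal_mul_I u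
    have h2 := norm_sub_le (Complex.exp (Complex.I * u) - 1) (Complex.I * u)
    have h3 := norm_sub_le (Complex.exp (Complex.I * u)) 1
    rw [hn] at h2
    rw [h1, norm_one] at h3
    have : |u| ≤ u ^ 2 := by rw [← sq_abs]; nlinarith
    nlinarith

lemma continuous_levyKernel {c : Rd d → Rd d} (hcc : Continuous c) (z : Rd d) :
    Continuous (levyKernel c z) := by unfold levyKernel; fun_prop

lemma continuous_levyKernel_left (c : Rd d → Rd d) (x : Rd d) :
    Continuous fun z => levyKernel c z x := by unfold levyKernel; fun_prop

lemma levyKernel_zero (c : Rd d → Rd d) (x : Rd d) : levyKernel c 0 x = 0 := by simp [levyKernel]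

lemma levyKernel_re (c : Rd d → Rd d) (z x : Rd d) :
    (levyKernel c z x).re = Real.cos ⟪z, x⟫ - 1 := by
  simp [levyKernel, mul_comm Complex.I, Complex.exp_ofReal_mul_I_re]

lemma levyKernel_im (c : Rd d → Rd d) (z x : Rd d) :
    (levyKernel c z x).im = Real.sin ⟪z, x⟫ - ⟪z, c x⟫ := by
  simp [levyKernel, mul_comm Complex.I, Complex.exp_ofReal_mul_I_im]

/-- Since `c(x) - x = O(|x|²)`, the compensator cancels the first-order term. The explicit
dependence on `z` makes the bound locally uniform in `z`, which is needed for continuity of the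
exponents and for their local boundedness. -/
lemma IsRepresentationFunction.exists_norm_levyKernel_le {c : Rd d → Rd d}
    (hc : IsRepresentationFunction c) (hcc : Continuous c) :
    ∃ K, 0 ≤ K ∧ ∀ z x, ‖levyKernel c z x‖ ≤ K * (1 + ‖z‖) ^ 2 * truncSq x := by
  obtain ⟨C, hC⟩ := hc.bounded
  have hC0 : 0 ≤ C := (norm_nonneg _).trans (hC 0)
  obtain ⟨K, hK, h⟩ := hc.exists_norm_sub_le hcc
  refine ⟨(2 + C) + (3 + K), by positivity, fun z x => ?_⟩
  have hz := norm_nonneg z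
  rw [add_mul (2 + C)]
  refine le_mul_truncSq (by positivity) (by positivity) ?_ ?_
  · have h1 : ‖Complex.exp (Complex.I * (⟪z, x⟫ : ℝ))‖ = 1 := by
      rw [mul_comm]; exact Complex.norm_exp_ofReal_mul_I _
    have h2 := norm_sub_le (Complex.exp (Complex.I * (⟪z, x⟫ : ℝ)) - 1)
      (Complex.I * (⟪z, c x⟫ : ℝ))
    have h3 := norm_sub_le (Complex.exp (Complex.I * (⟪z, x⟫ : ℝ))) 1
    rw [h1, norm_one] at h3
    have h4 : ‖Complex.I * ((⟪z, c x⟫ : ℝ) : ℂ)‖ ≤ ‖z‖ * C := by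
      simp only [norm_mul, Complex.norm_I, one_mul, Complex.norm_real]
      exact (norm_inner_le_norm z (c x)).trans (by gcongr; exact hC x)
    unfold levyKernel
    nlinarith [mul_nonneg hz hC0, mul_nonneg hz (mul_nonneg hz hC0)]
  · have h1 := norm_exp_I_mul_sub_one_sub_le ⟪z, x⟫
    have h2 : levyKernel c z x = (Complex.exp (Complex.I * (⟪z, x⟫ : ℝ)) - 1
        - Complex.I * (⟪z, x⟫ : ℝ)) - Complex.I * (⟪z, c x - x⟫ : ℝ) := by
      rw [levyKernel, inner_sub_right]; push_cast; ring
    have h3 : ‖Complex.I * ((⟪z, c x - x⟫ : ℝ) : ℂ)‖ ≤ ‖z‖ * (K * ‖x‖ ^ 2) := by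
      simp only [norm_mul, Complex.norm_I, one_mul, Complex.norm_real]
      exact (norm_inner_le_norm z _).trans (by gcongr; exact h x)
    have h4 : ⟪z, x⟫ ^ 2 ≤ ‖z‖ ^ 2 * ‖x‖ ^ 2 := by
      rw [← sq_abs, ← mul_pow]; gcongr; exact abs_real_inner_le_norm z x
    rw [h2]
    refine (norm_sub_le _ _).trans ((add_le_add h1 h3).trans ?_)
    have hx : 0 ≤ ‖x‖ ^ 2 := by positivity
    nlinarith [mul_nonneg hz hx, mul_nonneg (mul_nonneg hz hx) hK, mul_nonneg hx hK,
      mul_nonneg (mul_nonneg hx hK) (sq_nonneg ‖z‖)]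

/-- The kernel is approximated to second order at `0` by a quadratic form in `c x`. -/
lemma IsRepresentationFunction.isLittleO_levyKernel_add {c : Rd d → Rd d}
    (hc : IsRepresentationFunction c) (hcc : Continuous c) (z : Rd d) :
    (fun x => levyKernel c z x + (1 / 2 : ℂ) * ((⟪z, c x⟫ ^ 2 : ℝ) : ℂ))
      =o[𝓝 0] fun x => ‖x‖ ^ 2 := by
  have hin : (fun x : Rd d => (⟪z, x⟫ : ℝ)) =O[𝓝 0] fun x => ‖x‖ :=
    Asymptotics.IsBigO.of_bound ‖z‖ (Eventually.of_forall fun x => by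
      simpa using norm_inner_le_norm (𝕜 := ℝ) z x)
  have hn : (fun x : Rd d => ‖x‖) =o[𝓝 0] fun _ => (1 : ℝ) := by
    rw [Asymptotics.isLittleO_one_iff]
    simpa using (continuous_norm (E := Rd d)).tendsto 0
  have hv : (fun x : Rd d => (⟪z, c x - x⟫ : ℝ)) =o[𝓝 0] fun x => ‖x‖ ^ 2 := by
    refine Asymptotics.IsBigO.trans_isLittleO (g := fun x => c x - x)
      (Asymptotics.IsBigO.of_bound ‖z‖ (Eventually.of_forall fun x => by
        simpa using norm_inner_le_norm (𝕜 := ℝ) z (c x - x))) ?_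
    rw [Asymptotics.isLittleO_iff]
    intro ε hε
    have h1 := eventually_nhdsWithin_iff.1 (hc.tendsto_zero.eventually (Iio_mem_nhds hε))
    filter_upwards [h1] with x hx
    rcases eq_or_ne x 0 with rfl | hx0
    · simp [hc.map_zero hcc]
    have := hx hx0
    rw [inv_mul_lt_iff₀ (by positivity)] at this
    simp only [norm_pow, norm_norm]
    linarith
  have hu3 : (fun x : Rd d => Complex.exp (Complex.I * (⟪z, x⟫ : ℝ)) - 1
      - Complex.I * (⟪z, x⟫ : ℝ) + (1 / 2 : ℂ) * ((⟪z, x⟫ : ℝ) : ℂ) ^ 2)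
      =o[𝓝 0] fun x => ‖x‖ ^ 2 := by
    have h1 : (fun u : ℝ => Complex.exp (Complex.I * u) - 1 - Complex.I * u
        + (1 / 2 : ℂ) * (u : ℂ) ^ 2) =O[𝓝 0] fun u => u ^ 3 := by
      -- The constant is that of `Complex.exp_bound` at `n = 3`, namely `(n + 1) / (n! * n)`.
      refine Asymptotics.IsBigO.of_bound (4 / (6 * 3)) ?_
      filter_upwards [Metric.closedBall_mem_nhds (0 : ℝ) one_pos] with u hu
      have hn : ‖Complex.I * (u : ℂ)‖ = |u| := by simp
      have := Complex.exp_bound (x := Complex.I * u) (by rw [hn]; simpa using hu) (n := 3)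
        (by norm_num)
      rw [hn] at this
      simp only [Finset.sum_range_succ, Finset.sum_range_zero, pow_zero, Nat.factorial, mul_pow,
        Complex.I_sq] at this
      norm_num at this
      norm_num
      convert! this using 1
      · congr 1; ring
      · ring
    have ht : Tendsto (fun x : Rd d => (⟪z, x⟫ : ℝ)) (𝓝 0) (𝓝 0) := by
      have : Continuous fun x : Rd d => (⟪z, x⟫ : ℝ) := by fun_prop
      simpa using this.tendsto 0
    refine (h1.comp_tendsto ht).trans_isLittleO ?_
    have h2 : (fun x : Rd d => (⟪z, x⟫ : ℝ) ^ 3) =O[𝓝 0] fun x => ‖x‖ ^ 3 := hin.pow 3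
    refine h2.trans_isLittleO ?_
    have h3 : (fun x : Rd d => ‖x‖ ^ 2 * ‖x‖) =o[𝓝 0] fun x => ‖x‖ ^ 2 * (1 : ℝ) :=
      (Asymptotics.isBigO_refl _ _).mul_isLittleO hn
    simpa [← pow_succ] using h3
  have hvu : (fun x : Rd d => (⟪z, x⟫ : ℝ) * (⟪z, c x - x⟫ : ℝ)) =o[𝓝 0] fun x => ‖x‖ ^ 2 := by
    have := (hin.trans hn.isBigO).mul_isLittleO hv
    simpa using this
  have hb : (fun x : Rd d => ‖x‖ ^ 2) =O[𝓝 0] fun _ => (1 : ℝ) := by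
    simpa using hn.isBigO.pow 2
  have hvv : (fun x : Rd d => (⟪z, c x - x⟫ : ℝ) * (⟪z, c x - x⟫ : ℝ))
      =o[𝓝 0] fun x => ‖x‖ ^ 2 := by
    have := (hv.isBigO.trans hb).mul_isLittleO hv
    simpa using this
  -- With `u = ⟨z, x⟩` and `v = ⟨z, c x - x⟩`, the function is the Taylor remainder in `u` plus `-i
  -- v + u v + v² / 2`, and each term is `o(|x|²)`.
  have key := hu3.add ((((Complex.isBigO_ofReal_left.2 (Asymptotics.isBigO_refl _ _)).trans_isLittleO
    hv).const_mul_left (-Complex.I)).add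
    (((Complex.isBigO_ofReal_left.2 (Asymptotics.isBigO_refl _ _)).trans_isLittleO hvu).add
    (((Complex.isBigO_ofReal_left.2 (Asymptotics.isBigO_refl _ _)).trans_isLittleO
      hvv).const_mul_left (1 / 2 : ℂ))))
  refine key.congr_left fun x => ?_
  have : (⟪z, c x⟫ : ℝ) = ⟪z, x⟫ + ⟪z, c x - x⟫ := by rw [inner_sub_right]; ring
  rw [levyKernel, this]
  push_cast
  ring

/-! ### The weight built from `1 - sinc` -/

/-- A second difference of step `h` produces the factor `1 - cos (h t)`, which has zeros away from
`t = 0`; averaging over `h` removes them. -/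
lemma integral_one_sub_cos_mul (t : ℝ) :
    ∫ h in (0 : ℝ)..1, (1 - Real.cos (h * t)) = 1 - Real.sinc t := by
  rcases eq_or_ne t 0 with rfl | ht
  · simp
  rw [intervalIntegral.integral_sub (by simp)
    (Continuous.intervalIntegrable (by fun_prop) _ _),
    intervalIntegral.integral_comp_mul_right (fun u => Real.cos u) ht, integral_cos,
    Real.sinc_of_ne_zero ht]
  simp [div_eq_inv_mul]

lemma one_sub_sinc_le (t : ℝ) : 1 - Real.sinc t ≤ t ^ 2 := by
  rw [← integral_one_sub_cos_mul]
  have : ∫ h in (0 : ℝ)..1, (1 - Real.cos (h * t)) ≤ ∫ _ in (0 : ℝ)..1, t ^ 2 := by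
    refine intervalIntegral.integral_mono_on zero_le_one
      (Continuous.intervalIntegrable (by fun_prop) _ _) (by simp) fun h hh => ?_
    have h1 := Real.one_sub_sq_div_two_le_cos (x := h * t)
    have h2 : h ^ 2 ≤ 1 := pow_le_one₀ hh.1 hh.2
    rw [mul_pow] at h1
    nlinarith [sq_nonneg t]
  simpa using this

/-- For `|t| ≤ 2` the bound `cos s ≤ 1 - 2 s² / π²` on `|s| ≤ π` integrates to `2 t² / (3 π²)`, and
`2 / (3 π²) > 1 / 20`. For `|t| ≥ 2`, `sinc t ≤ 1 / |t| ≤ 1 / 2`. -/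
lemma le_one_sub_sinc (t : ℝ) : 1 / 20 * min 1 (t ^ 2) ≤ 1 - Real.sinc t := by
  rcases le_total |t| 2 with h | h
  · have h3 : ∫ h in (0 : ℝ)..1, 2 / Real.pi ^ 2 * (h * t) ^ 2 ≤
        ∫ h in (0 : ℝ)..1, (1 - Real.cos (h * t)) := by
      refine intervalIntegral.integral_mono_on zero_le_one
        (Continuous.intervalIntegrable (by fun_prop) _ _)
        (Continuous.intervalIntegrable (by fun_prop) _ _) fun s hs => ?_
      have : |s * t| ≤ Real.pi := by
        rw [abs_mul, abs_of_nonneg hs.1]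
        have := Real.pi_gt_three
        nlinarith [hs.2, hs.1, abs_nonneg t]
      linarith [Real.cos_le_one_sub_mul_cos_sq this]
    rw [integral_one_sub_cos_mul] at h3
    have h4 : ∫ h in (0 : ℝ)..1, 2 / Real.pi ^ 2 * (h * t) ^ 2
        = 2 / Real.pi ^ 2 * (1 / 3) * t ^ 2 := by
      simp_rw [mul_pow, intervalIntegral.integral_const_mul, intervalIntegral.integral_mul_const]
      simp only [integral_pow]
      norm_num
      ring
    have h5 : (1 : ℝ) / 20 ≤ 2 / Real.pi ^ 2 * (1 / 3) := by
      rw [div_mul_eq_mul_div, div_le_div_iff₀ (by norm_num) (by positivity)]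
      have := Real.pi_lt_d2
      nlinarith [Real.pi_pos]
    rw [h4] at h3
    refine le_trans ?_ h3
    exact mul_le_mul h5 (min_le_right _ _) (by positivity) (by positivity)
  · have ht : t ≠ 0 := by rintro rfl; simp at h; linarith
    have h1 := Real.sinc_le_inv_abs ht
    have h2 : |t|⁻¹ ≤ 2⁻¹ := inv_anti₀ two_pos h
    have := min_le_left 1 (t ^ 2)
    linarith

/-- The weight `∑ i, (1 - sinc (x i))`, comparable to `1 ∧ |x|^2`. -/
def levyWeight (x : Rd d) : ℝ := ∑ i, (1 - Real.sinc (x i))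

lemma continuous_levyWeight : Continuous (levyWeight (d := d)) := by
  unfold levyWeight
  have := Real.continuous_sinc
  fun_prop

lemma levyWeight_zero : levyWeight (0 : Rd d) = 0 := by simp [levyWeight]

lemma levyWeight_nonneg (x : Rd d) : 0 ≤ levyWeight x :=
  Finset.sum_nonneg fun _ _ => sub_nonneg.2 (Real.sinc_le_one _)

lemma levyWeight_le (x : Rd d) : levyWeight x ≤ (2 * d + 1) * truncSq x := by
  refine le_mul_truncSq (by positivity) zero_le_one ?_ ?_
  · have : levyWeight x ≤ ∑ _ : Fin d, (2 : ℝ) :=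
      Finset.sum_le_sum fun i _ => by linarith [Real.neg_one_le_sinc (x i)]
    simpa [mul_comm] using this
  · rw [one_mul, EuclideanSpace.real_norm_sq_eq]
    exact Finset.sum_le_sum fun _ _ => one_sub_sinc_le _

lemma truncSq_le_levyWeight (x : Rd d) : 1 / 20 * truncSq x ≤ levyWeight x := by
  have h1 : truncSq x ≤ ∑ i, min 1 (x i ^ 2) := by
    unfold truncSq
    by_cases h : ∃ i, 1 ≤ x i ^ 2
    · obtain ⟨i, hi⟩ := h
      calc min 1 (‖x‖ ^ 2) ≤ 1 := min_le_left _ _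
        _ = min 1 (x i ^ 2) := (min_eq_left hi).symm
        _ ≤ _ := Finset.single_le_sum (f := fun i => min 1 (x i ^ 2))
          (fun j _ => le_min zero_le_one (sq_nonneg _)) (Finset.mem_univ i)
    · push Not at h
      rw [Finset.sum_congr rfl fun i _ => min_eq_right (h i).le,
        ← EuclideanSpace.real_norm_sq_eq]
      exact min_le_right _ _
  calc 1 / 20 * truncSq x ≤ 1 / 20 * ∑ i, min 1 (x i ^ 2) := by gcongr
    _ = ∑ i, 1 / 20 * min 1 (x i ^ 2) := Finset.mul_sum _ _ _
    _ ≤ _ := Finset.sum_le_sum fun i _ => le_one_sub_sinc _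

lemma levyWeight_pos {x : Rd d} (hx : x ≠ 0) : 0 < levyWeight x :=
  lt_of_lt_of_le (by have := truncSq_pos hx; positivity) (truncSq_le_levyWeight x)

/-! ### Lévy measures, quadratic forms and exponents -/

lemma IsLevyMeasure.integrable_truncSq {η : Measure (Rd d)} (h : IsLevyMeasure η) :
    Integrable truncSq η := by
  refine ⟨continuous_truncSq.aestronglyMeasurable, ?_⟩
  rw [hasFiniteIntegral_iff_enorm]
  refine lt_of_le_of_lt (lintegral_mono fun x => ?_) h.2
  rw [Real.enorm_eq_ofReal (truncSq_nonneg x), truncSq, ENNReal.ofReal_min]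
  gcongr
  · simp
  · rw [ENNReal.ofReal_pow (norm_nonneg _), ofReal_norm]

lemma isLevyMeasure_of_integrable {η : Measure (Rd d)} (h0 : η {0} = 0)
    (h : Integrable truncSq η) : IsLevyMeasure η := by
  refine ⟨h0, lt_of_le_of_lt (lintegral_mono fun x => ?_) (hasFiniteIntegral_iff_enorm.1 h.2)⟩
  rw [Real.enorm_eq_ofReal (truncSq_nonneg x), truncSq, ENNReal.ofReal_min]
  gcongr
  · simp
  · rw [ENNReal.ofReal_pow (norm_nonneg _), ofReal_norm]

lemma integrable_of_le_truncSq {E : Type*} [NormedAddCommGroup E] {η : Measure (Rd d)}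
    (h : Integrable truncSq η) {F : Rd d → E} (hF : AEStronglyMeasurable F η) {K : ℝ}
    (hK : ∀ x, ‖F x‖ ≤ K * truncSq x) : Integrable F η :=
  (h.const_mul K).mono' hF (Eventually.of_forall hK)

/-- The Lévy-Khintchine exponent of a triplet `(A, η, γ)` whose third component is a measure. -/
def levyExponent (c : Rd d → Rd d) (A : Matrix (Fin d) (Fin d) ℝ) (η : Measure (Rd d)) (γ : Rd d)
    (z : Rd d) : ℂ :=
  Complex.I * (⟪γ, z⟫ : ℝ) - (1 / 2 : ℂ) * (quadForm A z : ℝ) + ∫ x, levyKernel c z x ∂η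

lemma continuous_quadForm (A : Matrix (Fin d) (Fin d) ℝ) : Continuous (quadForm A) := by
  simp only [funext (quadForm_eq_sum A)]
  fun_prop

lemma quadForm_zero (A : Matrix (Fin d) (Fin d) ℝ) : quadForm A 0 = 0 := by
  simp [quadForm]

lemma quadForm_smul (A : Matrix (Fin d) (Fin d) ℝ) (t : ℝ) (z : Rd d) :
    quadForm A (t • z) = t ^ 2 * quadForm A z := by
  simp only [quadForm_eq_sum, Finset.mul_sum, PiLp.smul_apply, smul_eq_mul]
  exact Finset.sum_congr rfl fun i _ => Finset.sum_congr rfl fun j _ => by ring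

/-- Parallelogram identity. -/
lemma quadForm_add_add_sub (A : Matrix (Fin d) (Fin d) ℝ) (z w : Rd d) :
    quadForm A (z + w) + quadForm A (z - w) = 2 * quadForm A z + 2 * quadForm A w := by
  simp only [quadForm, map_add, map_sub, inner_add_left, inner_add_right, inner_sub_left,
    inner_sub_right]
  ring

lemma quadForm_single (A : Matrix (Fin d) (Fin d) ℝ) (i : Fin d) :
    quadForm A (EuclideanSpace.single i 1) = A i i := by
  rw [quadForm_eq_sum, Finset.sum_eq_single i _ (by simp), Finset.sum_eq_single i _ (by simp)]
  · simp
  · intro j _ hj; simp [hj]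
  · intro j _ hj; simp [hj]

lemma integrable_levyKernel (hc : IsRepresentationFunction c) (hcc : Continuous c)
    {η : Measure (Rd d)} (hη : Integrable truncSq η) (z : Rd d) :
    Integrable (levyKernel c z) η := by
  obtain ⟨K, -, h⟩ := hc.exists_norm_levyKernel_le hcc
  exact integrable_of_le_truncSq hη (continuous_levyKernel hcc z).aestronglyMeasurable (h z)

lemma continuous_integral_levyKernel (hc : IsRepresentationFunction c) (hcc : Continuous c)
    {η : Measure (Rd d)} (hη : Integrable truncSq η) :
    Continuous fun z => ∫ x, levyKernel c z x ∂η := by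
  obtain ⟨K, hK, h⟩ := hc.exists_norm_levyKernel_le hcc
  refine continuous_iff_continuousAt.2 fun z₀ => ?_
  refine continuousAt_of_dominated (bound := fun x => K * (1 + (‖z₀‖ + 1)) ^ 2 * truncSq x)
    (Eventually.of_forall fun z => (continuous_levyKernel hcc z).aestronglyMeasurable) ?_
    (hη.const_mul _) (Eventually.of_forall fun x => (continuous_levyKernel_left c x).continuousAt)
  filter_upwards [Metric.ball_mem_nhds z₀ one_pos] with z hz
  refine Eventually.of_forall fun x => (h z x).trans ?_
  have : ‖z‖ ≤ ‖z₀‖ + 1 := by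
    have := norm_sub_norm_le z z₀
    rw [Metric.mem_ball, dist_eq_norm] at hz
    linarith
  have := truncSq_nonneg x
  gcongr

lemma continuous_levyExponent (hc : IsRepresentationFunction c) (hcc : Continuous c)
    {η : Measure (Rd d)} (hη : Integrable truncSq η) (A : Matrix (Fin d) (Fin d) ℝ) (γ : Rd d) :
    Continuous (levyExponent c A η γ) := by
  have h1 := continuous_integral_levyKernel hc hcc hη
  have h2 := continuous_quadForm A
  unfold levyExponent
  fun_prop

lemma levyExponent_zero (A : Matrix (Fin d) (Fin d) ℝ) (η : Measure (Rd d)) (γ : Rd d) :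
    levyExponent c A η γ 0 = 0 := by
  simp [levyExponent, quadForm_zero, levyKernel_zero]

/-! ### Second differences of an exponent as a characteristic function -/

/-- The averaged second differences of a function. -/
def secondDifference (ψ : Rd d → ℂ) (z : Rd d) : ℂ :=
  ∑ i, ∫ h in (0 : ℝ)..1, (ψ z - (1 / 2 : ℂ) * (ψ (z + h • EuclideanSpace.single i 1)
    + ψ (z - h • EuclideanSpace.single i 1)))

/-- The finite measure whose characteristic function is the averaged second difference of the
exponent of `(A, η, γ)`. -/
def levySmoothing (A : Matrix (Fin d) (Fin d) ℝ) (η : Measure (Rd d)) : Measure (Rd d) :=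
  η.withDensity (fun x => ENNReal.ofReal (levyWeight x))
    + ENNReal.ofReal (∑ i, A i i / 6) • Measure.dirac 0

lemma integrable_levyWeight {η : Measure (Rd d)} (hη : Integrable truncSq η) :
    Integrable levyWeight η :=
  integrable_of_le_truncSq hη continuous_levyWeight.aestronglyMeasurable fun x => by
    rw [Real.norm_of_nonneg (levyWeight_nonneg x)]; exact levyWeight_le x

lemma isFiniteMeasure_levySmoothing (A : Matrix (Fin d) (Fin d) ℝ) {η : Measure (Rd d)}
    (hη : Integrable truncSq η) : IsFiniteMeasure (levySmoothing A η) := by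
  have := isFiniteMeasure_withDensity_ofReal (integrable_levyWeight hη).2
  have : IsFiniteMeasure (ENNReal.ofReal (∑ i, A i i / 6) • Measure.dirac (0 : Rd d)) :=
    Measure.smul_finite _ ENNReal.ofReal_ne_top
  unfold levySmoothing
  infer_instance

/-- The constant and the compensator are affine in `z` and drop out, so the result does not depend
on `c`; the exponentials combine by `e^{ib} + e^{-ib} = 2 cos b`. -/
lemma levyKernel_secondDifference (z w x : Rd d) :
    levyKernel c z x - (1 / 2 : ℂ) * (levyKernel c (z + w) x + levyKernel c (z - w) x)
      = Complex.exp (⟪x, z⟫ * Complex.I) * ((1 - Real.cos ⟪w, x⟫ : ℝ) : ℂ) := by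
  have h1 : Complex.exp (Complex.I * ((⟪z + w, x⟫ : ℝ) : ℂ))
      = Complex.exp (⟪x, z⟫ * Complex.I) * Complex.exp (⟪w, x⟫ * Complex.I) := by
    rw [← Complex.exp_add, inner_add_left, real_inner_comm z x]
    push_cast; ring_nf
  have h2 : Complex.exp (Complex.I * ((⟪z - w, x⟫ : ℝ) : ℂ))
      = Complex.exp (⟪x, z⟫ * Complex.I) * Complex.exp (-⟪w, x⟫ * Complex.I) := by
    rw [← Complex.exp_add, inner_sub_left, real_inner_comm z x]
    push_cast; ring_nf
  have h3 : Complex.exp (Complex.I * ((⟪z, x⟫ : ℝ) : ℂ))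
      = Complex.exp (⟪x, z⟫ * Complex.I) := by
    rw [real_inner_comm z x, mul_comm]
  simp only [levyKernel]
  rw [h1, h2, h3, inner_add_left, inner_sub_left]
  push_cast
  rw [Complex.cos]
  ring

/-- `hA` keeps `ENNReal.ofReal` from truncating the mass of the atom at `0`. -/
lemma integral_levySmoothing {E : Type*} [NormedAddCommGroup E] [NormedSpace ℝ E]
    [CompleteSpace E]
    (A : Matrix (Fin d) (Fin d) ℝ) (hA : 0 ≤ ∑ i, A i i / 6)
    {η : Measure (Rd d)} (hη : Integrable truncSq η) {F : Rd d → E} (hF : Continuous F) {K : ℝ}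
    (hK : ∀ x, ‖F x‖ ≤ K) :
    ∫ x, F x ∂(levySmoothing A η) = ∫ x, levyWeight x • F x ∂η + (∑ i, A i i / 6) • F 0 := by
  have h1 := isFiniteMeasure_levySmoothing A hη
  have hint : Integrable F (levySmoothing A η) :=
    Integrable.of_bound hF.aestronglyMeasurable K (Eventually.of_forall hK)
  rw [levySmoothing, integral_add_measure (hint.mono_measure (Measure.le_add_right le_rfl))
    (hint.mono_measure (Measure.le_add_left le_rfl)),
    integral_withDensity_eq_integral_toReal_smul
      continuous_levyWeight.measurable.ennreal_ofReal (by simp)]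
  simp only [ENNReal.toReal_ofReal (levyWeight_nonneg _), integral_smul_measure, integral_dirac,
    ENNReal.toReal_ofReal hA]

lemma levyExponent_secondDifference (hc : IsRepresentationFunction c) (hcc : Continuous c)
    (A : Matrix (Fin d) (Fin d) ℝ) {η : Measure (Rd d)}
    (hη : Integrable truncSq η) (γ : Rd d) (z w : Rd d) :
    levyExponent c A η γ z - (1 / 2 : ℂ) * (levyExponent c A η γ (z + w)
        + levyExponent c A η γ (z - w))
      = ((1 / 2 * quadForm A w : ℝ) : ℂ)
        + ∫ x, Complex.exp (⟪x, z⟫ * Complex.I) * ((1 - Real.cos ⟪w, x⟫ : ℝ) : ℂ) ∂η := by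
  have hi := integrable_levyKernel hc hcc hη
  simp only [← levyKernel_secondDifference (c := c)]
  have hadd : Integrable (fun x => levyKernel c (z + w) x + levyKernel c (z - w) x) η :=
    (hi _).add (hi _)
  rw [integral_sub (hi z) (hadd.const_mul _), integral_const_mul,
    integral_add (hi _) (hi _)]
  have hq : (quadForm A (z + w) : ℂ) = 2 * quadForm A z + 2 * quadForm A w
      - quadForm A (z - w) := by
    rw [eq_sub_iff_add_eq]
    exact_mod_cast quadForm_add_add_sub A z w
  simp only [levyExponent, inner_add_right, inner_sub_right, hq]
  push_cast
  ring

lemma norm_exp_mul_one_sub_cos_le (z x : Rd d) {h : ℝ} (hh : |h| ≤ 1) (i : Fin d) :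
    ‖Complex.exp (⟪x, z⟫ * Complex.I) * ((1 - Real.cos (h * x i) : ℝ) : ℂ)‖ ≤ 3 * truncSq x := by
  rw [norm_mul, Complex.norm_exp_ofReal_mul_I, one_mul, Complex.norm_real,
    Real.norm_of_nonneg (sub_nonneg.2 (Real.cos_le_one _))]
  have h3 : (3 : ℝ) = 2 + 1 := by norm_num
  rw [h3]
  refine le_mul_truncSq zero_le_two zero_le_one ?_ ?_
  · linarith [Real.neg_one_le_cos (h * x i)]
  · have h1 := Real.one_sub_sq_div_two_le_cos (x := h * x i)
    have h2 : h ^ 2 ≤ 1 := (sq_le_one_iff_abs_le_one h).2 hh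
    have h3 : x i ^ 2 ≤ ‖x‖ ^ 2 := by
      have := PiLp.norm_apply_le x i
      rw [← sq_abs, ← Real.norm_eq_abs]; gcongr
    rw [mul_pow] at h1
    nlinarith [sq_nonneg (x i)]

/-- Fubini in the step `h` and the jump `x` turns the averages of `1 - cos (h xᵢ)` into `1 - sinc
xᵢ`, whose sum over `i` is the weight. The Gaussian part contributes the average of `h² Aᵢᵢ / 2`,
that is `Aᵢᵢ / 6`, independently of `z`, hence an atom at `0`. -/
lemma charFun_levySmoothing (hc : IsRepresentationFunction c) (hcc : Continuous c)
    (A : Matrix (Fin d) (Fin d) ℝ) (hA : 0 ≤ ∑ i, A i i / 6) {η : Measure (Rd d)} [SFinite η]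
    (hη : Integrable truncSq η) (γ : Rd d) (z : Rd d) :
    charFun (levySmoothing A η) z = secondDifference (levyExponent c A η γ) z := by
  rw [charFun_apply, integral_levySmoothing A hA hη (K := 1) (by fun_prop)
    (fun x => (Complex.norm_exp_ofReal_mul_I _).le)]
  have hint : ∀ (i : Fin d) (h : ℝ), |h| ≤ 1 → Integrable (fun x : Rd d =>
      Complex.exp (⟪x, z⟫ * Complex.I) * ((1 - Real.cos (h * x i) : ℝ) : ℂ)) η := fun i h hh =>
    integrable_of_le_truncSq hη (Continuous.aestronglyMeasurable (by fun_prop))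
      fun x => norm_exp_mul_one_sub_cos_le z x hh i
  have hprod : ∀ i : Fin d, Integrable (Function.uncurry fun (h : ℝ) (x : Rd d) =>
      Complex.exp (⟪x, z⟫ * Complex.I) * ((1 - Real.cos (h * x i) : ℝ) : ℂ))
      ((volume.restrict (Set.Ioc (0 : ℝ) 1)).prod η) := by
    intro i
    refine ((hη.comp_snd (volume.restrict (Set.Ioc (0 : ℝ) 1))).const_mul 3).mono'
      (Continuous.aestronglyMeasurable (by fun_prop)) ?_
    have h1 : ∀ᵐ p ∂((volume.restrict (Set.Ioc (0 : ℝ) 1)).prod η), p.1 ∈ Set.Ioc (0 : ℝ) 1 :=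
      Measure.quasiMeasurePreserving_fst.ae (ae_restrict_mem measurableSet_Ioc)
    filter_upwards [h1] with p hp
    exact norm_exp_mul_one_sub_cos_le z p.2 (abs_le.2 ⟨by linarith [hp.1], hp.2⟩) i
  have hsw : ∀ i : Fin d, ∫ h in (0 : ℝ)..1, ∫ x, Complex.exp (⟪x, z⟫ * Complex.I)
      * ((1 - Real.cos (h * x i) : ℝ) : ℂ) ∂η
      = ∫ x, (1 - Real.sinc (x i)) • Complex.exp (⟪x, z⟫ * Complex.I) ∂η := by
    intro i
    rw [intervalIntegral.integral_of_le zero_le_one, integral_integral_swap (hprod i)]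
    congr 1 with x
    rw [← intervalIntegral.integral_of_le zero_le_one, intervalIntegral.integral_const_mul,
      intervalIntegral.integral_ofReal, integral_one_sub_cos_mul, Complex.real_smul, mul_comm]
  have hterm : ∀ i : Fin d, ∫ h in (0 : ℝ)..1, (levyExponent c A η γ z - (1 / 2 : ℂ) *
      (levyExponent c A η γ (z + h • EuclideanSpace.single i 1)
        + levyExponent c A η γ (z - h • EuclideanSpace.single i 1)))
      = ((A i i / 6 : ℝ) : ℂ)
        + ∫ x, (1 - Real.sinc (x i)) • Complex.exp (⟪x, z⟫ * Complex.I) ∂η := by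
    intro i
    simp only [levyExponent_secondDifference hc hcc A hη, quadForm_smul, quadForm_single,
      inner_smul_left, EuclideanSpace.inner_single_left, conj_trivial, map_one, one_mul]
    rw [← hsw i, intervalIntegral.integral_add, intervalIntegral.integral_ofReal]
    · congr 2
      simp
      ring
    · exact Continuous.intervalIntegrable (by fun_prop) _ _
    · rw [intervalIntegrable_iff_integrableOn_Ioc_of_le zero_le_one]
      exact (hprod i).integral_prod_left
  rw [secondDifference, Finset.sum_congr rfl fun i _ => hterm i, Finset.sum_add_distrib,
    ← integral_finsetSum, add_comm]
  · congr 1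
    · simp
    · simp only [levyWeight, Finset.sum_smul]
  · intro i _
    refine integrable_of_le_truncSq hη (Continuous.aestronglyMeasurable
      (by have := Real.continuous_sinc; fun_prop)) (K := 2 * d + 1) fun x => ?_
    rw [norm_smul, Complex.norm_exp_ofReal_mul_I, mul_one,
      Real.norm_of_nonneg (sub_nonneg.2 (Real.sinc_le_one _))]
    exact (Finset.single_le_sum (f := fun i => 1 - Real.sinc (x i))
      (fun j _ => sub_nonneg.2 (Real.sinc_le_one _)) (Finset.mem_univ i)).trans (levyWeight_le x)

/-! ### Lévy's continuity theorem -/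

/-- **Lévy's continuity theorem**: a pointwise limit of characteristic functions that is continuous
at `0` is a characteristic function. -/
theorem exists_charFun_eq_of_tendsto {P : ℕ → ProbabilityMeasure (Rd d)} {φ : Rd d → ℂ}
    (hφ : ContinuousAt φ 0)
    (h : ∀ z, Tendsto (fun n => charFun (P n : Measure (Rd d)) z) atTop (𝓝 (φ z))) :
    ∃ Q : ProbabilityMeasure (Rd d), (∀ z, charFun (Q : Measure (Rd d)) z = φ z) ∧
      Tendsto P atTop (𝓝 Q) := by
  have h_tight := isTightMeasureSet_of_tendsto_charFun (μ := fun n => (P n : Measure (Rd d))) hφ h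
  have h_compact : IsCompact (closure (Set.range P)) :=
    isCompact_closure_of_isTightMeasureSet (by
      convert! h_tight using 1
      ext x; simp)
  -- A limit along a free ultrafilter plays the role of a convergent subsequence. It suffices to
  -- identify the characteristic function of `Q`, which then forces convergence of the whole
  -- sequence.
  obtain ⟨Q, -, hQ⟩ := h_compact.ultrafilter_le_nhds ((hyperfilter ℕ).map P)
    (le_trans (by simp) (monotone_principal subset_closure))
  have hQ' : Tendsto P (hyperfilter ℕ) (𝓝 Q) := hQ
  have hchar : ∀ z, charFun (Q : Measure (Rd d)) z = φ z := by
    intro z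
    rw [ProbabilityMeasure.tendsto_iff_forall_integral_rclike_tendsto ℂ] at hQ'
    have h1 := hQ' (BoundedContinuousFunction.innerProbChar z)
    simp only [← charFun_eq_integral_innerProbChar] at h1
    exact tendsto_nhds_unique h1 ((h z).mono_left Nat.hyperfilter_le_atTop)
  exact ⟨Q, hchar, ProbabilityMeasure.tendsto_of_tendsto_charFun fun z => hchar z ▸ h z⟩

/-- Lévy's continuity theorem for finite measures. -/
theorem exists_finite_charFun_eq_of_tendsto {M : ℕ → Measure (Rd d)} [∀ n, IsFiniteMeasure (M n)]
    {g : Rd d → ℂ} (hg : ContinuousAt g 0)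
    (h : ∀ z, Tendsto (fun n => charFun (M n) z) atTop (𝓝 (g z))) :
    ∃ N : Measure (Rd d), IsFiniteMeasure N ∧ (∀ z, charFun N z = g z) ∧
      ∀ f : Rd d →ᵇ ℂ, Tendsto (fun n => ∫ x, f x ∂(M n)) atTop (𝓝 (∫ x, f x ∂N)) := by
  have hm : Tendsto (fun n => (M n).real Set.univ) atTop (𝓝 (g 0).re) := by
    simpa [Function.comp_def] using (Complex.continuous_re.tendsto _).comp (h 0)
  have hg0 : g 0 = ((g 0).re : ℂ) := by
    refine tendsto_nhds_unique (h 0) ?_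
    simpa [Function.comp_def] using (Complex.continuous_ofReal.tendsto _).comp hm
  have hpos : 0 ≤ (g 0).re := ge_of_tendsto' hm fun n => measureReal_nonneg
  have hbd : ∀ n (f : Rd d →ᵇ ℂ), ‖∫ x, f x ∂(M n)‖ ≤ ‖f‖ * (M n).real Set.univ := fun n f => by
    simpa [mul_comm] using norm_integral_le_of_norm_le_const
      (Eventually.of_forall f.norm_coe_le_norm) (μ := M n)
  -- If the limiting mass is zero, normalising is not possible but the limit is the zero measure;
  -- otherwise the normalised measures reduce the claim to the probability case.
  rcases hpos.eq_or_lt with h0 | hlt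
  · rw [← h0] at hm
    refine ⟨0, inferInstance, fun z => ?_, fun f => ?_⟩
    · rw [charFun_zero_measure]
      exact tendsto_nhds_unique (squeeze_zero_norm (fun n => norm_charFun_le z) hm) (h z)
    · simp only [integral_zero_measure]
      exact squeeze_zero_norm (fun n => hbd n f) (by simpa using hm.const_mul ‖f‖)
  · let F : ℕ → FiniteMeasure (Rd d) := fun n => ⟨M n, inferInstance⟩
    have hF : ∀ n (f : Rd d → ℂ), ∫ x, f x ∂(M n)
        = ((M n).real Set.univ : ℂ) * ∫ x, f x ∂((F n).normalize : Measure (Rd d)) := by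
      intro n f
      have h1 : M n = (F n).mass • ((F n).normalize : Measure (Rd d)) := by
        have := congrArg (fun μ : FiniteMeasure (Rd d) => (μ : Measure (Rd d)))
          (FiniteMeasure.self_eq_mass_smul_normalize (F n))
        exact this
      conv_lhs => rw [h1]
      rw [integral_smul_nnreal_measure, NNReal.smul_def, Complex.real_smul]
      rfl
    have hne : ((g 0).re : ℂ) ≠ 0 := by exact_mod_cast hlt.ne'
    have hmC : Tendsto (fun n => ((M n).real Set.univ : ℂ)) atTop (𝓝 ((g 0).re : ℂ)) :=
      (Complex.continuous_ofReal.tendsto _).comp hm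
    have hφ : ∀ z, Tendsto (fun n => charFun ((F n).normalize : Measure (Rd d)) z) atTop
        (𝓝 (g z / (g 0).re)) := by
      intro z
      refine ((h z).div hmC hne).congr' ?_
      filter_upwards [hmC.eventually_ne hne] with n hn
      rw [Pi.div_apply, charFun_apply, hF n, charFun_apply, mul_div_cancel_left₀ _ hn]
    obtain ⟨Q, hQ, hT⟩ := exists_charFun_eq_of_tendsto (hg.div_const _) hφ
    refine ⟨ENNReal.ofReal (g 0).re • (Q : Measure (Rd d)),
      Measure.smul_finite _ ENNReal.ofReal_ne_top, fun z => ?_, fun f => ?_⟩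
    · rw [charFun_apply, integral_smul_measure, ← charFun_apply, hQ, ENNReal.toReal_ofReal hpos,
        Complex.real_smul, mul_div_cancel₀ _ hne]
    · rw [ProbabilityMeasure.tendsto_iff_forall_integral_rclike_tendsto ℂ] at hT
      rw [integral_smul_measure, ENNReal.toReal_ofReal hpos, Complex.real_smul]
      simp only [hF]
      exact hmC.mul (hT f)

/-! ### Construction of infinitely divisible distributions -/

/-- `φ` is the characteristic function of a probability distribution. -/
def IsProbCharFun (φ : Rd d → ℂ) : Prop :=
  ∃ P : ProbabilityMeasure (Rd d), ∀ z, charFun (P : Measure (Rd d)) z = φ z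

lemma IsProbCharFun.of_tendsto {φ : ℕ → Rd d → ℂ} {ψ : Rd d → ℂ} (hφ : ∀ n, IsProbCharFun (φ n))
    (hψ : ContinuousAt ψ 0) (h : ∀ z, Tendsto (fun n => φ n z) atTop (𝓝 (ψ z))) :
    IsProbCharFun ψ := by
  choose P hP using hφ
  obtain ⟨Q, hQ, -⟩ := exists_charFun_eq_of_tendsto (P := P) hψ fun z => by simpa [hP] using h z
  exact ⟨Q, hQ⟩

lemma isProbCharFun_exp_inner (a : Rd d) :
    IsProbCharFun fun z => Complex.exp (Complex.I * (⟪a, z⟫ : ℝ)) :=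
  ⟨⟨Measure.dirac a, inferInstance⟩, fun z => by
    rw [ProbabilityMeasure.coe_mk, charFun_dirac, mul_comm]⟩

lemma IsProbCharFun.mul {φ ψ : Rd d → ℂ} (hφ : IsProbCharFun φ) (hψ : IsProbCharFun ψ) :
    IsProbCharFun fun z => φ z * ψ z := by
  obtain ⟨P, hP⟩ := hφ
  obtain ⟨Q, hQ⟩ := hψ
  exact ⟨⟨Measure.conv (P : Measure (Rd d)) Q, inferInstance⟩, fun z => by
    rw [ProbabilityMeasure.coe_mk, charFun_conv, hP, hQ]⟩

lemma IsProbCharFun.pow {φ : Rd d → ℂ} (hφ : IsProbCharFun φ) (n : ℕ) :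
    IsProbCharFun fun z => φ z ^ n := by
  induction n with
  | zero => simpa using isProbCharFun_exp_inner (0 : Rd d)
  | succ n ih => simpa only [pow_succ] using ih.mul hφ

/-- Compound Poisson distributions. -/
lemma isProbCharFun_compoundPoisson (m : Measure (Rd d)) [IsFiniteMeasure m] :
    IsProbCharFun fun z => Complex.exp (charFun m z - m.real Set.univ) := by
  -- The law is the limit of `k`-fold convolution powers of `(1 - m(ℝ^d) / k) δ₀ + m / k`. Starting
  -- at `k = N` keeps the weight of `δ₀` nonnegative.
  obtain ⟨N, hN⟩ := exists_nat_gt (m.real Set.univ)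
  have hlt : ∀ n : ℕ, m.real Set.univ < ((n + N : ℕ) : ℝ) := fun n =>
    hN.trans_le (by exact_mod_cast Nat.le_add_left N n)
  have hpos : ∀ n : ℕ, (0 : ℝ) < ((n + N : ℕ) : ℝ) := fun n =>
    measureReal_nonneg.trans_lt (hlt n)
  refine IsProbCharFun.of_tendsto
    (φ := fun n z => (1 + (charFun m z - m.real Set.univ) / ((n + N : ℕ) : ℂ)) ^ (n + N))
    (fun n => IsProbCharFun.pow ?_ _) (by fun_prop) fun z =>
      (tendsto_add_atTop_iff_nat N).2 (Complex.tendsto_one_add_div_pow_exp _)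
  have h1 : 0 ≤ 1 - m.real Set.univ / ((n + N : ℕ) : ℝ) := by
    rw [sub_nonneg, div_le_one (hpos n)]; exact (hlt n).le
  have h2 : 0 ≤ 1 / ((n + N : ℕ) : ℝ) := by have := hpos n; positivity
  let ρ : Measure (Rd d) := ENNReal.ofReal (1 - m.real Set.univ / ((n + N : ℕ) : ℝ)) •
    Measure.dirac 0 + ENNReal.ofReal (1 / ((n + N : ℕ) : ℝ)) • m
  have i1 : IsFiniteMeasure (ENNReal.ofReal (1 - m.real Set.univ / ((n + N : ℕ) : ℝ)) •
    Measure.dirac (0 : Rd d)) := Measure.smul_finite _ ENNReal.ofReal_ne_top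
  have i2 : IsFiniteMeasure (ENNReal.ofReal (1 / ((n + N : ℕ) : ℝ)) • m) :=
    Measure.smul_finite _ ENNReal.ofReal_ne_top
  have hρ : IsProbabilityMeasure ρ := by
    refine ⟨?_⟩
    have : m Set.univ = ENNReal.ofReal (m.real Set.univ) := (ofReal_measureReal).symm
    simp only [ρ, Measure.add_apply, Measure.smul_apply, smul_eq_mul, measure_univ, mul_one]
    rw [this, ← ENNReal.ofReal_mul h2, ← ENNReal.ofReal_add h1 (by positivity)]
    rw [show ∀ a b : ℝ, 1 - a / b + 1 / b * a = 1 from fun a b => by ring, ENNReal.ofReal_one]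

  refine ⟨⟨ρ, hρ⟩, fun z => ?_⟩
  have hint : ∀ (κ : Measure (Rd d)) [IsFiniteMeasure κ],
      Integrable (fun x => Complex.exp (⟪x, z⟫ * Complex.I)) κ := fun κ _ =>
    Integrable.of_bound (Continuous.aestronglyMeasurable (by fun_prop)) 1
      (Eventually.of_forall fun x => (Complex.norm_exp_ofReal_mul_I _).le)
  rw [ProbabilityMeasure.coe_mk, charFun_apply, integral_add_measure (hint _) (hint _),
    integral_smul_measure, integral_smul_measure, ← charFun_apply, ← charFun_apply, charFun_dirac,
    ENNReal.toReal_ofReal h1, ENNReal.toReal_ofReal h2, Complex.real_smul, Complex.real_smul]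
  simp
  ring

lemma isFiniteMeasure_restrict_of_integrable_truncSq {η : Measure (Rd d)}
    (hη : Integrable truncSq η) {r : ℝ} (hr : 0 < r) :
    IsFiniteMeasure (η.restrict {x | r ≤ ‖x‖}) := by
  refine ⟨?_⟩
  rw [Measure.restrict_apply_univ]
  have h1 : {x : Rd d | r ≤ ‖x‖} ⊆ {x | min 1 (r ^ 2) ≤ ‖truncSq x‖} := fun x hx => by
    have hx' : r ≤ ‖x‖ := hx
    rw [Set.mem_ofPred_eq, Real.norm_of_nonneg (truncSq_nonneg x), truncSq]
    gcongr
  exact (measure_mono h1).trans_lt (hη.measure_norm_ge_lt_top (by positivity))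

/-- On `{|x| ≥ 1 / (n + 1)}` the measure is finite and the law is compound Poisson, shifted by minus
the integral of `c`. Letting `n → ∞`, the limit is a characteristic function because the full
exponent is continuous in `z`. -/
lemma isProbCharFun_exp_integral_levyKernel (hc : IsRepresentationFunction c) (hcc : Continuous c)
    {η : Measure (Rd d)} (hη : Integrable truncSq η) :
    IsProbCharFun fun z => Complex.exp (∫ x, levyKernel c z x ∂η) := by
  let S : ℕ → Set (Rd d) := fun n => {x | ((n : ℝ) + 1)⁻¹ ≤ ‖x‖}
  have hS : ∀ n, MeasurableSet (S n) := fun n => measurableSet_away _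
  have hSm : Monotone S := fun i j hij x hx =>
    le_trans (b := ((i : ℝ) + 1)⁻¹) (by gcongr) hx
  have hU : ⋃ n, S n = {0}ᶜ := by
    ext x
    simp only [Set.mem_iUnion, Set.mem_compl_iff, Set.mem_singleton_iff, S, Set.mem_ofPred_eq]
    constructor
    · rintro ⟨n, hn⟩ rfl
      rw [norm_zero] at hn
      have : 0 < ((n : ℝ) + 1)⁻¹ := by positivity
      linarith
    · intro hx
      obtain ⟨n, hn⟩ := exists_nat_one_div_lt (norm_pos_iff.2 hx)
      exact ⟨n, by simpa using hn.le⟩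
  have hi := integrable_levyKernel hc hcc hη
  have hlim : ∀ z, Tendsto (fun n => Complex.exp (∫ x in S n, levyKernel c z x ∂η)) atTop
      (𝓝 (Complex.exp (∫ x, levyKernel c z x ∂η))) := by
    intro z
    have h1 := tendsto_setIntegral_of_monotone hS hSm (f := levyKernel c z) (hi z).integrableOn
    have h2 : ∫ x in ⋃ n, S n, levyKernel c z x ∂η = ∫ x, levyKernel c z x ∂η := by
      rw [hU]
      -- An atom of `η` at `0` would be harmless: the kernel vanishes there because `c 0 = 0`.
      refine setIntegral_eq_integral_of_forall_compl_eq_zero fun x hx => ?_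
      have : x = 0 := by simpa using hx
      simp [this, levyKernel, hc.map_zero hcc]
    rw [h2] at h1
    exact (Complex.continuous_exp.tendsto _).comp h1
  refine IsProbCharFun.of_tendsto (fun n => ?_)
    (Complex.continuous_exp.comp (continuous_integral_levyKernel hc hcc hη)).continuousAt hlim
  have hfin : IsFiniteMeasure (η.restrict (S n)) :=
    isFiniteMeasure_restrict_of_integrable_truncSq hη (by positivity)
  obtain ⟨C, hC⟩ := hc.bounded
  have hci : Integrable c (η.restrict (S n)) :=
    Integrable.of_bound hcc.aestronglyMeasurable C (Eventually.of_forall hC)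
  have := (isProbCharFun_compoundPoisson (η.restrict (S n))).mul
    (isProbCharFun_exp_inner (-∫ x in S n, c x ∂η))
  convert! this using 2 with z
  rw [← Complex.exp_add]
  congr 1
  have he : Integrable (fun x => Complex.exp (⟪x, z⟫ * Complex.I)) (η.restrict (S n)) :=
    Integrable.of_bound (Continuous.aestronglyMeasurable (by fun_prop)) 1
      (Eventually.of_forall fun x => (Complex.norm_exp_ofReal_mul_I _).le)
  have h1 : ∀ x, levyKernel c z x = Complex.exp (⟪x, z⟫ * Complex.I) - 1
      - Complex.I * (⟪z, c x⟫ : ℝ) := fun x => by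
    rw [levyKernel, real_inner_comm, mul_comm Complex.I]
  simp only [h1]
  have he1 : Integrable (fun x => Complex.exp (⟪x, z⟫ * Complex.I) - 1) (η.restrict (S n)) :=
    he.sub (integrable_const _)
  have hi1 : Integrable (fun x => Complex.I * ((⟪z, c x⟫ : ℝ) : ℂ)) (η.restrict (S n)) :=
    ((hci.const_inner z).ofReal).const_mul _
  rw [integral_sub he1 hi1,
    integral_sub he (integrable_const _), integral_const_mul, integral_complex_ofReal,
    integral_inner hci, charFun_apply, inner_neg_left, real_inner_comm z]
  simp
  ring

/-- A symmetric matrix with nonnegative quadratic form is positive semidefinite. -/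
lemma posSemidef_of_quadForm_nonneg {A : Matrix (Fin d) (Fin d) ℝ} (hA : A.IsSymm)
    (h : ∀ z, 0 ≤ quadForm A z) : A.PosSemidef := by
  rw [Matrix.posSemidef_iff_dotProduct_mulVec]
  refine ⟨by rw [Matrix.IsHermitian, Matrix.conjTranspose_eq_transpose_of_trivial]; exact hA, fun x => ?_⟩
  have := h (WithLp.toLp 2 x)
  rw [quadForm_eq_sum] at this
  simpa [dotProduct, Matrix.mulVec, Finset.mul_sum, mul_comm, mul_left_comm] using this

/-- The law is the convolution of a point mass, a Gaussian and a pure jump law. -/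
lemma isProbCharFun_exp_levyExponent (hc : IsRepresentationFunction c) (hcc : Continuous c)
    {A : Matrix (Fin d) (Fin d) ℝ} (hA : A.PosSemidef)
    {η : Measure (Rd d)} (hη : Integrable truncSq η) (γ : Rd d) :
    IsProbCharFun fun z => Complex.exp (levyExponent c A η γ z) := by
  have hG : IsProbCharFun fun z : Rd d => Complex.exp (-((1 / 2 : ℂ) * (quadForm A z : ℝ))) := by
    refine ⟨⟨ProbabilityTheory.multivariateGaussian 0 A, inferInstance⟩, fun z => ?_⟩
    rw [ProbabilityMeasure.coe_mk, ProbabilityTheory.charFun_multivariateGaussian hA]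
    simp [quadForm_eq_sum, dotProduct, Matrix.mulVec, Finset.mul_sum, mul_comm, mul_left_comm, div_eq_mul_inv]
  convert! ((isProbCharFun_exp_inner γ).mul hG).mul
    (isProbCharFun_exp_integral_levyKernel hc hcc hη) using 2 with z
  rw [← Complex.exp_add, ← Complex.exp_add, levyExponent, sub_eq_add_neg]

lemma charFun_convPow (ρ : Measure (Rd d)) [IsProbabilityMeasure ρ] (n : ℕ) :
    IsProbabilityMeasure (convPow ρ n) ∧ ∀ z, charFun (convPow ρ n) z = charFun ρ z ^ n := by
  induction n with
  | zero => exact ⟨by unfold convPow; infer_instance, fun z => by simp [convPow]⟩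
  | succ n ih =>
    have := ih.1
    refine ⟨by unfold convPow; infer_instance, fun z => ?_⟩
    rw [convPow, charFun_conv, ih.2, pow_succ]

/-- Every triplet `(A, η, γ)` with `A` positive semidefinite and `η` a Lévy measure is the
characteristic triplet of an infinitely divisible distribution. -/
theorem exists_isInfinitelyDivisible (hc : IsRepresentationFunction c) (hcc : Continuous c)
    {A : Matrix (Fin d) (Fin d) ℝ} (hA : A.PosSemidef)
    {η : Measure (Rd d)} (hη : Integrable truncSq η) (γ : Rd d) :
    ∃ P : ProbabilityMeasure (Rd d), IsInfinitelyDivisible P ∧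
      ∀ z, charFun (P : Measure (Rd d)) z = Complex.exp (levyExponent c A η γ z) := by
  obtain ⟨P, hP⟩ := isProbCharFun_exp_levyExponent hc hcc hA hη γ
  refine ⟨P, fun n hn => ?_, hP⟩
  have hn0 : (0 : ℝ) ≤ (n : ℝ)⁻¹ := by positivity
  -- The convolution root has the triplet `(A / n, η / n, γ / n)`.
  obtain ⟨ρ, hρ⟩ := isProbCharFun_exp_levyExponent hc hcc (hA.smul hn0)
    (hη.smul_measure (c := ENNReal.ofReal (n : ℝ)⁻¹) ENNReal.ofReal_ne_top) ((n : ℝ)⁻¹ • γ)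
  have hpow := charFun_convPow (ρ : Measure (Rd d)) n
  have := hpow.1
  refine ⟨ρ, Measure.ext_of_charFun (funext fun z => ?_)⟩
  rw [hP, hpow.2, hρ, ← Complex.exp_nat_mul]
  have hnC : (n : ℂ) ≠ 0 := by exact_mod_cast (Nat.one_le_iff_ne_zero.1 hn)
  have hq : quadForm ((n : ℝ)⁻¹ • A) z = (n : ℝ)⁻¹ * quadForm A z := by
    simp only [quadForm_eq_sum, Finset.mul_sum, Matrix.smul_apply, smul_eq_mul, mul_assoc]
  simp only [levyExponent, hq, integral_smul_measure, ENNReal.toReal_ofReal hn0,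
    inner_smul_left, Complex.real_smul, conj_trivial, Complex.ofReal_mul, Complex.ofReal_inv,
    Complex.ofReal_natCast]
  field_simp

/-! ### Locally uniform convergence and continuous logarithms -/

lemma norm_exp_sub_exp_le (a b : ℝ) :
    ‖Complex.exp (a * Complex.I) - Complex.exp (b * Complex.I)‖ ≤ min 2 |a - b| := by
  refine le_min ?_ ?_
  · refine (norm_sub_le _ _).trans ?_
    rw [Complex.norm_exp_ofReal_mul_I, Complex.norm_exp_ofReal_mul_I]; norm_num
  · have h : Complex.exp (a * Complex.I) - Complex.exp (b * Complex.I)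
        = Complex.exp (b * Complex.I) * (Complex.exp (Complex.I * ((a - b : ℝ) : ℂ)) - 1) := by
      rw [mul_sub, ← Complex.exp_add, mul_one]; push_cast; ring_nf
    rw [h, norm_mul, Complex.norm_exp_ofReal_mul_I, one_mul]
    exact Real.norm_exp_I_mul_ofReal_sub_one_le

/-- The modulus of continuity is the integral of a bounded continuous function, so it passes through
weak limits; this yields equicontinuity of a weakly convergent sequence. -/
lemma norm_charFun_sub_charFun_le (P : Measure (Rd d)) [IsProbabilityMeasure P] {z w : Rd d}
    {δ : ℝ} (h : ‖w - z‖ ≤ δ) :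
    ‖charFun P w - charFun P z‖ ≤ ∫ x, min 2 (δ * ‖x‖) ∂P := by
  have hδ : 0 ≤ δ := (norm_nonneg _).trans h
  have he : ∀ z : Rd d, Integrable (fun x => Complex.exp (⟪x, z⟫ * Complex.I)) P := fun z =>
    Integrable.of_bound (Continuous.aestronglyMeasurable (by fun_prop)) 1
      (Eventually.of_forall fun x => (Complex.norm_exp_ofReal_mul_I _).le)
  rw [charFun_apply, charFun_apply, ← integral_sub (he w) (he z)]
  refine norm_integral_le_of_norm_le (Integrable.of_bound
    (Continuous.aestronglyMeasurable (by fun_prop)) 2 (Eventually.of_forall fun x => ?_))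
    (Eventually.of_forall fun x => (norm_exp_sub_exp_le _ _).trans ?_)
  · rw [Real.norm_of_nonneg (le_min zero_le_two (by positivity))]; exact min_le_left _ _
  · gcongr
    rw [← inner_sub_right]
    calc |⟪x, w - z⟫| ≤ ‖x‖ * ‖w - z‖ := abs_real_inner_le_norm _ _
      _ ≤ δ * ‖x‖ := by rw [mul_comm]; gcongr

/-- Weak convergence implies locally uniform convergence of the characteristic functions. -/
theorem tendstoLocallyUniformly_charFun {P : ℕ → ProbabilityMeasure (Rd d)}
    {Q : ProbabilityMeasure (Rd d)} (h : Tendsto P atTop (𝓝 Q)) :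
    TendstoLocallyUniformly (fun n z => charFun (P n : Measure (Rd d)) z)
      (charFun (Q : Measure (Rd d))) atTop := by
  rw [Metric.tendstoLocallyUniformly_iff]
  intro ε hε z
  have hlim : Tendsto (fun k : ℕ => ∫ x, min 2 (1 / ((k : ℝ) + 1) * ‖x‖) ∂(Q : Measure (Rd d)))
      atTop (𝓝 (∫ _, (0 : ℝ) ∂(Q : Measure (Rd d)))) := by
    refine tendsto_integral_of_dominated_convergence (fun _ => 2)
      (fun k => Continuous.aestronglyMeasurable (by fun_prop)) (integrable_const _)
      (fun k => Eventually.of_forall fun x => ?_) (Eventually.of_forall fun x => ?_)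
    · rw [Real.norm_of_nonneg (le_min zero_le_two (by positivity))]; exact min_le_left _ _
    · have h1 : Tendsto (fun k : ℕ => 1 / ((k : ℝ) + 1) * ‖x‖) atTop (𝓝 (0 * ‖x‖)) :=
        tendsto_one_div_add_atTop_nhds_zero_nat.mul_const _
      simpa using (tendsto_const_nhds (x := (2 : ℝ))).min h1
  rw [integral_zero] at hlim
  -- The radius is chosen for the limit law `Q`; weak convergence then gives the same bound for `P
  -- n` with `n` large. The final estimate adds three errors below `ε / 4`.
  obtain ⟨k, hk⟩ := (hlim.eventually (gt_mem_nhds (show (0 : ℝ) < ε / 4 by positivity))).exists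
  have hδ : (0 : ℝ) < 1 / ((k : ℝ) + 1) := by positivity
  set δ := 1 / ((k : ℝ) + 1)
  let f : Rd d →ᵇ ℝ := BoundedContinuousFunction.ofNormedAddCommGroup
    (fun x => min 2 (δ * ‖x‖)) (by fun_prop) 2 (fun x => by
      rw [Real.norm_of_nonneg (le_min zero_le_two (by positivity))]; exact min_le_left _ _)
  have hf := (ProbabilityMeasure.tendsto_iff_forall_integral_rclike_tendsto ℝ).1 h f
  have hz := ProbabilityMeasure.tendsto_iff_tendsto_charFun.1 h z
  refine ⟨Metric.closedBall z δ, Metric.closedBall_mem_nhds z hδ, ?_⟩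
  filter_upwards [hf.eventually (gt_mem_nhds hk),
    Metric.tendsto_nhds.1 hz (ε / 4) (by positivity)] with n h1 h2 w hw
  have hw' : ‖w - z‖ ≤ δ := by rwa [Metric.mem_closedBall, dist_eq_norm] at hw
  have h3 := norm_charFun_sub_charFun_le (P n : Measure (Rd d)) hw'
  have h4 := norm_charFun_sub_charFun_le (Q : Measure (Rd d)) hw'
  have h1' : ∫ x, min 2 (δ * ‖x‖) ∂(P n : Measure (Rd d)) < ε / 4 := h1
  rw [dist_eq_norm] at h2
  rw [dist_eq_norm, norm_sub_rev]
  calc ‖charFun (P n : Measure (Rd d)) w - charFun (Q : Measure (Rd d)) w‖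
      = ‖(charFun (P n : Measure (Rd d)) w - charFun (P n : Measure (Rd d)) z)
        + (charFun (P n : Measure (Rd d)) z - charFun (Q : Measure (Rd d)) z)
        - (charFun (Q : Measure (Rd d)) w - charFun (Q : Measure (Rd d)) z)‖ := by
        congr 1; ring
    _ ≤ _ := (norm_sub_le _ _).trans (add_le_add_left (norm_add_le _ _) _)
    _ < ε := by linarith

/-- By continuity `e` has no zeros near `0`, and the inequality carries nonvanishing from a point to
its double; `z` is reached from `z / 2^k` by `k` doublings. -/
lemma ne_zero_of_norm_pow_four_le {e : Rd d → ℂ} (he : ContinuousAt e 0) (h0 : e 0 ≠ 0)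
    (h : ∀ z, ‖e z‖ ^ 4 ≤ ‖e ((2 : ℝ) • z)‖) (z : Rd d) : e z ≠ 0 := by
  have hlim : Tendsto (fun k : ℕ => ((1 / 2 : ℝ) ^ k) • z) atTop (𝓝 0) := by
    simpa using (tendsto_pow_atTop_nhds_zero_of_lt_one (by norm_num : (0 : ℝ) ≤ 1 / 2)
      (by norm_num)).smul_const z
  obtain ⟨k, hk⟩ := ((he.tendsto.comp hlim).eventually_ne h0).exists
  have hstep : ∀ j : ℕ, e (((2 : ℝ) ^ j) • (((1 / 2 : ℝ) ^ k) • z)) ≠ 0 := by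
    intro j
    induction j with
    | zero => simpa using hk
    | succ j ih =>
      have := (pow_pos (norm_pos_iff.2 ih) 4).trans_le (h _)
      rw [pow_succ', mul_smul]
      exact norm_pos_iff.1 this
  have := hstep k
  rwa [smul_smul, ← mul_pow, show (2 : ℝ) * (1 / 2) = 1 by norm_num, one_pow, one_smul] at this

/-- The imaginary part of `D` starts at `0` and cannot reach `±π` on the connected ball: there `exp
D` would be a negative real, at distance more than `1` from `1`. So `D` stays in the range of the
principal logarithm. -/
lemma eq_log_exp_of_norm_exp_sub_one_lt {D : Rd d → ℂ} (hD : Continuous D) (h0 : D 0 = 0) {R : ℝ}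
    (h : ∀ z, ‖z‖ ≤ R → ‖Complex.exp (D z) - 1‖ < 1) {z : Rd d} (hz : ‖z‖ ≤ R) :
    Complex.log (Complex.exp (D z)) = D z := by
  have key : |(D z).im| < Real.pi := by
    by_contra hcon
    push Not at hcon
    have hpre : IsPreconnected (Metric.closedBall (0 : Rd d) R) :=
      (convex_closedBall _ _).isPreconnected
    have hR : 0 ≤ R := (norm_nonneg _).trans hz
    obtain ⟨y, hy, hy'⟩ := hpre.intermediate_value (f := fun z => |(D z).im|)
      (Metric.mem_closedBall_self hR) (show z ∈ Metric.closedBall (0 : Rd d) R by simpa using hz)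
      (by fun_prop) ⟨by simp [h0, Real.pi_pos.le], hcon⟩
    replace hy' : |(D y).im| = Real.pi := hy'
    have h1 := h y (by simpa using hy)
    have h2 := (Complex.abs_re_le_norm _).trans_lt h1
    rw [Complex.sub_re, Complex.one_re, Complex.exp_re, ← Real.cos_abs, hy', Real.cos_pi] at h2
    have := Real.exp_pos (D y).re
    rw [abs_lt] at h2
    linarith
  rw [abs_lt] at key
  exact Complex.log_exp key.1 key.2.le

/-- Compare with one fixed `F N`: for `n ≥ N` the quotients `exp (F n - F N)` stay close to `1` on
the ball, so `F n` is `F N` plus a principal logarithm, which is continuous in the quotient and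
bounded. -/
lemma exists_log_limit_on_ball {F : ℕ → Rd d → ℂ} {φ : Rd d → ℂ} (hF : ∀ n, Continuous (F n))
    (h0 : ∀ n, F n 0 = 0) (hφ : Continuous φ) (hne : ∀ z, φ z ≠ 0)
    (h : TendstoLocallyUniformly (fun n z => Complex.exp (F n z)) φ atTop) {R : ℝ} (hR : 0 ≤ R) :
    ∃ G : Rd d → ℂ, ContinuousOn G (Metric.closedBall 0 R) ∧
      (∀ z, ‖z‖ ≤ R → Tendsto (fun n => F n z) atTop (𝓝 (G z))) ∧
      ∃ C, ∀ᶠ n in atTop, ∀ z, ‖z‖ ≤ R → ‖F n z‖ ≤ C := by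
  have hK : IsCompact (Metric.closedBall (0 : Rd d) R) := isCompact_closedBall _ _
  have hu := (tendstoLocallyUniformly_iff_forall_isCompact.1 h) _ hK
  obtain ⟨z₀, -, hz₀⟩ := hK.exists_isMinOn ⟨0, Metric.mem_closedBall_self hR⟩
    (f := fun z => ‖φ z‖) (by fun_prop)
  have hm : 0 < ‖φ z₀‖ := norm_pos_iff.2 (hne z₀)
  set m := ‖φ z₀‖
  rw [Metric.tendstoUniformlyOn_iff] at hu
  -- With `m` the minimum of `|φ|`, the quotients differ from `1` by at most `(m / 3) / (5 m / 6) =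
  -- 2 / 5`. Being at most `1 / 2`, this also permits the bound on `log (1 + w)` used at the end.
  obtain ⟨N, hN⟩ := eventually_atTop.1 (hu (m / 6) (by positivity))
  have hN' : ∀ n, N ≤ n → ∀ z, ‖z‖ ≤ R → ‖φ z - Complex.exp (F n z)‖ < m / 6 := fun n hn z hz => by
    simpa [dist_eq_norm] using hN n hn z (by simpa using hz)
  have hmz : ∀ z, ‖z‖ ≤ R → m ≤ ‖φ z‖ := fun z hz => hz₀ (by simpa using hz)
  have hlow : ∀ z, ‖z‖ ≤ R → 5 / 6 * m ≤ ‖Complex.exp (F N z)‖ := fun z hz => by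
    have h1 := hN' N le_rfl z hz
    have h2 := hmz z hz
    have h3 := norm_sub_norm_le (φ z) (Complex.exp (F N z))
    linarith
  have hq : ∀ n, N ≤ n → ∀ z, ‖z‖ ≤ R → ‖Complex.exp (F n z - F N z) - 1‖ ≤ 1 / 2 := by
    intro n hn z hz
    have h1 := hN' N le_rfl z hz
    have h2 := hN' n hn z hz
    have h3 := hlow z hz
    have hpos : 0 < ‖Complex.exp (F N z)‖ := norm_pos_iff.2 (Complex.exp_ne_zero _)
    rw [Complex.exp_sub, div_sub_one (Complex.exp_ne_zero _), norm_div, div_le_iff₀ hpos]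
    have h4 : ‖Complex.exp (F n z) - Complex.exp (F N z)‖ ≤ m / 6 + m / 6 := by
      calc _ = ‖(φ z - Complex.exp (F N z)) - (φ z - Complex.exp (F n z))‖ := by congr 1; ring
        _ ≤ _ := (norm_sub_le _ _).trans (add_le_add h1.le h2.le)
    linarith
  have hlog : ∀ n, N ≤ n → ∀ z, ‖z‖ ≤ R →
      F n z = F N z + Complex.log (Complex.exp (F n z) / Complex.exp (F N z)) := by
    intro n hn z hz
    rw [← Complex.exp_sub, eq_log_exp_of_norm_exp_sub_one_lt (D := fun z => F n z - F N z)
      ((hF n).sub (hF N)) (by simp [h0]) (fun z hz => (hq n hn z hz).trans_lt (by norm_num)) hz]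
    ring
  have hqφ : ∀ z, ‖z‖ ≤ R → φ z / Complex.exp (F N z) ∈ Complex.slitPlane := by
    intro z hz
    have h1 := hN' N le_rfl z hz
    have h3 := hlow z hz
    have hpos : 0 < ‖Complex.exp (F N z)‖ := norm_pos_iff.2 (Complex.exp_ne_zero _)
    have h4 : ‖φ z / Complex.exp (F N z) - 1‖ < 1 := by
      rw [div_sub_one (Complex.exp_ne_zero _), norm_div, div_lt_one hpos]
      linarith
    have h5 := (Complex.abs_re_le_norm _).trans_lt h4
    rw [Complex.sub_re, Complex.one_re, abs_lt] at h5
    exact Or.inl (by linarith)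
  refine ⟨fun z => F N z + Complex.log (φ z / Complex.exp (F N z)), ?_, fun z hz => ?_, ?_⟩
  · refine (hF N).continuousOn.add (ContinuousOn.clog (Continuous.continuousOn ?_)
      fun z hz => hqφ z (by simpa using hz))
    exact hφ.div (Complex.continuous_exp.comp (hF N)) fun z => Complex.exp_ne_zero _
  · have h1 : Tendsto (fun n => Complex.exp (F n z)) atTop (𝓝 (φ z)) := by
      exact h.tendstoLocallyUniformlyOn.tendsto_at (Set.mem_univ z)
    have h2 := ((h1.div_const (Complex.exp (F N z))).clog (hqφ z hz)).const_add (F N z)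
    refine h2.congr' ?_
    filter_upwards [eventually_ge_atTop N] with n hn using (hlog n hn z hz).symm
  · obtain ⟨C, hC⟩ := hK.exists_bound_of_continuousOn (hF N).continuousOn
    refine ⟨C + 1, ?_⟩
    filter_upwards [eventually_ge_atTop N] with n hn z hz
    rw [hlog n hn z hz, ← Complex.exp_sub]
    refine (norm_add_le _ _).trans (add_le_add (hC z (by simpa using hz)) ?_)
    have h1 := hq n hn z hz
    have h2 := Complex.norm_log_one_add_half_le_self h1
    rw [add_sub_cancel] at h2
    linarith

/-- If `exp ∘ F n` converges locally uniformly to a nowhere vanishing continuous function and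
`F n 0 = 0`, then `F n` converges to a continuous logarithm of the limit. -/
theorem exists_log_limit {F : ℕ → Rd d → ℂ} {φ : Rd d → ℂ} (hF : ∀ n, Continuous (F n))
    (h0 : ∀ n, F n 0 = 0) (hφ : Continuous φ) (hne : ∀ z, φ z ≠ 0)
    (h : TendstoLocallyUniformly (fun n z => Complex.exp (F n z)) φ atTop) :
    ∃ G : Rd d → ℂ, Continuous G ∧ (∀ z, Tendsto (fun n => F n z) atTop (𝓝 (G z))) ∧
      (∀ R, ∃ C, ∀ᶠ n in atTop, ∀ z, ‖z‖ ≤ R → ‖F n z‖ ≤ C) ∧ ∀ z, Complex.exp (G z) = φ z := by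
  have key := fun (R : ℝ) (hR : 0 ≤ R) => exists_log_limit_on_ball hF h0 hφ hne h hR
  have hex : ∀ z, ∃ w, Tendsto (fun n => F n z) atTop (𝓝 w) := fun z => by
    obtain ⟨G, -, hG, -⟩ := key ‖z‖ (norm_nonneg z)
    exact ⟨G z, hG z le_rfl⟩
  choose G hG using hex
  refine ⟨G, continuous_iff_continuousAt.2 fun z => ?_, hG, fun R => ?_, fun z => ?_⟩
  · obtain ⟨G', hc', hG', -⟩ := key (‖z‖ + 1) (by positivity)
    have hmem : Metric.closedBall (0 : Rd d) (‖z‖ + 1) ∈ 𝓝 z :=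
      Filter.mem_of_superset (Metric.ball_mem_nhds z one_pos) fun w hw => by
        have := norm_sub_norm_le w z
        rw [Metric.mem_ball, dist_eq_norm] at hw
        simp only [Metric.mem_closedBall, dist_zero_right]
        linarith
    refine (hc'.continuousAt hmem).congr ?_
    filter_upwards [hmem] with w hw
    exact tendsto_nhds_unique (hG' w (by simpa using hw)) (hG w)
  · obtain ⟨-, -, -, C, hC⟩ := key (max R 0) (le_max_right _ _)
    exact ⟨C, hC.mono fun n hn z hz => hn z (hz.trans (le_max_left _ _))⟩
  · exact tendsto_nhds_unique ((Complex.continuous_exp.tendsto _).comp (hG z))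
      (h.tendstoLocallyUniformlyOn.tendsto_at (Set.mem_univ z))

/-- Continuous functions vanishing at `0` with the same exponential agree. -/
lemma eq_of_exp_eq {F G : Rd d → ℂ} (hF : Continuous F) (hG : Continuous G) (hF0 : F 0 = 0)
    (hG0 : G 0 = 0) (h : ∀ z, Complex.exp (F z) = Complex.exp (G z)) (z : Rd d) : F z = G z := by
  have := eq_log_exp_of_norm_exp_sub_one_lt (D := fun z => F z - G z) (hF.sub hG)
    (by simp [hF0, hG0]) (R := ‖z‖) (fun w _ => by
      rw [Complex.exp_sub, h w, div_self (Complex.exp_ne_zero _)]; simp) le_rfl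
  simp only [Complex.exp_sub, h z, div_self (Complex.exp_ne_zero _), Complex.log_one] at this
  exact (sub_eq_zero.1 this.symm)

/-! ### Real and imaginary parts of exponents; the sign of the Gaussian part -/

lemma re_integral_levyKernel (hc : IsRepresentationFunction c) (hcc : Continuous c)
    {η : Measure (Rd d)} (hη : Integrable truncSq η) (z : Rd d) :
    (∫ x, levyKernel c z x ∂η).re = ∫ x, (Real.cos ⟪z, x⟫ - 1) ∂η := by
  simp only [← levyKernel_re c]
  exact (integral_re (𝕜 := ℂ) (integrable_levyKernel hc hcc hη z)).symm

lemma im_integral_levyKernel (hc : IsRepresentationFunction c) (hcc : Continuous c)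
    {η : Measure (Rd d)} (hη : Integrable truncSq η) (z : Rd d) :
    (∫ x, levyKernel c z x ∂η).im = ∫ x, (Real.sin ⟪z, x⟫ - ⟪z, c x⟫) ∂η := by
  simp only [← levyKernel_im c]
  exact (integral_im (𝕜 := ℂ) (integrable_levyKernel hc hcc hη z)).symm

lemma levyExponent_re (hc : IsRepresentationFunction c) (hcc : Continuous c)
    {η : Measure (Rd d)} (hη : Integrable truncSq η) (A : Matrix (Fin d) (Fin d) ℝ) (γ z : Rd d) :
    (levyExponent c A η γ z).re = -(1 / 2) * quadForm A z + ∫ x, (Real.cos ⟪z, x⟫ - 1) ∂η := by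
  rw [levyExponent, Complex.add_re, re_integral_levyKernel hc hcc hη]
  simp

lemma levyExponent_im (hc : IsRepresentationFunction c) (hcc : Continuous c)
    {η : Measure (Rd d)} (hη : Integrable truncSq η) (A : Matrix (Fin d) (Fin d) ℝ) (γ z : Rd d) :
    (levyExponent c A η γ z).im = ⟪γ, z⟫ + ∫ x, (Real.sin ⟪z, x⟫ - ⟪z, c x⟫) ∂η := by
  rw [levyExponent, Complex.add_im, im_integral_levyKernel hc hcc hη]
  simp

lemma abs_cos_inner_sub_one_le (z x : Rd d) :
    |Real.cos ⟪z, x⟫ - 1| ≤ (2 + ‖z‖ ^ 2) * truncSq x := by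
  rw [abs_sub_comm, abs_of_nonneg (sub_nonneg.2 (Real.cos_le_one _))]
  refine le_mul_truncSq zero_le_two (by positivity) ?_ ?_
  · linarith [Real.neg_one_le_cos ⟪z, x⟫]
  · have h1 := Real.one_sub_sq_div_two_le_cos (x := ⟪z, x⟫)
    have h4 : ⟪z, x⟫ ^ 2 ≤ ‖z‖ ^ 2 * ‖x‖ ^ 2 := by
      rw [← sq_abs, ← mul_pow]; gcongr; exact abs_real_inner_le_norm z x
    nlinarith [sq_nonneg (⟪z, x⟫ : ℝ)]

lemma integrable_cos_inner_sub_one {η : Measure (Rd d)} (hη : Integrable truncSq η) (z : Rd d) :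
    Integrable (fun x => Real.cos ⟪z, x⟫ - 1) η :=
  integrable_of_le_truncSq hη (Continuous.aestronglyMeasurable (by fun_prop))
    (abs_cos_inner_sub_one_le z)

/-- By dominated convergence the jump part is of smaller order than `|z|²` along rays, so the
Gaussian form can be read off at infinity whatever the sign of the jump measure. -/
lemma tendsto_integral_cos_div_sq {η : Measure (Rd d)} (hη : Integrable truncSq η) (z : Rd d) :
    Tendsto (fun n : ℕ => (∫ x, (Real.cos ⟪((n : ℝ) + 1) • z, x⟫ - 1) ∂η) / ((n : ℝ) + 1) ^ 2)
      atTop (𝓝 0) := by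
  simp only [← integral_div]
  rw [← integral_zero (Rd d) ℝ (μ := η)]
  refine tendsto_integral_of_dominated_convergence (fun x => (2 + ‖z‖ ^ 2) * truncSq x)
    (fun n => Continuous.aestronglyMeasurable (by fun_prop)) (hη.const_mul _)
    (fun n => Eventually.of_forall fun x => ?_) (Eventually.of_forall fun x => ?_)
  · have h1 := abs_cos_inner_sub_one_le (((n : ℝ) + 1) • z) x
    have hn : (1 : ℝ) ≤ ((n : ℝ) + 1) ^ 2 := one_le_pow₀ (by simp)
    rw [norm_div, Real.norm_eq_abs, Real.norm_of_nonneg (by positivity : 0 ≤ ((n : ℝ) + 1) ^ 2),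
      div_le_iff₀ (by positivity)]
    refine h1.trans ?_
    rw [norm_smul, Real.norm_of_nonneg (by positivity : 0 ≤ (n : ℝ) + 1), mul_pow]
    have := truncSq_nonneg x
    have h2 : 2 + ((n : ℝ) + 1) ^ 2 * ‖z‖ ^ 2 ≤ (2 + ‖z‖ ^ 2) * ((n : ℝ) + 1) ^ 2 := by nlinarith
    nlinarith
  · have h1 : Tendsto (fun n : ℕ => 2 * (1 / ((n : ℝ) + 1))) atTop (𝓝 0) := by
      simpa using tendsto_one_div_add_atTop_nhds_zero_nat.const_mul (2 : ℝ)
    refine squeeze_zero_norm (fun n => ?_) h1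
    rw [norm_div, Real.norm_eq_abs, Real.norm_of_nonneg (by positivity : 0 ≤ ((n : ℝ) + 1) ^ 2),
      div_le_iff₀ (by positivity)]
    have h2 : 2 * (1 / ((n : ℝ) + 1)) * ((n : ℝ) + 1) ^ 2 = 2 * ((n : ℝ) + 1) := by field_simp
    rw [h2, abs_sub_comm, abs_of_nonneg (sub_nonneg.2 (Real.cos_le_one _))]
    have := Real.neg_one_le_cos ⟪((n : ℝ) + 1) • z, x⟫
    have hn : (0 : ℝ) ≤ n := n.cast_nonneg
    linarith

/-- A generating triplet whose exponent has nonpositive real part has a nonnegative Gaussian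
part, even if its Lévy measure is only signed. -/
lemma quadForm_nonneg_of_re_nonpos (hc : IsRepresentationFunction c) (hcc : Continuous c)
    {A : Matrix (Fin d) (Fin d) ℝ} {η₁ η₂ : Measure (Rd d)} (h₁ : Integrable truncSq η₁)
    (h₂ : Integrable truncSq η₂) {γ : Rd d}
    (h : ∀ z, (levyExponent c A η₁ γ z - ∫ x, levyKernel c z x ∂η₂).re ≤ 0) (z : Rd d) :
    0 ≤ quadForm A z := by
  have h1 := ((tendsto_integral_cos_div_sq h₁ z).sub (tendsto_integral_cos_div_sq h₂ z)).const_add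
    (-(1 / 2) * quadForm A z)
  have h2 : -(1 / 2) * quadForm A z + (0 - 0) ≤ 0 := by
    refine le_of_tendsto' h1 fun n => ?_
    have h3 := h (((n : ℝ) + 1) • z)
    have hn : (0 : ℝ) < (n : ℝ) + 1 := by positivity
    rw [Complex.sub_re, levyExponent_re hc hcc h₁, re_integral_levyKernel hc hcc h₂,
      quadForm_smul] at h3
    have h4 := div_nonpos_of_nonpos_of_nonneg h3 (by positivity : 0 ≤ ((n : ℝ) + 1) ^ 2)
    refine le_of_eq_of_le ?_ h4
    field_simp
    ring
  linarith

/-! ### Uniqueness of triplets with a positive jump measure -/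

/-- Each shell has finite mass and the shells miss only the origin. This supplies the hypothesis of
Fubini's theorem for `charFun_levySmoothing`. -/
lemma sFinite_of_integrable_truncSq {η : Measure (Rd d)} (h0 : η {0} = 0)
    (hη : Integrable truncSq η) : SFinite η := by
  have h1 : η = Measure.sum fun n : ℕ => η.restrict (shell d n) := by
    rw [← Measure.restrict_iUnion _ measurableSet_shell, eq_comm,
      Measure.restrict_eq_self_of_ae_mem]
    · rw [ae_iff]
      refine measure_mono_null (fun x hx => ?_) h0
      by_contra hx0
      exact hx (Set.mem_iUnion.2 ⟨_, hx0, rfl⟩)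
    · intro i j hij
      refine Set.disjoint_left.2 fun x hx hx' => hij ?_
      rw [← hx.2, ← hx'.2]
  have h2 : ∀ n, IsFiniteMeasure (η.restrict (shell d n)) := fun n => by
    have := isFiniteMeasure_restrict_of_integrable_truncSq hη
      (by positivity : 0 < ((n : ℝ) + 1)⁻¹)
    have hsub : shell d n ⊆ {x : Rd d | ((n : ℝ) + 1)⁻¹ ≤ ‖x‖} := fun x hx => shell_away hx
    exact isFiniteMeasure_of_le _ (Measure.restrict_mono hsub le_rfl)
  rw [h1]
  infer_instance

lemma quadForm_single_add_single {A : Matrix (Fin d) (Fin d) ℝ} (hA : A.IsSymm) (i j : Fin d) :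
    quadForm A (EuclideanSpace.single i 1 + EuclideanSpace.single j 1)
      = A i i + A j j + 2 * A i j := by
  have h1 : ∀ k l : Fin d, ⟪EuclideanSpace.single k (1 : ℝ),
      Matrix.toEuclideanLin A (EuclideanSpace.single l 1)⟫ = A k l := fun k l => by
    simp [EuclideanSpace.inner_single_left, Matrix.toLpLin_apply]
  rw [quadForm, map_add, inner_add_left, inner_add_right, inner_add_right, h1, h1, h1, h1,
    hA.apply i j]
  ring

lemma ext_of_quadForm {A B : Matrix (Fin d) (Fin d) ℝ} (hA : A.IsSymm) (hB : B.IsSymm)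
    (h : ∀ z, quadForm A z = quadForm B z) : A = B := by
  ext i j
  have h1 := h (EuclideanSpace.single i 1 + EuclideanSpace.single j 1)
  have h2 := h (EuclideanSpace.single i 1)
  have h3 := h (EuclideanSpace.single j 1)
  rw [quadForm_single, quadForm_single] at h2 h3
  rw [quadForm_single_add_single hA, quadForm_single_add_single hB] at h1
  linarith

lemma sum_diag_div_nonneg {A : Matrix (Fin d) (Fin d) ℝ} (h : ∀ z, 0 ≤ quadForm A z) :
    0 ≤ ∑ i, A i i / 6 :=
  Finset.sum_nonneg fun i _ => by
    have := h (EuclideanSpace.single i 1)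
    rw [quadForm_single] at this
    positivity

/-- The Gaussian contribution sits at `0` and the weight is positive elsewhere, so removing the
origin and dividing by the weight recovers the jump measure. -/
lemma ext_of_levySmoothing_eq {A₁ A₂ : Matrix (Fin d) (Fin d) ℝ} {η₁ η₂ : Measure (Rd d)}
    (z₁ : η₁ {0} = 0) (z₂ : η₂ {0} = 0) (h : levySmoothing A₁ η₁ = levySmoothing A₂ η₂) :
    η₁ = η₂ := by
  have key : ∀ (A : Matrix (Fin d) (Fin d) ℝ) {η : Measure (Rd d)}, η {0} = 0 →
      ((levySmoothing A η).restrict {0}ᶜ).withDensity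
        (fun x => (ENNReal.ofReal (levyWeight x))⁻¹) = η := by
    intro A η h0
    have hd : (Measure.dirac (0 : Rd d)).restrict {0}ᶜ = 0 := by
      rw [Measure.restrict_eq_zero]; simp
    have hη : η.restrict {0}ᶜ = η := Measure.restrict_eq_self_of_ae_mem (by
      rw [ae_iff]; simpa using h0)
    rw [levySmoothing, Measure.restrict_add, Measure.restrict_smul, hd, smul_zero, add_zero,
      restrict_withDensity (measurableSet_singleton _).compl, hη]
    refine withDensity_inv_same₀ ?_ ?_ ?_
    · exact continuous_levyWeight.measurable.ennreal_ofReal.aemeasurable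
    · rw [ae_iff]
      refine measure_mono_null (fun x hx => ?_) h0
      by_contra hx0
      exact hx (by simpa using levyWeight_pos hx0)
    · simp
  rw [← key A₁ z₁, ← key A₂ z₂, h]

/-- The Lévy-Khintchine exponent determines the triplet. -/
theorem levyExponent_injective (hc : IsRepresentationFunction c) (hcc : Continuous c)
    {A₁ A₂ : Matrix (Fin d) (Fin d) ℝ} {η₁ η₂ : Measure (Rd d)} {γ₁ γ₂ : Rd d}
    (s₁ : A₁.IsSymm) (s₂ : A₂.IsSymm) (n₁ : ∀ z, 0 ≤ quadForm A₁ z) (n₂ : ∀ z, 0 ≤ quadForm A₂ z)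
    (z₁ : η₁ {0} = 0) (z₂ : η₂ {0} = 0) (h₁ : Integrable truncSq η₁) (h₂ : Integrable truncSq η₂)
    (h : ∀ z, levyExponent c A₁ η₁ γ₁ z = levyExponent c A₂ η₂ γ₂ z) :
    A₁ = A₂ ∧ η₁ = η₂ ∧ γ₁ = γ₂ := by
  have := sFinite_of_integrable_truncSq z₁ h₁
  have := sFinite_of_integrable_truncSq z₂ h₂
  have := isFiniteMeasure_levySmoothing A₁ h₁
  have := isFiniteMeasure_levySmoothing A₂ h₂
  have hM : levySmoothing A₁ η₁ = levySmoothing A₂ η₂ := by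
    refine Measure.ext_of_charFun (funext fun z => ?_)
    rw [charFun_levySmoothing hc hcc A₁ (sum_diag_div_nonneg n₁) h₁ γ₁,
      charFun_levySmoothing hc hcc A₂ (sum_diag_div_nonneg n₂) h₂ γ₂, funext h]
  -- With equal jump measures, the real parts of the exponents determine the matrix and the
  -- imaginary parts the drift.
  obtain rfl := ext_of_levySmoothing_eq z₁ z₂ hM
  refine ⟨ext_of_quadForm s₁ s₂ fun z => ?_, rfl, ext_inner_right ℝ fun z => ?_⟩
  · have := congrArg Complex.re (h z)
    rw [levyExponent_re hc hcc h₁, levyExponent_re hc hcc h₁] at this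
    linarith
  · have := congrArg Complex.im (h z)
    rw [levyExponent_im hc hcc h₁, levyExponent_im hc hcc h₁] at this
    linarith

/-! ### Quasi-Lévy type measures as differences of Lévy measures -/

namespace SignedMeasureAwayZero

lemma toFun_eq_sub (ν : SignedMeasureAwayZero d) (B : BorelAwayZero d) :
    ν.toFun B = ν.posPart.real B - ν.negPart.real B := by
  obtain ⟨B, r, hr, hB⟩ := B
  simp only [measureReal_def]
  rw [ν.posPart_apply hr hB, ν.negPart_apply hr hB, ← measureReal_def, ← measureReal_def,
    ← SignedMeasure.apply_eq_posPart_real_sub_negPart_real _ hB.1, ν.restr_apply hr hB.1]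
  congr 2
  exact (Set.inter_eq_left.2 fun x hx => hB.2 x hx).symm

lemma IsQuasiLevyType.integrable_posPart {ν : SignedMeasureAwayZero d} (h : ν.IsQuasiLevyType) :
    Integrable truncSq ν.posPart := h.mono_measure (Measure.le_add_right le_rfl)

lemma IsQuasiLevyType.integrable_negPart {ν : SignedMeasureAwayZero d} (h : ν.IsQuasiLevyType) :
    Integrable truncSq ν.negPart := h.mono_measure (Measure.le_add_left le_rfl)

end SignedMeasureAwayZero

/-- The difference of two Lévy measures as a signed measure away from zero. -/
def levySub (η σ : Measure (Rd d)) (hη : Integrable truncSq η) (hσ : Integrable truncSq σ) :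
    SignedMeasureAwayZero d where
  toFun B := η.real B - σ.real B
  isSigned r hr := by
    have := isFiniteMeasure_restrict_of_integrable_truncSq hη hr
    have := isFiniteMeasure_restrict_of_integrable_truncSq hσ hr
    refine ⟨(η.restrict {x | r ≤ ‖x‖}).toSignedMeasure - (σ.restrict {x | r ≤ ‖x‖}).toSignedMeasure,
      fun B hB => ?_⟩
    have hB' : (B : Set (Rd d)) ∩ {x : Rd d | r ≤ ‖x‖} = B :=
      Set.inter_eq_left.2 fun x hx => hB.2 x hx
    rw [_root_.sub_apply, Measure.toSignedMeasure_apply_measurable hB.1,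
      Measure.toSignedMeasure_apply_measurable hB.1, measureReal_restrict_apply hB.1,
      measureReal_restrict_apply hB.1, hB']

/-- Exhaust the complement of the origin by `{|x| ≥ 1 / (n + 1)}`; only `m`, the smaller measure,
must not charge `0`. -/
lemma measure_le_of_forall_away {m κ : Measure (Rd d)} (h0 : m {0} = 0)
    (h : ∀ B ∈ BorelAwayZero d, m B ≤ κ B) : m ≤ κ := by
  refine Measure.le_iff.2 fun B hB => ?_
  have hmon : Monotone fun n : ℕ => B ∩ {x : Rd d | ((n : ℝ) + 1)⁻¹ ≤ ‖x‖} := fun i j hij x hx =>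
    ⟨hx.1, le_trans (b := ((i : ℝ) + 1)⁻¹) (by gcongr) hx.2⟩
  have hU : ⋃ n : ℕ, B ∩ {x : Rd d | ((n : ℝ) + 1)⁻¹ ≤ ‖x‖} = B \ {0} := by
    ext x
    simp only [Set.mem_iUnion, Set.mem_inter_iff, Set.mem_ofPred_eq, Set.mem_sdiff,
      Set.mem_singleton_iff, exists_and_left, and_congr_right_iff]
    intro _
    constructor
    · rintro ⟨n, hn⟩ rfl
      rw [norm_zero] at hn
      have : 0 < ((n : ℝ) + 1)⁻¹ := by positivity
      linarith
    · intro hx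
      obtain ⟨n, hn⟩ := exists_nat_one_div_lt (norm_pos_iff.2 hx)
      exact ⟨n, by simpa using hn.le⟩
  calc m B = m (B \ {0}) := (measure_sdiff_null h0).symm
    _ = ⨆ n : ℕ, m (B ∩ {x : Rd d | ((n : ℝ) + 1)⁻¹ ≤ ‖x‖}) := by
      rw [← hU, hmon.measure_iUnion]
    _ ≤ ⨆ n : ℕ, κ (B ∩ {x : Rd d | ((n : ℝ) + 1)⁻¹ ≤ ‖x‖}) :=
      iSup_mono fun n => h _ (SignedMeasureAwayZero.inter_mem (by positivity) hB)
    _ ≤ κ B := iSup_le fun n => measure_mono Set.inter_subset_left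

lemma measure_lt_top_of_away {m : Measure (Rd d)} (hm : Integrable truncSq m) {B : Set (Rd d)}
    (hB : B ∈ BorelAwayZero d) : m B < ∞ := by
  obtain ⟨r, hr, hB⟩ := hB
  have := isFiniteMeasure_restrict_of_integrable_truncSq hm hr
  have h1 := measure_lt_top (m.restrict {x | r ≤ ‖x‖}) B
  have hB' : B ∩ {x : Rd d | r ≤ ‖x‖} = B := Set.inter_eq_left.2 fun x hx => hB.2 x hx
  rwa [Measure.restrict_apply hB.1, hB'] at h1

namespace SignedMeasureAwayZero

lemma posPart_lt_top (ν : SignedMeasureAwayZero d) {B : Set (Rd d)} (hB : B ∈ BorelAwayZero d) :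
    ν.posPart B < ∞ := by
  obtain ⟨r, hr, hB⟩ := hB
  rw [ν.posPart_apply hr hB]
  exact measure_lt_top _ _

lemma negPart_lt_top (ν : SignedMeasureAwayZero d) {B : Set (Rd d)} (hB : B ∈ BorelAwayZero d) :
    ν.negPart B < ∞ := by
  obtain ⟨r, hr, hB⟩ := hB
  rw [ν.negPart_apply hr hB]
  exact measure_lt_top _ _

/-- On a set bounded away from `0`, the positive part is the value of `ν` on a subset. -/
lemma exists_subset_posPart_eq (ν : SignedMeasureAwayZero d) (B : BorelAwayZero d) :
    ∃ B' : BorelAwayZero d, (B' : Set (Rd d)) ⊆ B ∧ ν.posPart.real B = ν.toFun B' := by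
  obtain ⟨B, r, hr, hB⟩ := B
  obtain ⟨S, hS, hpos, hneg⟩ := (ν.restr r).toJordanDecomposition.mutuallySingular
  have hB' : B ∩ Sᶜ ∈ BorelAway d r := ⟨hB.1.inter hS.compl, fun x hx => hB.2 x hx.1⟩
  refine ⟨⟨B ∩ Sᶜ, r, hr, hB'⟩, Set.inter_subset_left, ?_⟩
  rw [toFun_eq_sub]
  simp only [measureReal_def]
  rw [ν.posPart_apply hr hB, ν.posPart_apply hr hB', ν.negPart_apply hr hB',
    measure_mono_null Set.inter_subset_right hneg, ENNReal.toReal_zero, sub_zero,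
    ← Set.sdiff_eq, measure_sdiff_null hpos]

/-- On a set bounded away from `0`, the negative part is minus the value of `ν` on a subset. -/
lemma exists_subset_negPart_eq (ν : SignedMeasureAwayZero d) (B : BorelAwayZero d) :
    ∃ B' : BorelAwayZero d, (B' : Set (Rd d)) ⊆ B ∧ ν.negPart.real B = -ν.toFun B' := by
  obtain ⟨B, r, hr, hB⟩ := B
  obtain ⟨S, hS, hpos, hneg⟩ := (ν.restr r).toJordanDecomposition.mutuallySingular
  have hB' : B ∩ S ∈ BorelAway d r := ⟨hB.1.inter hS, fun x hx => hB.2 x hx.1⟩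
  refine ⟨⟨B ∩ S, r, hr, hB'⟩, Set.inter_subset_left, ?_⟩
  rw [toFun_eq_sub]
  simp only [measureReal_def]
  have h1 : (ν.restr r).toJordanDecomposition.negPart (B ∩ S)
      = (ν.restr r).toJordanDecomposition.negPart B := by
    rw [← measure_sdiff_null (s := B) hneg, Set.sdiff_compl]
  rw [ν.negPart_apply hr hB, ν.posPart_apply hr hB', ν.negPart_apply hr hB',
    measure_mono_null Set.inter_subset_right hpos, ENNReal.toReal_zero, zero_sub, neg_neg, h1]

/-- If `ν = η - σ` away from `0`, then `ν⁺ ≤ η`. -/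
lemma posPart_le {ν : SignedMeasureAwayZero d} {η σ : Measure (Rd d)} (hη : Integrable truncSq η)
    (h : ∀ B : BorelAwayZero d, ν.toFun B = η.real B - σ.real B) : ν.posPart ≤ η := by
  refine measure_le_of_forall_away ν.posPart_zero fun B hB => ?_
  obtain ⟨B', hB', he⟩ := ν.exists_subset_posPart_eq ⟨B, hB⟩
  have hη' := measure_lt_top_of_away hη hB
  rw [← ENNReal.toReal_le_toReal (ν.posPart_lt_top hB).ne hη'.ne]
  have h1 : ν.posPart.real B = ν.toFun B' := he
  have h2 : η.real B' ≤ η.real B := measureReal_mono hB' hη'.ne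
  rw [h] at h1
  have h3 : 0 ≤ σ.real B' := measureReal_nonneg
  change ν.posPart.real B ≤ η.real B
  linarith

/-- If `ν = η - σ` away from `0`, then `ν⁻ ≤ σ`. -/
lemma negPart_le {ν : SignedMeasureAwayZero d} {η σ : Measure (Rd d)} (hσ : Integrable truncSq σ)
    (h : ∀ B : BorelAwayZero d, ν.toFun B = η.real B - σ.real B) : ν.negPart ≤ σ := by
  refine measure_le_of_forall_away ν.negPart_zero fun B hB => ?_
  obtain ⟨B', hB', he⟩ := ν.exists_subset_negPart_eq ⟨B, hB⟩
  have hσ' := measure_lt_top_of_away hσ hB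
  rw [← ENNReal.toReal_le_toReal (ν.negPart_lt_top hB).ne hσ'.ne]
  have h1 : ν.negPart.real B = -ν.toFun B' := he
  have h2 : σ.real B' ≤ σ.real B := measureReal_mono hB' hσ'.ne
  rw [h] at h1
  have h3 : 0 ≤ η.real B' := measureReal_nonneg
  change ν.negPart.real B ≤ σ.real B
  linarith

/-- If `ν = η - σ` away from `0`, then `ν⁺ + σ = η + ν⁻`. -/
lemma posPart_add_eq {ν : SignedMeasureAwayZero d} {η σ : Measure (Rd d)}
    (hη : Integrable truncSq η) (hσ : Integrable truncSq σ) (h0 : η {0} = 0) (h0' : σ {0} = 0)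
    (h : ∀ B : BorelAwayZero d, ν.toFun B = η.real B - σ.real B) :
    ν.posPart + σ = η + ν.negPart := by
  have key : ∀ B ∈ BorelAwayZero d, (ν.posPart + σ) B = (η + ν.negPart) B := fun B hB => by
    have h1 := ν.toFun_eq_sub ⟨B, hB⟩
    rw [h] at h1
    simp only [Measure.add_apply]
    rw [← ENNReal.toReal_eq_toReal_iff' (ENNReal.add_lt_top.2 ⟨ν.posPart_lt_top hB,
      measure_lt_top_of_away hσ hB⟩).ne (ENNReal.add_lt_top.2 ⟨measure_lt_top_of_away hη hB,
      ν.negPart_lt_top hB⟩).ne, ENNReal.toReal_add (ν.posPart_lt_top hB).ne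
      (measure_lt_top_of_away hσ hB).ne, ENNReal.toReal_add (measure_lt_top_of_away hη hB).ne
      (ν.negPart_lt_top hB).ne]
    simp only [measureReal_def] at h1
    linarith
  refine le_antisymm (measure_le_of_forall_away ?_ fun B hB => (key B hB).le)
    (measure_le_of_forall_away ?_ fun B hB => (key B hB).ge)
  · simp [ν.posPart_zero, h0']
  · simp [ν.negPart_zero, h0]

end SignedMeasureAwayZero

/-- The Lévy-Khintchine representation in terms of the exponents of `ν⁺` and `ν⁻`. -/
lemma IsCharacteristicTriplet.charFun_eq_exp {μ : ProbabilityMeasure (Rd d)}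
    {A : Matrix (Fin d) (Fin d) ℝ} {ν : SignedMeasureAwayZero d} {γ : Rd d}
    (h : IsCharacteristicTriplet c μ A ν γ) (z : Rd d) : charFun (μ : Measure (Rd d)) z
      = Complex.exp (levyExponent c A ν.posPart γ z - ∫ x, levyKernel c z x ∂ν.negPart) := by
  rw [h.charFun_eq, levyExponent, SignedMeasureAwayZero.integral, add_sub_assoc]
  rfl

/-- A characteristic function is bounded by `1`, so the exponent has nonpositive real part, and the
Gaussian form dominates that real part at infinity. -/
lemma IsCharacteristicTriplet.quadForm_nonneg (hc : IsRepresentationFunction c)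
    (hcc : Continuous c) {μ : ProbabilityMeasure (Rd d)}
    {A : Matrix (Fin d) (Fin d) ℝ} {ν : SignedMeasureAwayZero d} {γ : Rd d}
    (h : IsCharacteristicTriplet c μ A ν γ) (z : Rd d) : 0 ≤ quadForm A z := by
  refine quadForm_nonneg_of_re_nonpos hc hcc h.quasiLevy.integrable_posPart
    h.quasiLevy.integrable_negPart (γ := γ) (fun z => ?_) z
  have h1 := norm_charFun_le_one (μ := (μ : Measure (Rd d))) z
  rwa [h.charFun_eq_exp, Complex.norm_exp, Real.exp_le_one_iff] at h1

lemma levyExponent_add_measure (hc : IsRepresentationFunction c) (hcc : Continuous c)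
    {A : Matrix (Fin d) (Fin d) ℝ} {η σ : Measure (Rd d)} (hη : Integrable truncSq η)
    (hσ : Integrable truncSq σ) (γ z : Rd d) :
    levyExponent c A (η + σ) γ z = levyExponent c A η γ z + ∫ x, levyKernel c z x ∂σ := by
  rw [levyExponent, integral_add_measure (integrable_levyKernel hc hcc hη z)
    (integrable_levyKernel hc hcc hσ z), levyExponent, add_assoc]

/-- A distribution with exponent `ψ(A, η, γ) - ψ(0, σ, 0)` for Lévy measures `η` and `σ` has the
characteristic triplet `(A, η - σ, γ)`. -/
lemma isCharacteristicTriplet_levySub (hc : IsRepresentationFunction c) (hcc : Continuous c)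
    {μ : ProbabilityMeasure (Rd d)} {A : Matrix (Fin d) (Fin d) ℝ} (hA : A.IsSymm)
    {η σ : Measure (Rd d)} (hη : Integrable truncSq η) (hσ : Integrable truncSq σ)
    (h0 : η {0} = 0) (h0' : σ {0} = 0) {γ : Rd d}
    (h : ∀ z, charFun (μ : Measure (Rd d)) z
      = Complex.exp (levyExponent c A η γ z - ∫ x, levyKernel c z x ∂σ)) :
    IsCharacteristicTriplet c μ A (levySub η σ hη hσ) γ := by
  set ν := levySub η σ hη hσ
  have hν : ∀ B : BorelAwayZero d, ν.toFun B = η.real B - σ.real B := fun B => rfl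
  have hp : Integrable truncSq ν.posPart :=
    hη.mono_measure (SignedMeasureAwayZero.posPart_le hη hν)
  have hn : Integrable truncSq ν.negPart :=
    hσ.mono_measure (SignedMeasureAwayZero.negPart_le hσ hν)
  refine ⟨hA, hp.add_measure hn, fun z => ?_⟩
  -- `η` and `σ` need not be the Jordan parts of `ν`, as common mass cancels. The identity `ν⁺ + σ =
  -- η + ν⁻` compares exponents without subtracting measures.
  have h1 := congrArg (fun m => levyExponent c A m γ z)
    (SignedMeasureAwayZero.posPart_add_eq hη hσ h0 h0' hν)
  simp only [levyExponent_add_measure hc hcc hp hσ, levyExponent_add_measure hc hcc hη hn] at h1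
  rw [h, sub_eq_sub_iff_add_eq_add.2 h1.symm, levyExponent, SignedMeasureAwayZero.integral,
    add_sub_assoc]
  rfl

/-- Any triplet of a distribution with exponent `ψ(A, η, γ) - ψ(0, σ, 0)` is `(A, η - σ, γ)`. -/
lemma IsCharacteristicTriplet.eq_of_charFun_eq (hc : IsRepresentationFunction c)
    (hcc : Continuous c)
    {μ : ProbabilityMeasure (Rd d)} {A A' : Matrix (Fin d) (Fin d) ℝ} (hA : A.IsSymm)
    {η σ : Measure (Rd d)} (hη : Integrable truncSq η) (hσ : Integrable truncSq σ)
    (h0 : η {0} = 0) (h0' : σ {0} = 0) {γ γ' : Rd d}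
    (h : ∀ z, charFun (μ : Measure (Rd d)) z
      = Complex.exp (levyExponent c A η γ z - ∫ x, levyKernel c z x ∂σ))
    {ν : SignedMeasureAwayZero d} (hμ : IsCharacteristicTriplet c μ A' ν γ') :
    A' = A ∧ γ' = γ ∧ ∀ B : BorelAwayZero d, η.real B = ν.toFun B + σ.real B := by
  have hp := hμ.quasiLevy.integrable_posPart
  have hn := hμ.quasiLevy.integrable_negPart
  -- Both exponents are continuous and vanish at `0`, so equality of their exponentials lifts to the
  -- exponents.
  have hexp := eq_of_exp_eq
    ((continuous_levyExponent hc hcc hp A' γ').sub (continuous_integral_levyKernel hc hcc hn))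
    ((continuous_levyExponent hc hcc hη A γ).sub (continuous_integral_levyKernel hc hcc hσ))
    (by simp [levyExponent_zero, levyKernel_zero]) (by simp [levyExponent_zero, levyKernel_zero])
    (fun z => by simp only [Pi.sub_apply]; rw [← h, ← hμ.charFun_eq_exp])
  have htri := isCharacteristicTriplet_levySub hc hcc hA hη hσ h0 h0' h
  -- Adding both negative parts to both sides leaves exponents with positive jump measures.
  obtain ⟨h1, h2, h3⟩ := levyExponent_injective hc hcc (η₁ := ν.posPart + σ)
    (η₂ := η + ν.negPart) (γ₁ := γ') (γ₂ := γ) hμ.symm hA (hμ.quadForm_nonneg hc hcc)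
    (htri.quadForm_nonneg hc hcc) (by simp [ν.posPart_zero, h0']) (by simp [ν.negPart_zero, h0])
    (hp.add_measure hσ) (hη.add_measure hn) (fun z => by
      rw [levyExponent_add_measure hc hcc hp hσ, levyExponent_add_measure hc hcc hη hn]
      exact sub_eq_sub_iff_add_eq_add.1 (hexp z))
  refine ⟨h1, h3, fun B => ?_⟩
  have h4 := congrArg (fun m => (m (B : Set (Rd d))).toReal) h2
  simp only [Measure.add_apply] at h4
  rw [ENNReal.toReal_add (ν.posPart_lt_top B.2).ne (measure_lt_top_of_away hσ B.2).ne,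
    ENNReal.toReal_add (measure_lt_top_of_away hη B.2).ne (ν.negPart_lt_top B.2).ne] at h4
  rw [ν.toFun_eq_sub]
  simp only [measureReal_def]
  linarith

/-! ### Cutoffs and convergence of the negative parts -/

/-- A continuous cutoff that vanishes for `|x| ≤ ε` and equals `1` for `|x| ≥ 2ε`. -/
def cutoff (ε : ℝ) (x : Rd d) : ℝ := max 0 (min 1 (‖x‖ / ε - 1))

lemma continuous_cutoff (ε : ℝ) : Continuous (cutoff (d := d) ε) := by unfold cutoff; fun_prop

lemma cutoff_nonneg (ε : ℝ) (x : Rd d) : 0 ≤ cutoff ε x := le_max_left _ _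

lemma cutoff_le_one (ε : ℝ) (x : Rd d) : cutoff ε x ≤ 1 := max_le zero_le_one (min_le_left _ _)

lemma cutoff_eq_zero {ε : ℝ} (hε : 0 < ε) {x : Rd d} (hx : ‖x‖ ≤ ε) : cutoff ε x = 0 := by
  have : ‖x‖ / ε ≤ 1 := (div_le_one hε).2 hx
  exact max_eq_left ((min_le_right _ _).trans (by linarith))

lemma cutoff_eq_one {ε : ℝ} (hε : 0 < ε) {x : Rd d} (hx : 2 * ε ≤ ‖x‖) : cutoff ε x = 1 := by
  have : 2 ≤ ‖x‖ / ε := (le_div_iff₀ hε).2 hx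
  rw [cutoff, min_eq_left (by linarith), max_eq_right zero_le_one]

lemma norm_mul_cutoff_le {F : Rd d → ℝ} {K : ℝ} (hK : ∀ x, ‖F x‖ ≤ K * truncSq x) (ε : ℝ)
    (x : Rd d) : ‖F x * cutoff ε x‖ ≤ K * truncSq x := by
  rw [norm_mul, Real.norm_of_nonneg (cutoff_nonneg _ _)]
  exact (mul_le_of_le_one_right (norm_nonneg _) (cutoff_le_one _ _)).trans (hK x)

lemma eq_zero_of_le_truncSq {E : Type*} [NormedAddCommGroup E] {F : Rd d → E} {K : ℝ}
    (hK : ∀ x, ‖F x‖ ≤ K * truncSq x) : F 0 = 0 := by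
  simpa [truncSq] using hK 0

lemma tendsto_integral_mul_cutoff {η : Measure (Rd d)} (hη : Integrable truncSq η)
    {F : Rd d → ℝ} (hF : Continuous F) {K : ℝ} (hK : ∀ x, ‖F x‖ ≤ K * truncSq x) :
    Tendsto (fun ε => ∫ x, F x * cutoff ε x ∂η) (𝓝[>] 0) (𝓝 (∫ x, F x ∂η)) := by
  refine tendsto_integral_filter_of_dominated_convergence (fun x => K * truncSq x)
    (Eventually.of_forall fun ε => (hF.mul (continuous_cutoff ε)).aestronglyMeasurable)
    (Eventually.of_forall fun ε => Eventually.of_forall fun x => norm_mul_cutoff_le hK ε x)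
    (hη.const_mul _) (Eventually.of_forall fun x => ?_)
  rcases eq_or_ne x 0 with rfl | hx
  · simp [eq_zero_of_le_truncSq hK]
  refine tendsto_const_nhds.congr' ?_
  filter_upwards [Ioo_mem_nhdsGT (show (0 : ℝ) < ‖x‖ / 2 by positivity)] with ε hε
  rw [cutoff_eq_one hε.1 (by linarith [hε.2]), mul_one]

/-- Vague convergence away from `0` together with uniformly small second moments near `0` implies
convergence of the integrals of functions dominated by `1 ∧ |x|^2`. -/
theorem tendsto_integral_of_small_jumps {τ : ℕ → Measure (Rd d)} {σ : Measure (Rd d)}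
    (hτ : ∀ n, Integrable truncSq (τ n)) (hσ : Integrable truncSq σ)
    (hvague : ∀ f ∈ CSharp d, Tendsto (fun n => ∫ x, f x ∂(τ n)) atTop (𝓝 (∫ x, f x ∂σ)))
    (hsmall : Tendsto (fun ε : ℝ => limsup
        (fun n => ∫⁻ x in Metric.closedBall (0 : Rd d) ε, ‖x‖ₑ ^ 2 ∂(τ n)) atTop)
      (𝓝[>] 0) (𝓝 0))
    {F : Rd d → ℝ} (hF : Continuous F) {K : ℝ} (hK : ∀ x, ‖F x‖ ≤ K * truncSq x) :
    Tendsto (fun n => ∫ x, F x ∂(τ n)) atTop (𝓝 (∫ x, F x ∂σ)) := by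
  wlog hK0 : 0 ≤ K generalizing K
  · refine this (K := 0) (fun x => (hK x).trans ?_) le_rfl
    have := truncSq_nonneg x
    gcongr
    exact (not_le.1 hK0).le
  have hFi : ∀ {m : Measure (Rd d)}, Integrable truncSq m → Integrable F m := fun hm =>
    integrable_of_le_truncSq hm hF.aestronglyMeasurable hK
  have hFχ : ∀ {m : Measure (Rd d)}, Integrable truncSq m → ∀ ε,
      Integrable (fun x => F x * cutoff ε x) m := fun hm ε =>
    integrable_of_le_truncSq hm (hF.mul (continuous_cutoff ε)).aestronglyMeasurable
      (norm_mul_cutoff_le hK ε)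
  rw [Metric.tendsto_nhds]
  intro δ hδ
  -- Multiplied by `K` this is at most `δ / 4`; the `+ 1` covers `K = 0`.
  have hδ' : 0 < δ / (4 * (K + 1)) := by positivity
  have h1 : ∀ᶠ ε in 𝓝[>] (0 : ℝ), limsup
      (fun n => ∫⁻ x in Metric.closedBall (0 : Rd d) ε, ‖x‖ₑ ^ 2 ∂(τ n)) atTop
        < ENNReal.ofReal (δ / (4 * (K + 1))) :=
    hsmall.eventually (gt_mem_nhds (ENNReal.ofReal_pos.2 hδ'))
  -- The cutoff at `ε` reaches `1` only at radius `2 * ε`, so the second moment has to be small on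
  -- that larger ball.
  have h1' : ∀ᶠ ε in 𝓝[>] (0 : ℝ), limsup
      (fun n => ∫⁻ x in Metric.closedBall (0 : Rd d) (2 * ε), ‖x‖ₑ ^ 2 ∂(τ n)) atTop
        < ENNReal.ofReal (δ / (4 * (K + 1))) := by
    have ht : Tendsto (fun ε : ℝ => 2 * ε) (𝓝[>] 0) (𝓝[>] 0) := by
      refine tendsto_nhdsWithin_iff.2 ⟨?_, ?_⟩
      · have : Continuous fun ε : ℝ => 2 * ε := by fun_prop
        simpa using (this.tendsto 0).mono_left nhdsWithin_le_nhds
      · filter_upwards [self_mem_nhdsWithin] with ε hε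
        have : 0 < ε := hε
        simpa using this
    exact ht.eventually h1
  have h2 := Metric.tendsto_nhds.1 (tendsto_integral_mul_cutoff hσ hF hK) (δ / 4) (by positivity)
  obtain ⟨ε, ⟨hε1, hε2⟩, hε0⟩ := ((h1'.and h2).and self_mem_nhdsWithin).exists
  replace hε0 : 0 < ε := hε0
  let f : Rd d →ᵇ ℝ := BoundedContinuousFunction.ofNormedAddCommGroup
    (fun x => F x * cutoff ε x) (hF.mul (continuous_cutoff ε)) K fun x =>
      (norm_mul_cutoff_le hK ε x).trans (mul_le_of_le_one_right hK0 (truncSq_le_one x))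
  have hf : f ∈ CSharp d := by
    change ∀ᶠ x in 𝓝 (0 : Rd d), F x * cutoff ε x = 0
    filter_upwards [Metric.closedBall_mem_nhds (0 : Rd d) hε0] with x hx
    rw [cutoff_eq_zero hε0 (by simpa using hx), mul_zero]
  have h3 := Metric.tendsto_nhds.1 (hvague f hf) (δ / 4) (by positivity)
  filter_upwards [eventually_lt_of_limsup_lt hε1, h3] with n hn1 hn2
  have hn2' : |∫ x, F x * cutoff ε x ∂(τ n) - ∫ x, F x * cutoff ε x ∂σ| < δ / 4 := hn2
  rw [Real.dist_eq] at hε2 ⊢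
  have hsq : ∫ x in Metric.closedBall (0 : Rd d) (2 * ε), ‖x‖ ^ 2 ∂(τ n)
      ≤ δ / (4 * (K + 1)) := by
    rw [integral_eq_lintegral_of_nonneg_ae (Eventually.of_forall fun x => by positivity)
      (by fun_prop)]
    refine ENNReal.toReal_le_of_le_ofReal hδ'.le (le_trans (le_of_eq ?_) hn1.le)
    refine lintegral_congr fun x => ?_
    rw [ENNReal.ofReal_pow (norm_nonneg _), ofReal_norm]
  have hsqi : IntegrableOn (fun x : Rd d => ‖x‖ ^ 2) (Metric.closedBall 0 (2 * ε)) (τ n) := by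
    refine (((hτ n).const_mul (1 + (2 * ε) ^ 2)).integrableOn).mono' (by fun_prop) ?_
    refine (ae_restrict_iff' Metric.isClosed_closedBall.measurableSet).2
      (Eventually.of_forall fun x hx => ?_)
    have hx' : ‖x‖ ≤ 2 * ε := by simpa using hx
    rw [Real.norm_of_nonneg (by positivity), add_comm]
    refine le_mul_truncSq (by positivity) zero_le_one ?_ (by simp)
    gcongr
  have hdiff : |∫ x, F x ∂(τ n) - ∫ x, F x * cutoff ε x ∂(τ n)| ≤ K * (δ / (4 * (K + 1))) := by
    rw [← integral_sub (hFi (hτ n)) (hFχ (hτ n) ε)]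
    have hz : ∀ x ∉ Metric.closedBall (0 : Rd d) (2 * ε), F x - F x * cutoff ε x = 0 := by
      intro x hx
      have hx' : 2 * ε < ‖x‖ := by simpa using hx
      rw [cutoff_eq_one hε0 hx'.le, mul_one, sub_self]
    rw [← setIntegral_eq_integral_of_forall_compl_eq_zero hz, ← Real.norm_eq_abs]
    calc ‖∫ x in Metric.closedBall (0 : Rd d) (2 * ε), (F x - F x * cutoff ε x) ∂(τ n)‖
        ≤ ∫ x in Metric.closedBall (0 : Rd d) (2 * ε), K * ‖x‖ ^ 2 ∂(τ n) := by
          refine norm_integral_le_of_norm_le (hsqi.const_mul K) (Eventually.of_forall fun x => ?_)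
          have e1 : F x - F x * cutoff ε x = F x * (1 - cutoff ε x) := by ring
          rw [e1, norm_mul, Real.norm_of_nonneg (sub_nonneg.2 (cutoff_le_one ε x))]
          refine (mul_le_of_le_one_right (norm_nonneg _) (by linarith [cutoff_nonneg ε x])).trans
            ((hK x).trans ?_)
          gcongr
          exact truncSq_le_sq x
      _ ≤ _ := by rw [integral_const_mul]; gcongr
  have hfin : K * (δ / (4 * (K + 1))) ≤ δ / 4 := by
    rw [← mul_div_assoc, div_le_div_iff₀ (by positivity) (by norm_num)]
    nlinarith
  have e : ∫ x, F x ∂(τ n) - ∫ x, F x ∂σ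
      = (∫ x, F x ∂(τ n) - ∫ x, F x * cutoff ε x ∂(τ n))
        + (∫ x, F x * cutoff ε x ∂(τ n) - ∫ x, F x * cutoff ε x ∂σ)
        + (∫ x, F x * cutoff ε x ∂σ - ∫ x, F x ∂σ) := by ring
  rw [e]
  refine (abs_add_le _ _).trans_lt ?_
  have := abs_add_le (∫ x, F x ∂(τ n) - ∫ x, F x * cutoff ε x ∂(τ n))
    (∫ x, F x * cutoff ε x ∂(τ n) - ∫ x, F x * cutoff ε x ∂σ)
  linarith

lemma tendsto_complex_integral {ι : Type*} {l : Filter ι} {τ : ι → Measure (Rd d)}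
    {σ : Measure (Rd d)} {F : Rd d → ℂ} (hτ : ∀ n, Integrable F (τ n)) (hσ : Integrable F σ)
    (hre : Tendsto (fun n => ∫ x, (F x).re ∂(τ n)) l (𝓝 (∫ x, (F x).re ∂σ)))
    (him : Tendsto (fun n => ∫ x, (F x).im ∂(τ n)) l (𝓝 (∫ x, (F x).im ∂σ))) :
    Tendsto (fun n => ∫ x, F x ∂(τ n)) l (𝓝 (∫ x, F x ∂σ)) := by
  have key : ∀ {m : Measure (Rd d)}, Integrable F m → ∫ x, F x ∂m
      = ((∫ x, (F x).re ∂m : ℝ) : ℂ) + ((∫ x, (F x).im ∂m : ℝ) : ℂ) * Complex.I := fun hm =>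
    (integral_re_add_im (𝕜 := ℂ) hm).symm
  simp only [key (hτ _), key hσ]
  exact ((Complex.continuous_ofReal.tendsto _).comp hre).add
    (((Complex.continuous_ofReal.tendsto _).comp him).mul_const _)

/-! ### Convergence of generating triplets -/

lemma continuous_secondDifference {ψ : Rd d → ℂ} (hψ : Continuous ψ) :
    Continuous (secondDifference ψ) := by
  unfold secondDifference
  refine continuous_finsetSum _ fun i _ => ?_
  exact intervalIntegral.continuous_parametric_intervalIntegral_of_continuous'
    (by fun_prop) _ _

/-- Dominated convergence in the step: all points involved lie in the ball of radius `‖z‖ + 1`,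
which is why local boundedness of the exponents is carried along. -/
lemma tendsto_secondDifference {ψ : ℕ → Rd d → ℂ} {ψ' : Rd d → ℂ} (hψ : ∀ n, Continuous (ψ n))
    (hlim : ∀ z, Tendsto (fun n => ψ n z) atTop (𝓝 (ψ' z)))
    (hbdd : ∀ R, ∃ C, ∀ᶠ n in atTop, ∀ z, ‖z‖ ≤ R → ‖ψ n z‖ ≤ C) (z : Rd d) :
    Tendsto (fun n => secondDifference (ψ n) z) atTop (𝓝 (secondDifference ψ' z)) := by
  obtain ⟨C, hC⟩ := hbdd (‖z‖ + 1)
  refine tendsto_finsetSum _ fun i _ => ?_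
  refine intervalIntegral.tendsto_integral_filter_of_dominated_convergence
    (fun _ => C + 1 / 2 * (C + C)) (Eventually.of_forall fun n =>
      Continuous.aestronglyMeasurable (by have := hψ n; fun_prop)) ?_ (by simp)
    (Eventually.of_forall fun h _ => ?_)
  · filter_upwards [hC] with n hn
    refine Eventually.of_forall fun h hh => ?_
    rw [Set.uIoc_of_le zero_le_one] at hh
    have hs : ‖h • (EuclideanSpace.single i (1 : ℝ) : Rd d)‖ ≤ 1 := by
      rw [norm_smul, PiLp.norm_single, Real.norm_of_nonneg hh.1.le]
      simpa using hh.2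
    have h1 := hn z (by linarith)
    have h2 := hn (z + h • EuclideanSpace.single i 1) ((norm_add_le _ _).trans (by linarith))
    have h3 := hn (z - h • EuclideanSpace.single i 1) ((norm_sub_le _ _).trans (by linarith))
    refine (norm_sub_le _ _).trans (add_le_add h1 ?_)
    rw [norm_mul]
    have h4 : ‖(1 / 2 : ℂ)‖ = 1 / 2 := by norm_num
    rw [h4]
    gcongr
    exact (norm_add_le _ _).trans (add_le_add h2 h3)
  · exact (hlim _).sub (((hlim _).add (hlim _)).const_mul _)

/-- The matrix `∫ c(x) c(x)ᵀ η(dx)`. -/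
def momentMatrix (c : Rd d → Rd d) (η : Measure (Rd d)) : Matrix (Fin d) (Fin d) ℝ :=
  Matrix.of fun i j => ∫ x, c x i * c x j ∂η

lemma momentMatrix_isSymm (c : Rd d → Rd d) (η : Measure (Rd d)) : (momentMatrix c η).IsSymm := by
  ext i j
  simp [momentMatrix, mul_comm]

lemma IsRepresentationFunction.exists_norm_sq_le (hc : IsRepresentationFunction c)
    (hcc : Continuous c) : ∃ K, 0 ≤ K ∧ ∀ x, ‖c x‖ ^ 2 ≤ K * truncSq x := by
  obtain ⟨C, hC⟩ := hc.bounded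
  obtain ⟨K, hK, h⟩ := hc.exists_norm_sub_le hcc
  have hC0 : 0 ≤ C := (norm_nonneg _).trans (hC 0)
  have h1 : ∀ x, ‖c x‖ ^ 2 ≤ C ^ 2 := fun x => by gcongr; exact hC x
  refine ⟨C ^ 2 + (C ^ 2 + (1 + K) ^ 2), by positivity,
    fun x => le_mul_truncSq (by positivity) (by positivity) (h1 x) ?_⟩
  rcases le_total 1 ‖x‖ with hx | hx
  · have h2 : 1 ≤ ‖x‖ ^ 2 := one_le_pow₀ hx
    nlinarith [h1 x, sq_nonneg C, sq_nonneg (1 + K)]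
  · have h2 : ‖c x‖ ≤ (1 + K) * ‖x‖ := by
      have h3 := norm_add_le (c x - x) x
      rw [sub_add_cancel] at h3
      nlinarith [h x, norm_nonneg x, mul_nonneg hK (norm_nonneg x)]
    have h3 : ‖c x‖ ^ 2 ≤ ((1 + K) * ‖x‖) ^ 2 := by gcongr
    rw [mul_pow] at h3
    nlinarith [mul_nonneg (sq_nonneg C) (sq_nonneg ‖x‖)]

lemma integrable_inner_sq (hc : IsRepresentationFunction c) (hcc : Continuous c)
    {η : Measure (Rd d)} (hη : Integrable truncSq η) (z : Rd d) :
    Integrable (fun x => (⟪z, c x⟫ : ℝ) ^ 2) η := by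
  obtain ⟨K, hK, h⟩ := hc.exists_norm_sq_le hcc
  refine integrable_of_le_truncSq hη (Continuous.aestronglyMeasurable (by fun_prop))
    (K := ‖z‖ ^ 2 * K) fun x => ?_
  rw [Real.norm_of_nonneg (sq_nonneg _), ← sq_abs, mul_assoc]
  calc |⟪z, c x⟫| ^ 2 ≤ (‖z‖ * ‖c x‖) ^ 2 := by gcongr; exact abs_real_inner_le_norm _ _
    _ ≤ _ := by rw [mul_pow]; gcongr; exact h x

lemma quadForm_momentMatrix (hc : IsRepresentationFunction c) (hcc : Continuous c)
    {η : Measure (Rd d)} (hη : Integrable truncSq η) (z : Rd d) :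
    quadForm (momentMatrix c η) z = ∫ x, (⟪z, c x⟫ : ℝ) ^ 2 ∂η := by
  obtain ⟨K, hK, h⟩ := hc.exists_norm_sq_le hcc
  have hint : ∀ i j : Fin d, Integrable (fun x => c x i * c x j) η := fun i j => by
    refine integrable_of_le_truncSq hη (Continuous.aestronglyMeasurable (by fun_prop))
      fun x => le_trans ?_ (h x)
    rw [norm_mul, sq]
    exact mul_le_mul (PiLp.norm_apply_le _ i) (PiLp.norm_apply_le _ j) (norm_nonneg _)
      (norm_nonneg _)
  have key : ∀ x : Rd d, (⟪z, c x⟫ : ℝ) ^ 2 = ∑ i, ∑ j, (c x i * c x j) * (z i * z j) := by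
    intro x
    simp only [PiLp.inner_apply, RCLike.inner_apply, conj_trivial, sq, Finset.sum_mul_sum]
    exact Finset.sum_congr rfl fun i _ => Finset.sum_congr rfl fun j _ => by ring
  simp only [quadForm_eq_sum, momentMatrix, Matrix.of_apply, key]
  rw [integral_finsetSum _ fun i _ => integrable_finsetSum _ fun j _ => (hint i j).mul_const _]
  refine Finset.sum_congr rfl fun i _ => ?_
  rw [integral_finsetSum _ fun j _ => (hint i j).mul_const _]
  exact Finset.sum_congr rfl fun j _ => (integral_mul_const _ _).symm

lemma quadForm_add (A B : Matrix (Fin d) (Fin d) ℝ) (z : Rd d) :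
    quadForm (A + B) z = quadForm A z + quadForm B z := by
  simp only [quadForm_eq_sum, Matrix.add_apply, add_mul, Finset.sum_add_distrib]

lemma quadForm_sub (A B : Matrix (Fin d) (Fin d) ℝ) (z : Rd d) :
    quadForm (A - B) z = quadForm A z - quadForm B z := by
  simp only [quadForm_eq_sum, Matrix.sub_apply, sub_mul, Finset.sum_sub_distrib]

/-- A pointwise limit of quadratic forms is a quadratic form. -/
lemma exists_quadForm_of_tendsto {B : ℕ → Matrix (Fin d) (Fin d) ℝ} (hB : ∀ n, (B n).IsSymm)
    {b : Rd d → ℝ} (h : ∀ z, Tendsto (fun n => quadForm (B n) z) atTop (𝓝 (b z))) :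
    ∃ B' : Matrix (Fin d) (Fin d) ℝ, B'.IsSymm ∧ ∀ z, quadForm B' z = b z := by
  let e : Fin d → Rd d := fun i => EuclideanSpace.single i 1
  -- Polarisation recovers each matrix entry from values of the form, so the entries converge too.
  let B' : Matrix (Fin d) (Fin d) ℝ := Matrix.of fun i j =>
    (b (e i + e j) - b (e i) - b (e j)) / 2
  have hent : ∀ i j, Tendsto (fun n => B n i j) atTop (𝓝 (B' i j)) := by
    intro i j
    have := (((h (e i + e j)).sub (h (e i))).sub (h (e j))).div_const 2
    refine this.congr fun n => ?_
    rw [quadForm_single_add_single (hB n), quadForm_single, quadForm_single]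
    ring
  refine ⟨B', ?_, fun z => tendsto_nhds_unique ?_ (h z)⟩
  · ext i j
    simp only [Matrix.transpose_apply, B', Matrix.of_apply, add_comm (e j)]
    ring
  · simp only [quadForm_eq_sum]
    exact tendsto_finsetSum _ fun i _ => tendsto_finsetSum _ fun j _ => (hent i j).mul_const _

/-- A pointwise limit of linear forms is a linear form. -/
lemma exists_inner_of_tendsto {γ : ℕ → Rd d} {b : Rd d → ℝ}
    (h : ∀ z, Tendsto (fun n => (⟪γ n, z⟫ : ℝ)) atTop (𝓝 (b z))) :
    ∃ γ' : Rd d, Tendsto γ atTop (𝓝 γ') ∧ ∀ z, (⟪γ', z⟫ : ℝ) = b z := by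
  let γ' : Rd d := WithLp.toLp 2 fun i => b (EuclideanSpace.single i 1)
  have hγ : Tendsto γ atTop (𝓝 γ') := by
    have h1 : Tendsto (fun n => (γ n).ofLp) atTop (𝓝 fun i => b (EuclideanSpace.single i 1)) := by
      refine tendsto_pi_nhds.2 fun i => ?_
      simpa [EuclideanSpace.inner_single_right] using h (EuclideanSpace.single i 1)
    exact ((PiLp.continuous_toLp 2 _).tendsto _).comp h1
  exact ⟨γ', hγ, fun z => tendsto_nhds_unique (hγ.inner tendsto_const_nhds) (h z)⟩

/-- Division by the weight turns functions of order `o(|x|^2)` that are dominated by `1 ∧ |x|^2`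
into bounded continuous functions vanishing at `0`. -/
lemma exists_bcf_inv_weight_smul {F : Rd d → ℂ} (hF : Continuous F) {K : ℝ}
    (hK : ∀ x, ‖F x‖ ≤ K * truncSq x) (ho : F =o[𝓝 0] fun x => ‖x‖ ^ 2) :
    ∃ H : Rd d →ᵇ ℂ, ∀ x, H x = (levyWeight x)⁻¹ • F x := by
  have hb : ∀ x, ‖(levyWeight x)⁻¹ • F x‖ ≤ 20 * |K| := by
    intro x
    rcases eq_or_ne x 0 with rfl | hx
    · simp [levyWeight_zero]
    have hw := levyWeight_pos hx
    rw [norm_smul, norm_inv, Real.norm_of_nonneg hw.le, inv_mul_le_iff₀ hw]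
    have h1 := truncSq_le_levyWeight x
    have h2 : K * truncSq x ≤ |K| * truncSq x := by
      have := truncSq_nonneg x
      gcongr
      exact le_abs_self K
    nlinarith [hK x, abs_nonneg K]
  have hcont : Continuous fun x => (levyWeight x)⁻¹ • F x := by
    refine continuous_iff_continuousAt.2 fun x => ?_
    rcases eq_or_ne x 0 with rfl | hx
    · rw [ContinuousAt, levyWeight_zero, inv_zero, zero_smul, Metric.tendsto_nhds]
      intro ε hε
      -- Near `0` the weight is at least `|x|² / 20`, so this makes the quotient at most `ε / 2`.
      have h1 := (Asymptotics.isLittleO_iff.1 ho) (show (0 : ℝ) < ε / 40 by positivity)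
      filter_upwards [h1, Metric.ball_mem_nhds (0 : Rd d) one_pos] with x hx hx1
      rw [dist_zero_right]
      rcases eq_or_ne x 0 with rfl | hx0
      · simpa [levyWeight_zero] using hε
      have hw := levyWeight_pos hx0
      rw [norm_smul, norm_inv, Real.norm_of_nonneg hw.le, inv_mul_lt_iff₀ hw]
      have h2 : truncSq x = ‖x‖ ^ 2 := by
        refine min_eq_right (pow_le_one₀ (norm_nonneg _) ?_)
        exact (by simpa using hx1 : ‖x‖ < 1).le
      have h3 := truncSq_le_levyWeight x
      rw [h2] at h3
      simp only [norm_pow, norm_norm] at hx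
      have h4 : 0 < ‖x‖ ^ 2 := by positivity
      nlinarith
    · exact (continuous_levyWeight.continuousAt.inv₀ (levyWeight_pos hx).ne').smul
        hF.continuousAt
  exact ⟨BoundedContinuousFunction.ofNormedAddCommGroup _ hcont _ hb, fun x => rfl⟩

/-- The Lévy measure extracted from a limit of the measures `levySmoothing`. -/
def unsmooth (N : Measure (Rd d)) : Measure (Rd d) :=
  (N.restrict {0}ᶜ).withDensity fun x => ENNReal.ofReal (levyWeight x)⁻¹

lemma measurable_inv_levyWeight :
    Measurable fun x : Rd d => ENNReal.ofReal (levyWeight x)⁻¹ :=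
  (continuous_levyWeight.measurable.inv).ennreal_ofReal

lemma unsmooth_zero (N : Measure (Rd d)) : unsmooth N {0} = 0 := by
  rw [unsmooth, withDensity_apply _ (measurableSet_singleton _), Measure.restrict_restrict
    (measurableSet_singleton _)]
  simp

lemma integral_unsmooth (N : Measure (Rd d)) (F : Rd d → ℂ) :
    ∫ x, F x ∂(unsmooth N) = ∫ x, (levyWeight x)⁻¹ • F x ∂N := by
  rw [unsmooth, integral_withDensity_eq_integral_toReal_smul
    measurable_inv_levyWeight (by simp)]
  simp only [ENNReal.toReal_ofReal (inv_nonneg.2 (levyWeight_nonneg _))]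
  -- The convention `0⁻¹ = 0` makes the integrand vanish at the origin, so an atom of `N` there does
  -- not count.
  refine setIntegral_eq_integral_of_forall_compl_eq_zero fun x hx => ?_
  have : x = 0 := by simpa using hx
  simp [this, levyWeight_zero]

lemma integrable_truncSq_unsmooth (N : Measure (Rd d)) [IsFiniteMeasure N] :
    Integrable truncSq (unsmooth N) := by
  rw [unsmooth, integrable_withDensity_iff_integrable_smul'
    measurable_inv_levyWeight (by simp)]
  refine Integrable.of_bound (Measurable.aestronglyMeasurable ?_) 20
    (Eventually.of_forall fun x => ?_)
  · exact measurable_inv_levyWeight.ennreal_toReal.smul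
      continuous_truncSq.measurable
  · rw [ENNReal.toReal_ofReal (inv_nonneg.2 (levyWeight_nonneg _)), smul_eq_mul,
      Real.norm_of_nonneg (mul_nonneg (inv_nonneg.2 (levyWeight_nonneg _)) (truncSq_nonneg x))]
    rcases eq_or_ne x 0 with rfl | hx
    · simp [levyWeight_zero]
    rw [inv_mul_le_iff₀ (levyWeight_pos hx)]
    linarith [truncSq_le_levyWeight x]

/-- **Convergence of generating triplets.** If the exponents of the triplets `(A n, π n, γ n)`
converge pointwise and locally boundedly to a continuous function `ψ`, then `ψ` is the exponent of
a triplet `(A, η, γ)`, and the triplets converge to it. -/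
theorem exists_triplet_of_tendsto (hc : IsRepresentationFunction c) (hcc : Continuous c)
    {A : ℕ → Matrix (Fin d) (Fin d) ℝ} {π : ℕ → Measure (Rd d)} {γ : ℕ → Rd d}
    (hAs : ∀ n, (A n).IsSymm) (hA : ∀ n z, 0 ≤ quadForm (A n) z) (hπ0 : ∀ n, π n {0} = 0)
    (hπ : ∀ n, Integrable truncSq (π n)) {ψ : Rd d → ℂ} (hψ : Continuous ψ)
    (hlim : ∀ z, Tendsto (fun n => levyExponent c (A n) (π n) (γ n) z) atTop (𝓝 (ψ z)))
    (hbdd : ∀ R, ∃ C, ∀ᶠ n in atTop, ∀ z, ‖z‖ ≤ R → ‖levyExponent c (A n) (π n) (γ n) z‖ ≤ C) :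
    ∃ (A' : Matrix (Fin d) (Fin d) ℝ) (η : Measure (Rd d)) (γ' : Rd d),
      A'.IsSymm ∧ η {0} = 0 ∧ Integrable truncSq η ∧
      (∀ z, ψ z = levyExponent c A' η γ' z) ∧
      (∃ C, ∀ᶠ n in atTop, ∫ x, truncSq x ∂(π n) ≤ C) ∧
      (∀ (F : Rd d → ℂ) (K : ℝ), Continuous F → (∀ x, ‖F x‖ ≤ K * truncSq x) →
        F =o[𝓝 0] (fun x => ‖x‖ ^ 2) →
        Tendsto (fun n => ∫ x, F x ∂(π n)) atTop (𝓝 (∫ x, F x ∂η))) ∧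
      Tendsto γ atTop (𝓝 γ') ∧
      ∀ z, Tendsto (fun n => quadForm (A n) z + ∫ x, (⟪z, c x⟫ : ℝ) ^ 2 ∂(π n)) atTop
        (𝓝 (quadForm A' z + ∫ x, (⟪z, c x⟫ : ℝ) ^ 2 ∂η)) := by
  have hsf : ∀ n, SFinite (π n) := fun n => sFinite_of_integrable_truncSq (hπ0 n) (hπ n)
  have hMfin : ∀ n, IsFiniteMeasure (levySmoothing (A n) (π n)) := fun n =>
    isFiniteMeasure_levySmoothing (A n) (hπ n)
  have htr : ∀ n, 0 ≤ ∑ i, A n i i / 6 := fun n => sum_diag_div_nonneg (hA n)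
  have hchar : ∀ z, Tendsto (fun n => charFun (levySmoothing (A n) (π n)) z) atTop
      (𝓝 (secondDifference ψ z)) := by
    intro z
    have := tendsto_secondDifference (fun n => continuous_levyExponent hc hcc (hπ n) (A n) (γ n))
      hlim hbdd z
    exact this.congr fun n => (charFun_levySmoothing hc hcc (A n) (htr n) (hπ n) (γ n) z).symm
  obtain ⟨N, hN, -, hNlim⟩ := exists_finite_charFun_eq_of_tendsto
    (continuous_secondDifference hψ).continuousAt hchar
  have hη := integrable_truncSq_unsmooth N
  -- The quotient of `F` by the weight is a bounded continuous test function vanishing at `0`. Hence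
  -- it sees neither the Gaussian atoms of the smoothed measures nor the atom of `N`, where small
  -- jumps may have accumulated.
  have hFlim : ∀ (F : Rd d → ℂ) (K : ℝ), Continuous F → (∀ x, ‖F x‖ ≤ K * truncSq x) →
      F =o[𝓝 0] (fun x => ‖x‖ ^ 2) →
      Tendsto (fun n => ∫ x, F x ∂(π n)) atTop (𝓝 (∫ x, F x ∂(unsmooth N))) := by
    intro F K hF hK ho
    obtain ⟨H, hH⟩ := exists_bcf_inv_weight_smul hF hK ho
    rw [integral_unsmooth]
    simp only [← hH]
    refine (hNlim H).congr fun n => ?_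
    rw [integral_levySmoothing (A n) (htr n) (hπ n) H.continuous H.norm_coe_le_norm, hH 0,
      levyWeight_zero, inv_zero, zero_smul, smul_zero, add_zero]
    refine integral_congr_ae (Eventually.of_forall fun x => ?_)
    simp only [hH]
    rcases eq_or_ne x 0 with rfl | hx
    · simp [levyWeight_zero, eq_zero_of_le_truncSq hK]
    · rw [smul_inv_smul₀ (levyWeight_pos hx).ne']
  -- The total masses of the smoothed measures converge, and `1 ∧ |x|²` is at most `20` times the
  -- weight.
  have hmass : ∃ C, ∀ᶠ n in atTop, ∫ x, truncSq x ∂(π n) ≤ C := by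
    have h1 : Tendsto (fun n => (charFun (levySmoothing (A n) (π n)) 0).re) atTop
        (𝓝 (secondDifference ψ 0).re) := (Complex.continuous_re.tendsto _).comp (hchar 0)
    refine ⟨20 * ((secondDifference ψ 0).re + 1), ?_⟩
    filter_upwards [h1.eventually (gt_mem_nhds (lt_add_one _))] with n hn
    have h2 := integral_levySmoothing (A n) (htr n) (hπ n) (F := fun _ => (1 : ℝ))
      continuous_const (K := 1) (by simp)
    simp only [integral_const, smul_eq_mul, mul_one] at h2
    rw [charFun_zero, Complex.ofReal_re, h2] at hn
    have h3 : ∫ x, truncSq x ∂(π n) ≤ ∫ x, 20 * levyWeight x ∂(π n) :=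
      integral_mono (hπ n) ((integrable_levyWeight (hπ n)).const_mul 20) fun x => by
        have := truncSq_le_levyWeight x
        simp only
        linarith
    rw [integral_const_mul] at h3
    linarith [htr n]
  -- the compensated kernels
  let G : Rd d → Rd d → ℂ := fun z x =>
    levyKernel c z x + (1 / 2 : ℂ) * ((⟪z, c x⟫ ^ 2 : ℝ) : ℂ)
  have hGc : ∀ z, Continuous (G z) := fun z => by
    have := continuous_levyKernel hcc z
    fun_prop
  have hGi : ∀ {m : Measure (Rd d)}, Integrable truncSq m → ∀ z, ∫ x, G z x ∂m
      = ∫ x, levyKernel c z x ∂m + (1 / 2 : ℂ) * ((∫ x, (⟪z, c x⟫ : ℝ) ^ 2 ∂m : ℝ) : ℂ) := by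
    intro m hm z
    have hi : Integrable (fun x => (1 / 2 : ℂ) * ((⟪z, c x⟫ ^ 2 : ℝ) : ℂ)) m :=
      ((integrable_inner_sq hc hcc hm z).ofReal).const_mul _
    rw [integral_add (integrable_levyKernel hc hcc hm z) hi, integral_const_mul,
      integral_complex_ofReal]
  have hGK : ∀ z, ∃ K, ∀ x, ‖G z x‖ ≤ K * truncSq x := by
    intro z
    obtain ⟨K₁, -, h₁⟩ := hc.exists_norm_levyKernel_le hcc
    obtain ⟨K₂, -, h₂⟩ := hc.exists_norm_sq_le hcc
    refine ⟨K₁ * (1 + ‖z‖) ^ 2 + ‖z‖ ^ 2 * K₂, fun x => (norm_add_le _ _).trans ?_⟩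
    rw [add_mul]
    refine add_le_add (h₁ z x) ?_
    rw [norm_mul, Complex.norm_real, Real.norm_of_nonneg (sq_nonneg _)]
    have h4 : ‖(1 / 2 : ℂ)‖ = 1 / 2 := by norm_num
    have h5 : (⟪z, c x⟫ : ℝ) ^ 2 ≤ ‖z‖ ^ 2 * ‖c x‖ ^ 2 := by
      rw [← sq_abs, ← mul_pow]; gcongr; exact abs_real_inner_le_norm z _
    have h6 : ‖z‖ ^ 2 * ‖c x‖ ^ 2 ≤ ‖z‖ ^ 2 * (K₂ * truncSq x) := by gcongr; exact h₂ x
    rw [h4]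
    nlinarith [sq_nonneg (⟪z, c x⟫ : ℝ)]
  have hdiff : ∀ z, Tendsto (fun n => levyExponent c (A n) (π n) (γ n) z - ∫ x, G z x ∂(π n)) atTop
      (𝓝 (ψ z - ∫ x, G z x ∂(unsmooth N))) := fun z => by
    obtain ⟨K, hK⟩ := hGK z
    exact (hlim z).sub (hFlim (G z) K (hGc z) hK (hc.isLittleO_levyKernel_add hcc z))
  -- Once the compensated kernel is removed, the drift is the imaginary part and a single quadratic
  -- form the real part, so the two converge separately.
  have hform : ∀ n z, levyExponent c (A n) (π n) (γ n) z - ∫ x, G z x ∂(π n)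
      = Complex.I * (⟪γ n, z⟫ : ℝ)
        - (1 / 2 : ℂ) * (quadForm (A n + momentMatrix c (π n)) z : ℝ) := by
    intro n z
    rw [hGi (hπ n), levyExponent, quadForm_add, quadForm_momentMatrix hc hcc (hπ n)]
    push_cast
    ring
  simp only [hform] at hdiff
  obtain ⟨γ', hγ', hγz⟩ := exists_inner_of_tendsto (γ := γ)
    (b := fun z => (ψ z - ∫ x, G z x ∂(unsmooth N)).im) fun z => by
      simpa [Function.comp_def] using (Complex.continuous_im.tendsto _).comp (hdiff z)
  have hBlim : ∀ z, Tendsto (fun n => quadForm (A n + momentMatrix c (π n)) z) atTop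
      (𝓝 (-2 * (ψ z - ∫ x, G z x ∂(unsmooth N)).re)) := fun z => by
    have := ((Complex.continuous_re.tendsto _).comp (hdiff z)).const_mul (-2)
    refine this.congr fun n => ?_
    simp
  obtain ⟨B, hBs, hB⟩ := exists_quadForm_of_tendsto
    (fun n => (hAs n).add (momentMatrix_isSymm c (π n))) hBlim
  -- The limiting form `B` also contains the second moments of `c` under the limiting jump measure;
  -- subtracting them leaves the Gaussian matrix. Its positivity is not needed here and is derived
  -- later from `IsCharacteristicTriplet.quadForm_nonneg`.
  refine ⟨B - momentMatrix c (unsmooth N), unsmooth N, γ',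
    hBs.sub (momentMatrix_isSymm c _), unsmooth_zero N, hη, fun z => ?_, hmass, hFlim, hγ',
    fun z => ?_⟩
  · have h1 : ψ z - ∫ x, G z x ∂(unsmooth N)
        = Complex.I * (⟪γ', z⟫ : ℝ) - (1 / 2 : ℂ) * (quadForm B z : ℝ) := by
      rw [hγz, hB]
      apply Complex.ext <;> simp
    rw [hGi hη, sub_eq_iff_eq_add] at h1
    rw [h1, levyExponent, quadForm_sub, quadForm_momentMatrix hc hcc hη]
    push_cast
    ring
  · rw [quadForm_sub, quadForm_momentMatrix hc hcc hη, sub_add_cancel, hB]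
    refine (hBlim z).congr fun n => ?_
    rw [quadForm_add, quadForm_momentMatrix hc hcc (hπ n)]

/-! ### Truncated second moments -/

/-- The difference of squares factors into `⟨z, c x - x⟩ = O(|x|²)` and `⟨z, c x + x⟩`, which tends
to `0`. -/
lemma inner_sq_sub_isLittleO (hc : IsRepresentationFunction c) (hcc : Continuous c) (z : Rd d) :
    ∀ ρ > 0, ∀ᶠ x in 𝓝 (0 : Rd d), |(⟪z, c x⟫ : ℝ) ^ 2 - ⟪z, x⟫ ^ 2| ≤ ρ * ‖x‖ ^ 2 := by
  intro ρ hρ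
  obtain ⟨K, hK, h⟩ := hc.exists_norm_sub_le hcc
  have hcont : Continuous fun x : Rd d => ‖z‖ * (‖z‖ * K) * (‖c x‖ + ‖x‖) := by fun_prop
  have h0 : ∀ᶠ x in 𝓝 (0 : Rd d), ‖z‖ * (‖z‖ * K) * (‖c x‖ + ‖x‖) < ρ :=
    (hcont.tendsto 0).eventually (gt_mem_nhds (by simpa [hc.map_zero hcc] using hρ))
  filter_upwards [h0] with x hx
  have e : (⟪z, c x⟫ : ℝ) ^ 2 - ⟪z, x⟫ ^ 2 = ⟪z, c x - x⟫ * ⟪z, c x + x⟫ := by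
    rw [inner_sub_right, inner_add_right]; ring
  rw [e, abs_mul]
  calc |⟪z, c x - x⟫| * |⟪z, c x + x⟫|
      ≤ (‖z‖ * (K * ‖x‖ ^ 2)) * (‖z‖ * (‖c x‖ + ‖x‖)) := by
        gcongr
        · exact (abs_real_inner_le_norm _ _).trans (by gcongr; exact h x)
        · exact (abs_real_inner_le_norm _ _).trans (by gcongr; exact norm_add_le _ _)
    _ = ‖z‖ * (‖z‖ * K) * (‖c x‖ + ‖x‖) * ‖x‖ ^ 2 := by ring
    _ ≤ ρ * ‖x‖ ^ 2 := by gcongr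

/-- The second moments near `0` are asymptotically those of the compensator. -/
lemma eventually_abs_truncated_sub_le (hc : IsRepresentationFunction c) (hcc : Continuous c)
    {π : ℕ → Measure (Rd d)} {η : Measure (Rd d)} (hπ : ∀ n, Integrable truncSq (π n))
    (hη : Integrable truncSq η) {C : ℝ} (hC : ∀ᶠ n in atTop, ∫ x, truncSq x ∂(π n) ≤ C)
    (hlim : ∀ (F : Rd d → ℝ) (K : ℝ), Continuous F → (∀ x, ‖F x‖ ≤ K * truncSq x) →
        (∀ᶠ x in 𝓝 0, F x = 0) →
        Tendsto (fun n => ∫ x, F x ∂(π n)) atTop (𝓝 (∫ x, F x ∂η)))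
    (z : Rd d) {δ : ℝ} (hδ : 0 < δ) :
    ∀ᶠ ε in 𝓝[>] (0 : ℝ), ∀ᶠ n in atTop,
      |∫ x, (⟪z, c x⟫ : ℝ) ^ 2 ∂(π n) - ∫ x in Metric.closedBall (0 : Rd d) ε, ⟪z, x⟫ ^ 2 ∂(π n)
        - ∫ x, (⟪z, c x⟫ : ℝ) ^ 2 ∂η| ≤ δ := by
  obtain ⟨K, hK, hcK⟩ := hc.exists_norm_sq_le hcc
  set h : Rd d → ℝ := fun x => (⟪z, c x⟫ : ℝ) ^ 2
  have hh0 : ∀ x, 0 ≤ h x := fun x => sq_nonneg _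
  have hhc : Continuous h := by fun_prop
  have hhK : ∀ x, ‖h x‖ ≤ (‖z‖ ^ 2 * K) * truncSq x := fun x => by
    rw [Real.norm_of_nonneg (hh0 x), mul_assoc]
    calc h x = |⟪z, c x⟫| ^ 2 := (sq_abs _).symm
      _ ≤ (‖z‖ * ‖c x‖) ^ 2 := by gcongr; exact abs_real_inner_le_norm _ _
      _ ≤ _ := by rw [mul_pow]; gcongr; exact hcK x
  have hcut := tendsto_integral_mul_cutoff hη hhc hhK
  have hhalf : Tendsto (fun ε : ℝ => ε / 2) (𝓝[>] 0) (𝓝[>] 0) := by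
    refine tendsto_nhdsWithin_iff.2 ⟨?_, ?_⟩
    · have : Continuous fun ε : ℝ => ε / 2 := by fun_prop
      simpa using (this.tendsto 0).mono_left nhdsWithin_le_nhds
    · filter_upwards [self_mem_nhdsWithin] with ε hε
      have : 0 < ε := hε
      simpa using this
  have h1 := Metric.tendsto_nhds.1 hcut (δ / 4) (by positivity)
  have h2 := Metric.tendsto_nhds.1 (hcut.comp hhalf) (δ / 4) (by positivity)
  -- Chosen so that `ρ` times the eventually bounded integral of `1 ∧ |x|²` is at most `δ / 4`.
  have hρ : 0 < δ / (4 * (|C| + 1)) := by positivity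
  set ρ := δ / (4 * (|C| + 1))
  obtain ⟨r, hr, hball⟩ := Metric.eventually_nhds_iff.1 (inner_sq_sub_isLittleO hc hcc z ρ hρ)
  filter_upwards [h1, h2, Ioo_mem_nhdsGT (lt_min hr one_pos)] with ε hε1 hε2 hε
  have hε0 : 0 < ε := hε.1
  have hεr : ε < r := hε.2.trans_le (min_le_left _ _)
  have hε_one : ε < 1 := hε.2.trans_le (min_le_right _ _)
  have hvan : ∀ s : ℝ, 0 < s → ∀ᶠ x in 𝓝 (0 : Rd d), h x * cutoff s x = 0 := fun s hs => by
    filter_upwards [Metric.closedBall_mem_nhds (0 : Rd d) hs] with x hx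
    rw [cutoff_eq_zero hs (by simpa using hx), mul_zero]
  have hl := fun (s : ℝ) (hs : 0 < s) => hlim (fun x => h x * cutoff s x) _
    (hhc.mul (continuous_cutoff s)) (norm_mul_cutoff_le hhK s) (hvan s hs)
  have h3 := Metric.tendsto_nhds.1 (hl ε hε0) (δ / 4) (by positivity)
  have h4 := Metric.tendsto_nhds.1 (hl (ε / 2) (by positivity)) (δ / 4) (by positivity)
  filter_upwards [h3, h4, hC] with n hn3 hn4 hnC
  have hB : MeasurableSet (Metric.closedBall (0 : Rd d) ε) :=
    Metric.isClosed_closedBall.measurableSet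
  rw [← integral_indicator hB]
  set q : Rd d → ℝ := (Metric.closedBall (0 : Rd d) ε).indicator fun x => (⟪z, x⟫ : ℝ) ^ 2
  have hhi : Integrable h (π n) :=
    integrable_of_le_truncSq (hπ n) hhc.aestronglyMeasurable hhK
  have hci : ∀ s, Integrable (fun x => h x * cutoff s x) (π n) := fun s =>
    integrable_of_le_truncSq (hπ n) (hhc.mul (continuous_cutoff s)).aestronglyMeasurable
      (norm_mul_cutoff_le hhK s)
  have hin : ∀ x, x ∈ Metric.closedBall (0 : Rd d) ε →
      ‖x‖ ≤ ε ∧ truncSq x = ‖x‖ ^ 2 ∧ |h x - ⟪z, x⟫ ^ 2| ≤ ρ * truncSq x := by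
    intro x hx
    have hx' : ‖x‖ ≤ ε := by simpa using hx
    have ht : truncSq x = ‖x‖ ^ 2 :=
      min_eq_right (pow_le_one₀ (norm_nonneg _) (hx'.trans hε_one.le))
    refine ⟨hx', ht, ?_⟩
    rw [ht]
    exact hball (by simpa using hx'.trans_lt hεr)
  have hqi : Integrable q (π n) := by
    refine integrable_of_le_truncSq (hπ n) (K := ‖z‖ ^ 2 * K + ρ) (Measurable.aestronglyMeasurable
      (Measurable.indicator (Continuous.measurable (by fun_prop)) hB)) fun x => ?_
    by_cases hx : x ∈ Metric.closedBall (0 : Rd d) ε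
    · simp only [q, Set.indicator_of_mem hx]
      obtain ⟨-, -, hx3⟩ := hin x hx
      have h5 := hhK x
      rw [Real.norm_of_nonneg (hh0 x)] at h5
      rw [Real.norm_of_nonneg (sq_nonneg _)]
      have := abs_le.1 hx3
      linarith
    · simp only [q, Set.indicator_of_notMem hx, norm_zero]
      have := truncSq_nonneg x
      positivity
  -- Sandwich for the discontinuous truncation: `cutoff ε` vanishes on the ball of radius `ε`, while
  -- `cutoff (ε / 2)` equals `1` outside it. Both bounds are integrals whose limits in `n` are known
  -- up to the error in `ρ`.
  have hlow : ∀ x, h x * cutoff ε x - ρ * truncSq x ≤ h x - q x := by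
    intro x
    by_cases hx : x ∈ Metric.closedBall (0 : Rd d) ε
    · obtain ⟨hx1, -, hx3⟩ := hin x hx
      simp only [q, Set.indicator_of_mem hx]
      rw [cutoff_eq_zero hε0 hx1]
      linarith [(abs_le.1 hx3).1]
    · simp only [q, Set.indicator_of_notMem hx]
      have := mul_le_of_le_one_right (hh0 x) (cutoff_le_one ε x)
      have := mul_nonneg hρ.le (truncSq_nonneg x)
      linarith
  have hupp : ∀ x, h x - q x ≤ h x * cutoff (ε / 2) x + ρ * truncSq x := by
    intro x
    by_cases hx : x ∈ Metric.closedBall (0 : Rd d) ε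
    · obtain ⟨-, -, hx3⟩ := hin x hx
      simp only [q, Set.indicator_of_mem hx]
      have := mul_nonneg (hh0 x) (cutoff_nonneg (ε / 2) x)
      linarith [(abs_le.1 hx3).2]
    · have hx' : ε < ‖x‖ := by simpa using hx
      simp only [q, Set.indicator_of_notMem hx]
      rw [cutoff_eq_one (by positivity) (by linarith)]
      have := mul_nonneg hρ.le (truncSq_nonneg x)
      linarith
  have i1 := integral_mono ((hci ε).sub ((hπ n).const_mul ρ)) (hhi.sub hqi) hlow
  have i2 := integral_mono (hhi.sub hqi) ((hci (ε / 2)).add ((hπ n).const_mul ρ)) hupp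
  simp only [Pi.sub_apply, Pi.add_apply] at i1 i2
  rw [integral_sub (hci ε) ((hπ n).const_mul ρ), integral_sub hhi hqi, integral_const_mul] at i1
  rw [integral_add (hci _) ((hπ n).const_mul ρ), integral_sub hhi hqi, integral_const_mul] at i2
  have hρC : ρ * ∫ x, truncSq x ∂(π n) ≤ δ / 4 := by
    calc ρ * ∫ x, truncSq x ∂(π n) ≤ ρ * (|C| + 1) := by
          gcongr; linarith [le_abs_self C]
      _ = δ / 4 := by simp only [ρ]; field_simp
  rw [Real.dist_eq, abs_lt] at hn3 hn4 hε1
  simp only [Function.comp_apply, Real.dist_eq, abs_lt] at hε2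
  rw [abs_le]
  constructor <;> linarith [hn3.1, hn3.2, hn4.1, hn4.2, hε1.1, hε1.2, hε2.1, hε2.2]

/-! ### The limit theorem -/

/-- The Gaussian part scales exactly by `4`, and for the jumps `1 - cos 2t ≤ 4 (1 - cos t)`, the
difference being `2 (1 - cos t)²`. -/
lemma norm_exp_levyExponent_pow_four_le (hc : IsRepresentationFunction c) (hcc : Continuous c)
    {η : Measure (Rd d)} (hη : Integrable truncSq η) (A : Matrix (Fin d) (Fin d) ℝ) (γ z : Rd d) :
    ‖Complex.exp (levyExponent c A η γ z)‖ ^ 4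
      ≤ ‖Complex.exp (levyExponent c A η γ ((2 : ℝ) • z))‖ := by
  rw [Complex.norm_exp, Complex.norm_exp, ← Real.exp_nat_mul, Real.exp_le_exp,
    levyExponent_re hc hcc hη, levyExponent_re hc hcc hη, quadForm_smul]
  have h1 : ∫ x, 4 * (Real.cos ⟪z, x⟫ - 1) ∂η ≤ ∫ x, (Real.cos ⟪(2 : ℝ) • z, x⟫ - 1) ∂η := by
    refine integral_mono ((integrable_cos_inner_sub_one hη z).const_mul 4)
      (integrable_cos_inner_sub_one hη _) fun x => ?_
    simp only [real_inner_smul_left, Real.cos_two_mul]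
    nlinarith [sq_nonneg (Real.cos ⟪z, x⟫ - 1)]
  rw [integral_const_mul] at h1
  push_cast
  linarith

/-- The limit theorem in terms of exponents. -/
theorem exists_triplet_of_tendsto_probabilityMeasure
    (hc : IsRepresentationFunction c) (hcc : Continuous c)
    {μn : ℕ → ProbabilityMeasure (Rd d)} {An : ℕ → Matrix (Fin d) (Fin d) ℝ}
    {νn : ℕ → SignedMeasureAwayZero d} {γn : ℕ → Rd d}
    (htriplet : ∀ n, IsCharacteristicTriplet c (μn n) (An n) (νn n) (γn n))
    {μ : ProbabilityMeasure (Rd d)} (hμ : Tendsto μn atTop (𝓝 μ))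
    {σ : Measure (Rd d)} (hσ : Integrable truncSq σ)
    (hneg : ∀ f ∈ CSharp d,
      Tendsto (fun n => ∫ x, f x ∂(νn n).negPart) atTop (𝓝 (∫ x, f x ∂σ)))
    (hsmall : Tendsto
      (fun ε : ℝ => limsup
        (fun n => ∫⁻ x in Metric.closedBall (0 : Rd d) ε, ‖x‖ₑ ^ 2 ∂(νn n).negPart) atTop)
      (𝓝[>] 0) (𝓝 0)) :
    ∃ (A' : Matrix (Fin d) (Fin d) ℝ) (η : Measure (Rd d)) (γ' : Rd d),
      A'.IsSymm ∧ η {0} = 0 ∧ Integrable truncSq η ∧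
      (∀ z, charFun (μ : Measure (Rd d)) z
        = Complex.exp (levyExponent c A' η γ' z - ∫ x, levyKernel c z x ∂σ)) ∧
      (∃ C, ∀ᶠ n in atTop, ∫ x, truncSq x ∂(νn n).posPart ≤ C) ∧
      (∀ (F : Rd d → ℂ) (K : ℝ), Continuous F → (∀ x, ‖F x‖ ≤ K * truncSq x) →
        F =o[𝓝 0] (fun x => ‖x‖ ^ 2) →
        Tendsto (fun n => ∫ x, F x ∂(νn n).posPart) atTop (𝓝 (∫ x, F x ∂η))) ∧
      Tendsto γn atTop (𝓝 γ') ∧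
      ∀ z, Tendsto (fun n => quadForm (An n) z + ∫ x, (⟪z, c x⟫ : ℝ) ^ 2 ∂(νn n).posPart) atTop
        (𝓝 (quadForm A' z + ∫ x, (⟪z, c x⟫ : ℝ) ^ 2 ∂η)) := by
  have hp := fun n => (htriplet n).quasiLevy.integrable_posPart
  have hn := fun n => (htriplet n).quasiLevy.integrable_negPart
  have hreal := fun (F : Rd d → ℝ) (hF : Continuous F) (K : ℝ) hK =>
    tendsto_integral_of_small_jumps hn hσ hneg hsmall hF (K := K) hK
  obtain ⟨K, hK, hker⟩ := hc.exists_norm_levyKernel_le hcc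
  have hnegker : ∀ z, Tendsto (fun n => ∫ x, levyKernel c z x ∂(νn n).negPart) atTop
      (𝓝 (∫ x, levyKernel c z x ∂σ)) := fun z => by
    have hk := continuous_levyKernel hcc z
    refine tendsto_complex_integral (fun n => integrable_levyKernel hc hcc (hn n) z)
      (integrable_levyKernel hc hcc hσ z) ?_ ?_
    · exact hreal _ (Complex.continuous_re.comp hk) _ fun x =>
        (Complex.abs_re_le_norm _).trans (hker z x)
    · exact hreal _ (Complex.continuous_im.comp hk) _ fun x =>
        (Complex.abs_im_le_norm _).trans (hker z x)
  obtain ⟨D, hD⟩ : ∃ D, ∀ᶠ n in atTop, ∫ x, truncSq x ∂(νn n).negPart ≤ D := by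
    have := hreal truncSq continuous_truncSq 1 fun x => by
      rw [Real.norm_of_nonneg (truncSq_nonneg x), one_mul]
    exact ⟨_, (this.eventually (gt_mem_nhds (lt_add_one _))).mono fun n h => h.le⟩
  let Ψ : ℕ → Rd d → ℂ := fun n z =>
    levyExponent c (An n) (νn n).posPart (γn n) z - ∫ x, levyKernel c z x ∂(νn n).negPart
  have hΨc : ∀ n, Continuous (Ψ n) := fun n =>
    (continuous_levyExponent hc hcc (hp n) _ _).sub (continuous_integral_levyKernel hc hcc (hn n))
  have hΨ0 : ∀ n, Ψ n 0 = 0 := fun n => by simp [Ψ, levyExponent_zero, levyKernel_zero]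
  have hΨexp : ∀ n z, Complex.exp (Ψ n z) = charFun (μn n : Measure (Rd d)) z := fun n z =>
    ((htriplet n).charFun_eq_exp z).symm
  have hσc := continuous_integral_levyKernel hc hcc hσ
  have hcharlim := ProbabilityMeasure.tendsto_iff_tendsto_charFun.1 hμ
  -- The doubling inequality is available only for positive jump measures, so it is applied to `e`,
  -- the limit of the exponentials of the exponents with jump measures `νₙ⁺`.
  have hne : ∀ z, charFun (μ : Measure (Rd d)) z ≠ 0 := by
    let e : Rd d → ℂ := fun z =>
      charFun (μ : Measure (Rd d)) z * Complex.exp (∫ x, levyKernel c z x ∂σ)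
    have he : ∀ z, Tendsto (fun n => Complex.exp
        (levyExponent c (An n) (νn n).posPart (γn n) z)) atTop (𝓝 (e z)) := fun z => by
      have := (hcharlim z).mul ((Complex.continuous_exp.tendsto _).comp (hnegker z))
      refine this.congr fun n => ?_
      rw [Function.comp_apply, ← hΨexp, ← Complex.exp_add]
      simp only [Ψ, sub_add_cancel]
    have hec : Continuous e := continuous_charFun.mul (Complex.continuous_exp.comp hσc)
    have hez := ne_zero_of_norm_pow_four_le (e := e) hec.continuousAt
      (by simp [e, levyKernel_zero]) (fun z =>
        le_of_tendsto_of_tendsto' ((he z).norm.pow 4) (he _).norm fun n =>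
          norm_exp_levyExponent_pow_four_le hc hcc (hp n) _ _ z)
    exact fun z => left_ne_zero_of_mul (hez z)
  obtain ⟨G, hGc, hGlim, hGb, hGexp⟩ := exists_log_limit hΨc hΨ0
    (φ := charFun (μ : Measure (Rd d))) continuous_charFun hne (by
      simp only [hΨexp]
      exact tendstoLocallyUniformly_charFun hμ)
  obtain ⟨A', η, γ', h1, h2, h3, h4, h5⟩ := exists_triplet_of_tendsto hc hcc
    (π := fun n => (νn n).posPart) (γ := γn) (fun n => (htriplet n).symm)
    (fun n => (htriplet n).quadForm_nonneg hc hcc) (fun n => (νn n).posPart_zero) hp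
    (ψ := fun z => G z + ∫ x, levyKernel c z x ∂σ) (hGc.add hσc)
    (fun z => ((hGlim z).add (hnegker z)).congr fun n => by simp only [Ψ, sub_add_cancel])
    (fun R => by
      obtain ⟨C, hC⟩ := hGb R
      refine ⟨C + K * (1 + |R|) ^ 2 * D, ?_⟩
      filter_upwards [hC, hD] with n hnC hnD z hz
      have e1 : levyExponent c (An n) (νn n).posPart (γn n) z
          = Ψ n z + ∫ x, levyKernel c z x ∂(νn n).negPart := by simp only [Ψ, sub_add_cancel]
      rw [e1]
      refine (norm_add_le _ _).trans (add_le_add (hnC z hz) ?_)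
      calc ‖∫ x, levyKernel c z x ∂(νn n).negPart‖
          ≤ ∫ x, K * (1 + |R|) ^ 2 * truncSq x ∂(νn n).negPart := by
            refine norm_integral_le_of_norm_le ((hn n).const_mul _)
              (Eventually.of_forall fun x => (hker z x).trans ?_)
            have := truncSq_nonneg x
            have : ‖z‖ ≤ |R| := hz.trans (le_abs_self R)
            gcongr
        _ = K * (1 + |R|) ^ 2 * ∫ x, truncSq x ∂(νn n).negPart := integral_const_mul _ _
        _ ≤ _ := by gcongr)
  exact ⟨A', η, γ', h1, h2, h3, fun z => by rw [← hGexp, ← h4, add_sub_cancel_right], h5⟩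

end QID

end

theorem mainTheorem7 {d : ℕ} (c : QID.Rd d → QID.Rd d)
    (hc : QID.IsRepresentationFunction c) (hc_cont : Continuous c)
    (μn : ℕ → ProbabilityMeasure (QID.Rd d))
    (An : ℕ → Matrix (Fin d) (Fin d) ℝ) (νn : ℕ → QID.SignedMeasureAwayZero d)
    (γn : ℕ → QID.Rd d)
    (hμn : ∀ n, QID.IsQuasiInfinitelyDivisible (μn n))
    (htriplet : ∀ n, QID.IsCharacteristicTriplet c (μn n) (An n) (νn n) (γn n))
    (μ : ProbabilityMeasure (QID.Rd d)) (hμ : Tendsto μn atTop (𝓝 μ))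
    (σ : Measure (QID.Rd d)) (hσ : QID.IsLevyMeasure σ)
    (hneg : ∀ f ∈ QID.CSharp d,
      Tendsto (fun n => ∫ x, f x ∂(νn n).negPart) atTop (𝓝 (∫ x, f x ∂σ)))
    (hsmall : Tendsto
      (fun ε : ℝ => limsup
        (fun n => ∫⁻ x in Metric.closedBall (0 : QID.Rd d) ε, ‖x‖ₑ ^ 2 ∂(νn n).negPart) atTop)
      (𝓝[>] 0) (𝓝 0)) :
    QID.IsQuasiInfinitelyDivisible μ ∧
    (∃ A ν γ, QID.IsCharacteristicTriplet c μ A ν γ) ∧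
    ∀ A ν γ, QID.IsCharacteristicTriplet c μ A ν γ →
      (∃ η : Measure (QID.Rd d), QID.IsLevyMeasure η ∧
        (∀ B : QID.BorelAwayZero d, η.real B = ν.toFun B + σ.real B) ∧
        ∀ f ∈ QID.CSharp d,
          Tendsto (fun n => ∫ x, f x ∂(νn n).posPart) atTop (𝓝 (∫ x, f x ∂η))) ∧
      Tendsto γn atTop (𝓝 γ) ∧
      ∀ z : QID.Rd d, Tendsto
        (fun ε : ℝ => limsup
          (fun n => ENNReal.ofReal
            |QID.quadForm (QID.truncatedGaussian (An n) (νn n) ε) z - QID.quadForm A z|) atTop)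
        (𝓝[>] 0) (𝓝 0) := by
  open QID in
  have hσi := hσ.integrable_truncSq
  obtain ⟨A', η, γ', hAs, hη0, hη, hchar, ⟨C, hC⟩, hF, hγ, hq⟩ :=
    exists_triplet_of_tendsto_probabilityMeasure hc hc_cont htriplet hμ hσi hneg hsmall
  have htri := isCharacteristicTriplet_levySub hc hc_cont hAs hη hσi hη0 hσ.1 hchar
  have hFreal : ∀ (F : Rd d → ℝ) (K : ℝ), Continuous F → (∀ x, ‖F x‖ ≤ K * truncSq x) →
      (∀ᶠ x in 𝓝 0, F x = 0) →
      Tendsto (fun n => ∫ x, F x ∂(νn n).posPart) atTop (𝓝 (∫ x, F x ∂η)) := by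
    intro F K hFc hK h0
    have h1 := hF (fun x => (F x : ℂ)) K (by fun_prop) (fun x => by
      rw [Complex.norm_real]; exact hK x)
      ((Asymptotics.isLittleO_zero _ _).congr' (by
        filter_upwards [h0] with x hx; simp [hx]) EventuallyEq.rfl)
    simp only [integral_complex_ofReal] at h1
    simpa [Function.comp_def] using (Complex.continuous_re.tendsto _).comp h1
  refine ⟨?_, ⟨A', _, γ', htri⟩, fun A ν γ hA => ?_⟩
  -- The numerator has triplet `(A', η, γ')` and the denominator `(0, σ, 0)`.
  · obtain ⟨P₁, hP₁, h₁⟩ := exists_isInfinitelyDivisible hc hc_cont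
      (posSemidef_of_quadForm_nonneg hAs (htri.quadForm_nonneg hc hc_cont)) hη γ'
    obtain ⟨P₂, hP₂, h₂⟩ := exists_isInfinitelyDivisible hc hc_cont
      (Matrix.PosSemidef.zero (n := Fin d) (R := ℝ)) hσi 0
    refine ⟨P₁, P₂, hP₁, hP₂, fun z => ?_⟩
    rw [hchar, Complex.exp_sub, h₁, h₂]
    simp [levyExponent, quadForm_eq_sum]
  · obtain ⟨rfl, rfl, hB⟩ := hA.eq_of_charFun_eq hc hc_cont hAs hη hσi hη0 hσ.1 hchar
    refine ⟨⟨η, isLevyMeasure_of_integrable hη0 hη, hB, fun f hf => ?_⟩, hγ, fun z => ?_⟩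
    · obtain ⟨r, hr, hball⟩ := Metric.eventually_nhds_iff.1 hf
      have hr2 : 0 < min 1 (r ^ 2) := by positivity
      -- Where `f` may be nonzero, `|x| ≥ r` and hence `1 ∧ |x|² ≥ 1 ∧ r²`.
      refine hFreal f (‖f‖ / min 1 (r ^ 2)) f.continuous (fun x => ?_) hf
      rcases lt_or_ge ‖x‖ r with hx | hx
      · rw [hball (by simpa using hx), norm_zero]
        have := truncSq_nonneg x
        positivity
      · refine (f.norm_coe_le_norm x).trans ?_
        rw [div_mul_eq_mul_div, le_div_iff₀ hr2]
        have : min 1 (r ^ 2) ≤ truncSq x := by unfold truncSq; gcongr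
        gcongr
    · rw [ENNReal.tendsto_nhds_zero]
      intro δ hδ
      obtain ⟨δ', hδ', hle⟩ : ∃ δ' : ℝ, 0 < δ' ∧ ENNReal.ofReal δ' ≤ δ := by
        rcases eq_or_ne δ ∞ with rfl | hδt
        · exact ⟨1, one_pos, le_top⟩
        · exact ⟨δ.toReal, ENNReal.toReal_pos hδ.ne' hδt, ENNReal.ofReal_toReal_le⟩
      -- Replacing the truncated second moment by that of `c` costs `δ' / 2`, and so does the
      -- convergence of the combined quadratic forms.
      filter_upwards [eventually_abs_truncated_sub_le hc hc_cont
        (fun n => (htriplet n).quasiLevy.integrable_posPart) hη hC hFreal z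
        (half_pos hδ')] with ε hε
      refine (limsup_le_of_le (h := ?_)).trans hle
      filter_upwards [hε, Metric.tendsto_nhds.1 (hq z) (δ' / 2) (half_pos hδ')] with n h1 h2
      refine ENNReal.ofReal_le_ofReal ?_
      rw [quadForm_truncatedGaussian _ (htriplet n).quasiLevy]
      rw [Real.dist_eq] at h2
      rw [abs_lt] at h2
      rw [abs_le] at h1 ⊢
      constructor <;> linarith [h1.1, h1.2, h2.1, h2.2]
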